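/- **Setting.** Let $y_1,\dots,y_N\in\mathbb R^2$ be distinct points, $\alpha_1,\dots,\alpha_N\in C^1(\mathbb R)$ real valued, $\lambda>0$, and let $\gamma$ be the Euler–Mascheroni constant, $\Gamma$ the Gamma function and $K_0$ the modified Bessel function of the second kind of order $0$. For $c\in\mathbb C^N$ put $$S_c(x)=\frac1{2\pi}\sum_{j=1}^N c_j\,K_0(\sqrt\lambda\,|x-y_j|),\qquad x\in\mathbb R^2 .$$ The form domain is $\mathscr D[\mathcal F]=\{\psi\in L^2(\mathbb R^2):\ \psi-S_c\in H^1(\mathbb R^2)\text{ for some }c\in\mathbb C^N\}$. The operator domain $\mathscr D(H_{\alpha(s)})$ consists of all $\psi\in L^2(\mathbb R^2)$ for which there is $c\in\mathbb C^N$ (the charges of $\psi$) such that $\phi=\psi-S_c\in H^2(\mathbb R^2)$ and, for all $j$, $$\lim_{x\to y_j}\phi(x)=\Big(\alpha_j(s)+\tfrac1{2\pi}\log\tfrac{\sqrt\lambda}2+\tfrac{\gamma}{2\pi}\Big)c_j-\frac1{2\pi}\sum_{k\ne j}K_0(\sqrt\lambda|y_j-y_k|)\,c_k .$$ Let $U_0(t)=e^{it\Delta}$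 on $L^2(\mathbb R^2)$, and $U_0(t;r)=\dfrac{e^{-r^2/(4it)}}{2it}$ for $t\neq0$, $r\ge0$. Let $\mathcal I(t)=\int_0^\infty \frac{t^{u-1}}{\Gamma(u)}\,du$ for $t>0$ and $\mathcal I(t)=-\mathcal I(-t)$ for $t<0$. Let $s\in\mathbb R$, let $\psi_s\in\mathscr D(H_{\alpha(s)})$ have charges $c$, and let $J\subseteq\mathbb R$ be an interval containing $s$ (for instance $J=\mathbb R$). A *solution of the charge equation on $J$* is a continuous $q:J\to\mathbb C^N$ with $q(s)=c$ and, for all $t\in J\setminus\{s\}$, $$q(t)+\int_s^t\mathcal K(t,\tau)\,q(\tau)\,d\tau=f(t),\qquad f_j(t)=4\pi\int_s^t\mathcal I(t-\tau)\,\big(U_0(\tau-s)\psi_s\big)(y_j)\,d\tau,$$ $$\mathcal K_{jj}(t,\tau)=4\pi\,\mathcal I(t-\tau)\Big(\alpha_j(\tau)-\tfrac1{2\pi}\log2+\tfrac\gamma{2\pi}\Big),\qquad \mathcal K_{jk}(t,\tau)=-2i\,\mathcal I(t-\tau)\int_s^\tau U_0(\tau-\sigma;|y_j-y_k|)\,d\sigma\quad(j\ne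 k).$$ Here $(U_0(\tau-s)\psi_s)(y_j)$ is the value of the continuous representative, and the integral over $\sigma$ is improper at $\sigma=\tau$. **Proposition.** Let $q$ be a solution of the charge equation on $J$. Then for every $t\in J$ the function $$\big(U(t,s)\psi_s\big)(x)=\big(U_0(t-s)\psi_s\big)(x)+\frac i{2\pi}\sum_{j=1}^N\int_s^t U_0(t-\tau;|x-y_j|)\,q_j(\tau)\,d\tau$$ is a well-defined element of $L^2(\mathbb R^2)$ (the integral over $\tau$ being the limit in $L^2(\mathbb R^2)$, as $\theta\uparrow1$, of the integrals from $s$ to $s+\theta(t-s)$), and $U(t,s)\psi_s\in\mathscr D[\mathcal F]$; more precisely, $$U(t,s)\psi_s-\frac1{2\pi}\sum_{j=1}^N q_j(t)\,K_0(\sqrt\lambda\,|x-y_j|)\in H^1(\mathbb R^2).$$ -/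

import Mathlib

open MeasureTheory Filter Topology Set
open scoped FourierTransform SchwartzMap ENNReal

noncomputable section

namespace PointInteraction

/-- The plane `ℝ²`. -/
abbrev Plane : Type := EuclideanSpace ℝ (Fin 2)

/-- The Hilbert space `L²(ℝ²)` of complex valued functions. -/
abbrev L2Plane : Type := Lp (α := Plane) ℂ 2 volume

/-- `f ∈ L²(ℝ²)` belongs to the Sobolev space `H^k(ℝ²)`. -/
def MemH (k : ℝ) (f : L2Plane) : Prop :=
  TemperedDistribution.MemSobolev k 2 (f : 𝓢'(Plane, ℂ))

/-- The Macdonald function (modified Bessel function of the second kind of order zero),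
`K₀(z) = ½ ∫₀^∞ exp(-u - z²/(4u)) du/u` for `z > 0`. -/
def besselK0 (z : ℝ) : ℝ :=
  1 / 2 * ∫ u in Ioi (0 : ℝ), Real.exp (-u - z ^ 2 / (4 * u)) / u

/-- The singular part `(1/2π) ∑ⱼ cⱼ K₀(√lam |x - yⱼ|)`. -/
def singularPart {N : ℕ} (y : Fin N → Plane) (lam : ℝ) (c : Fin N → ℂ) (x : Plane) : ℂ :=
  1 / (2 * Real.pi) * ∑ j, c j * (besselK0 (Real.sqrt lam * ‖x - y j‖) : ℂ)

/-- `ψ = φ + (1/2π) ∑ⱼ cⱼ K₀(√lam |x - yⱼ|)` for some `φ ∈ H¹(ℝ²)`, i.e. `ψ` lies in the form domain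
and its charges are `c`. -/
def HasFormCharges {N : ℕ} (y : Fin N → Plane) (lam : ℝ) (ψ : L2Plane) (c : Fin N → ℂ) : Prop :=
  ∃ φ : L2Plane, MemH 1 φ ∧ ∀ᵐ x : Plane, ψ x = φ x + singularPart y lam c x

/-- The form domain `D[F]`. -/
def formDomain {N : ℕ} (y : Fin N → Plane) (lam : ℝ) : Set L2Plane :=
  {ψ | ∃ c : Fin N → ℂ, HasFormCharges y lam ψ c}

/-- The matrix `Γ_lam` for interaction parameters `a`. -/
def gammaMatrix {N : ℕ} (a : Fin N → ℝ) (y : Fin N → Plane) (lam : ℝ) :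
    Matrix (Fin N) (Fin N) ℂ :=
  fun j k =>
    if j = k then
      ((a j + 1 / (2 * Real.pi) * Real.log (Real.sqrt lam / 2)
        + Real.eulerMascheroniConstant / (2 * Real.pi) : ℝ) : ℂ)
    else ((-(1 / (2 * Real.pi)) * besselK0 (Real.sqrt lam * ‖y j - y k‖) : ℝ) : ℂ)

/-- `ψ` lies in the operator domain `D(H_a)` (which consists of all `ψ` for which such a `c` exists)
and its charges are `c`: `ψ = φ + singular part` with
`φ ∈ H²(ℝ²)` and `φ(x) → (Γ_lam c)_j` as `x → yⱼ`. The limit is that of the class of `φ` modulo null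
sets, i.e. of its continuous representative. -/
def HasOperatorCharges {N : ℕ} (a : Fin N → ℝ) (y : Fin N → Plane) (lam : ℝ) (ψ : L2Plane)
    (c : Fin N → ℂ) : Prop :=
  ∃ φ : L2Plane, MemH 2 φ ∧ (∀ᵐ x : Plane, ψ x = φ x + singularPart y lam c x) ∧
    ∀ j, Tendsto (φ : Plane → ℂ) (ae volume ⊓ 𝓝 (y j))
      (𝓝 ((gammaMatrix a y lam).mulVec c j))

/-- The symbol `e^{-i|p|²t}` of `e^{itΔ}`, in the variable `ξ = p/2π` of Mathlib's Fourier
transform. -/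
def freeSymbol (t : ℝ) (ξ : Plane) : ℂ :=
  Complex.exp (-Complex.I * ((2 * Real.pi * ‖ξ‖) ^ 2 * t : ℝ))

theorem memLp_freeSymbol (t : ℝ) : MemLp (freeSymbol t) ∞ (volume : Measure Plane) := by
  have hc : Continuous (freeSymbol t) := by
    unfold freeSymbol
    fun_prop
  refine memLp_top_of_bound hc.aestronglyMeasurable 1 (Eventually.of_forall fun ξ => ?_)
  have h : -Complex.I * ((2 * Real.pi * ‖ξ‖) ^ 2 * t : ℝ)
      = ((-((2 * Real.pi * ‖ξ‖) ^ 2 * t) : ℝ) : ℂ) * Complex.I := by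
    push_cast
    ring
  rw [freeSymbol, h, Complex.norm_exp_ofReal_mul_I]

/-- The free propagator `U₀(t) = e^{itΔ}` on `L²(ℝ²)`. -/
def freeProp (t : ℝ) (f : L2Plane) : L2Plane :=
  𝓕⁻ ((memLp_freeSymbol t).toLp (freeSymbol t) • 𝓕 f)

/-- The kernel `U₀(t; r) = exp(-r²/(4it)) / (2it)`, which is `2π` times the integral kernel of
`e^{itΔ}` with respect to Lebesgue measure. -/
def freeKernel (t r : ℝ) : ℂ :=
  Complex.exp (-(r : ℂ) ^ 2 / (4 * Complex.I * t)) / (2 * Complex.I * t)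

/-- The value at `x` of an element of `L²(ℝ²)` which is continuous at `x` after a modification on a
null set. -/
def pointValue (f : L2Plane) (x : Plane) : ℂ :=
  limUnder (ae volume ⊓ 𝓝 x) (f : Plane → ℂ)

/-- The Volterra function `𝓘(t) = ∫₀^∞ t^{u-1}/Γ(u) du` for `t > 0`, extended to `t < 0` as an odd
function. -/
def volterraI (t : ℝ) : ℝ :=
  Real.sign t * ∫ u in Ioi (0 : ℝ), |t| ^ (u - 1) / Real.Gamma u

/-- The improper integral `∫_s^τ U₀(τ - σ; r) dσ`, conditionally convergent at `σ = τ` if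
`r > 0`. -/
def freeKernelIntegral (s τ r : ℝ) : ℂ :=
  limUnder (𝓝[<] (1 : ℝ)) fun θ : ℝ => ∫ σ in s..(s + θ * (τ - s)), freeKernel (τ - σ) r

/-- The matrix kernel `𝓚(t, τ)` of the charge equation with initial time `s`. -/
def chargeKernel {N : ℕ} (α : Fin N → ℝ → ℝ) (y : Fin N → Plane) (s t τ : ℝ) :
    Matrix (Fin N) (Fin N) ℂ :=
  fun j k =>
    if j = k then
      ((4 * Real.pi * volterraI (t - τ) *
        (α j τ - 1 / (2 * Real.pi) * Real.log 2
          + Real.eulerMascheroniConstant / (2 * Real.pi)) : ℝ) : ℂ)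
    else -2 * Complex.I * (volterraI (t - τ) : ℂ) * freeKernelIntegral s τ ‖y j - y k‖

/-- The source `fⱼ(t) = 4π ∫_s^t 𝓘(t - τ) (U₀(τ - s)ψ)(yⱼ) dτ` of the charge equation. -/
def chargeSource {N : ℕ} (y : Fin N → Plane) (s : ℝ) (ψ : L2Plane) (t : ℝ) (j : Fin N) : ℂ :=
  4 * Real.pi * ∫ τ in s..t, (volterraI (t - τ) : ℂ) * pointValue (freeProp (τ - s) ψ) (y j)

/-- `q` is a continuous solution on `J` of the charge equation
`q(t) + ∫_s^t 𝓚(t, τ) q(τ) dτ = f(t)` with initial value `q(s) = c`. At `t = s` both integrals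
over `[s, s]` are void and the equation is replaced by the initial condition. -/
structure IsChargeSolution {N : ℕ} (α : Fin N → ℝ → ℝ) (y : Fin N → Plane) (s : ℝ) (ψ : L2Plane)
    (c : Fin N → ℂ) (J : Set ℝ) (q : ℝ → Fin N → ℂ) : Prop where
  continuousOn : ContinuousOn q J
  initial : q s = c
  equation : ∀ t ∈ J, t ≠ s → ∀ j,
    q t j + ∫ τ in s..t, (chargeKernel α y s t τ).mulVec (q τ) j = chargeSource y s ψ t j

/-- The charge term `(i/2π) ∑ⱼ ∫_s^{s+θ(t-s)} U₀(t - τ; |x - yⱼ|) qⱼ(τ) dτ`, cut off near the singular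
time `τ = t` when `θ < 1`. -/
def chargeTerm {N : ℕ} (y : Fin N → Plane) (s t : ℝ) (q : ℝ → Fin N → ℂ) (θ : ℝ) (x : Plane) : ℂ :=
  Complex.I / (2 * Real.pi) *
    ∑ j, ∫ τ in s..(s + θ * (t - s)), freeKernel (t - τ) ‖x - y j‖ * q τ j

/-- `Ψ = U(t, s)ψ`, that is
`Ψ(x) = (U₀(t - s)ψ)(x) + (i/2π) ∑ⱼ ∫_s^t U₀(t - τ; |x - yⱼ|) qⱼ(τ) dτ`,
where the integral, singular at `τ = t`, is the limit in `L²(ℝ²)` of its cut-offs. -/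
def IsEvolution {N : ℕ} (y : Fin N → Plane) (s t : ℝ) (q : ℝ → Fin N → ℂ) (ψ Ψ : L2Plane) : Prop :=
  Tendsto
    (fun θ : ℝ =>
      eLpNorm (fun x : Plane => Ψ x - freeProp (t - s) ψ x - chargeTerm y s t q θ x) 2 volume)
    (𝓝[<] (1 : ℝ)) (𝓝 0)

end PointInteraction

end

/-! Write `t = s + εR` with `ε = ±1`, `p_j(r) = q_j(s + εr)` and `ω = |p|²`. The singular part of
`ψ`, its free evolution and the waves emitted by the centres all have explicit Fourier transforms.
After subtracting the singular part with charges `q(t)`, the transform that remains is `e^{-iω(t-s)}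
φ̂ + ∑_j e^{-ip·y_j} B_j(ω)`. Here `φ ∈ H²` is the regular part of `ψ`, and `B_j(ω) = iε ∫_0^R
e^{-iωε(R-r)} p_j(r) dr - p_j(R)/(ω+lam) + e^{-iωεR} p_j(0)/(ω+lam)` (`boundaryTerm`,
`hasFormCharges_waveL2`). In two dimensions `ω` maps area to a constant multiple of `dω`
(`map_freq_volume`), so membership in `H¹` follows from `∫_0^∞ (1+ω)|B_j(ω)|² dω < ∞`. The two
fractions are boundary terms of an integration by parts. Up to a phase and `O(ω⁻²)`, `B_j` is
therefore the Fourier transform in time of `p_j` minus a smooth function with the same end values,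
extended by zero (`boundaryTerm_eq`). Half a derivative in `L²` of this extension is what is needed.

Continuity of `q` does not give this; the charge equation does. Its source contains `c_j` times a
logarithm in the elapsed time, produced by the `K₀` singularity propagated back to its own centre.
Since `𝓘 * (-γ - log) = 1` (`volterraI_conv_log`), that part contributes exactly `c_j`. Hence `p_j -
c_j = 𝓘 * (G_j + ∑_l A_jl p_l)`, where `G` and `A` are bounded with modulus of continuity `δ/r + √δ`
(`IsNice`, `charge_equation_of_isChargeSolution`). Extended by zero, such functions have `L²`
increments of size `O(√δ)` (`IsNice.halfSq`), and a Gronwall inequality in `L²` transfers this to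
`p` and hence to `G_j + ∑_l A_jl p_l` (`halfSq_of_volterra`).

The class `O(√δ)` contains jumps and just fails to have half a derivative. The remaining convolution
with `𝓘` closes the gap: the mass of `𝓘` on `(0, a)` is at most `e/|log a|`, so the increments of
`p_j` are `O(√δ/|log δ|)` in `L²` and `O(1/|log δ|)` uniformly (`exists_incr_conv_le`). The uniform
bound handles the zero extension at `r = R` (`exists_lintegral_incr_cut_le`), and convergence of `∫
dδ/(δ log²δ)` at `0` turns the `L²` bound into half a derivative
(`lintegral_one_add_abs_mul_fourier_lt_top`).

The limit defining the evolution exists because, by Plancherel in time, the wave emitted during `[a,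
b]` has `L²` norm at most a constant times `√(b - a)` (`norm_waveL2_le`). -/

namespace PointInteraction

/-! ### Fourier transform on `L²` and Sobolev spaces -/

section FourierLp

variable {V : Type*} [NormedAddCommGroup V] [InnerProductSpace ℝ V] [FiniteDimensional ℝ V]
  [MeasurableSpace V] [BorelSpace V]

/-- Transposition of the inverse Fourier transform on `L²` against Schwartz functions. -/
theorem integral_fourierInv_Lp_mul (m : Lp (α := V) ℂ 2 volume) (g : 𝓢(V, ℂ)) :
    ∫ x, g x * (𝓕⁻ m : Lp (α := V) ℂ 2 volume) x = ∫ x, (𝓕⁻ g : 𝓢(V, ℂ)) x * m x := by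
  have h := congrArg (fun T : 𝓢'(V, ℂ) => T g) (Lp.fourierInv_toTemperedDistribution_eq m)
  simp only [TemperedDistribution.fourierInv_apply] at h
  rw [Lp.toTemperedDistribution_apply, Lp.toTemperedDistribution_apply] at h
  simpa using h.symm

theorem integral_fourier_Lp_mul (m : Lp (α := V) ℂ 2 volume) (g : 𝓢(V, ℂ)) :
    ∫ x, g x * (𝓕 m : Lp (α := V) ℂ 2 volume) x = ∫ x, (𝓕 g : 𝓢(V, ℂ)) x * m x := by
  have h := congrArg (fun T : 𝓢'(V, ℂ) => T g) (Lp.fourier_toTemperedDistribution_eq m)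
  simp only [TemperedDistribution.fourier_apply] at h
  rw [Lp.toTemperedDistribution_apply, Lp.toTemperedDistribution_apply] at h
  simpa using h.symm

/-- Two locally integrable functions with the same integrals against all Schwartz functions agree
almost everywhere. -/
theorem ae_eq_of_forall_schwartz {f w : V → ℂ} (hf : LocallyIntegrable f) (hw : LocallyIntegrable w)
    (h : ∀ g : 𝓢(V, ℂ), ∫ x, g x * f x = ∫ x, g x * w x) : f =ᵐ[volume] w := by
  refine ae_eq_of_integral_contDiff_smul_eq hf hw fun g hg hgc => ?_
  have hg₁ : HasCompactSupport (Complex.ofRealCLM ∘ g) := hgc.comp_left rfl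
  have hg₂ : ContDiff ℝ (⊤ : ℕ∞) (Complex.ofRealCLM ∘ g) := by fun_prop
  simpa using h (hg₁.toSchwartzMap hg₂)

/-- A locally integrable function whose pairings with Fourier transforms of Schwartz functions are
those of the multiplier `m` is the inverse Fourier transform of `m`. -/
theorem fourierInv_ae_eq {m : Lp (α := V) ℂ 2 volume} {w : V → ℂ} (hw : LocallyIntegrable w)
    (h : ∀ g : 𝓢(V, ℂ), ∫ x, (𝓕 g : 𝓢(V, ℂ)) x * w x = ∫ x, g x * m x) :
    ((𝓕⁻ m : Lp (α := V) ℂ 2 volume) : V → ℂ) =ᵐ[volume] w := by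
  refine ae_eq_of_forall_schwartz ((Lp.memLp _).locallyIntegrable (by norm_num)) hw fun g => ?_
  rw [integral_fourierInv_Lp_mul, ← h]
  simp

theorem fourier_ae_eq {m : Lp (α := V) ℂ 2 volume} {w : V → ℂ} (hw : LocallyIntegrable w)
    (h : ∀ g : 𝓢(V, ℂ), ∫ x, g x * w x = ∫ x, (𝓕 g : 𝓢(V, ℂ)) x * m x) :
    ((𝓕 m : Lp (α := V) ℂ 2 volume) : V → ℂ) =ᵐ[volume] w := by
  refine ae_eq_of_forall_schwartz ((Lp.memLp _).locallyIntegrable (by norm_num)) hw fun g => ?_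
  rw [integral_fourier_Lp_mul, ← h]

theorem continuous_fourier_of_integrable {f : V → ℂ} (hf : Integrable f) : Continuous (𝓕 f) :=
  VectorFourier.fourierIntegral_continuous Real.continuous_fourierChar
    (by exact continuous_inner) hf

/-- On `L¹ ∩ L²` the Fourier transform is given by the Fourier integral. -/
theorem fourier_toLp_ae_eq {f : V → ℂ} (hf : MemLp f 2) (hf1 : Integrable f) :
    ((𝓕 (hf.toLp f) : Lp (α := V) ℂ 2 volume) : V → ℂ) =ᵐ[volume] 𝓕 f := by
  refine fourier_ae_eq (continuous_fourier_of_integrable hf1).locallyIntegrable fun g => ?_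
  have h := VectorFourier.integral_fourierIntegral_smul_eq_flip (L := innerₗ V)
    (μ := volume) (ν := volume) Real.continuous_fourierChar (by exact continuous_inner)
    g.integrable hf1
  rw [flip_innerₗ] at h
  simp only [smul_eq_mul] at h
  refine Eq.trans h.symm (integral_congr_ae ?_)
  filter_upwards [hf.coeFn_toLp] with x hx
  rw [hx]
  rfl

/-- Transposition is applied to `𝓕 g` and the reflection of `f`, so that Fourier inversion for
Schwartz functions brings back `g`, reflected; the substitution `ξ ↦ -ξ` then removes both
reflections. -/
theorem fourierInv_toLp_ae_eq {f : V → ℂ} (hf : MemLp f 2) (hf1 : Integrable f) :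
    ((𝓕⁻ (hf.toLp f) : Lp (α := V) ℂ 2 volume) : V → ℂ) =ᵐ[volume] 𝓕⁻ f := by
  have hc : Continuous (𝓕⁻ f) := by
    have : 𝓕⁻ f = fun x => 𝓕 f (-x) := by
      ext x; rw [Real.fourierInv_eq_fourier_neg]
    rw [this]
    exact (continuous_fourier_of_integrable hf1).comp continuous_neg
  refine fourierInv_ae_eq hc.locallyIntegrable fun g => ?_
  have hg : (fun x => (𝓕 g : 𝓢(V, ℂ)) x) = 𝓕 (g : V → ℂ) := by
    ext x; rw [SchwartzMap.fourier_coe]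
  have h := VectorFourier.integral_fourierIntegral_smul_eq_flip (L := innerₗ V)
    (μ := volume) (ν := volume) Real.continuous_fourierChar (by exact continuous_inner)
    (𝓕 g : 𝓢(V, ℂ)).integrable (hf1.comp_neg)
  rw [flip_innerₗ] at h
  simp only [smul_eq_mul] at h
  have e1 : ∀ ξ, VectorFourier.fourierIntegral Real.fourierChar volume (innerₗ V)
      (fun x => f (-x)) ξ = 𝓕⁻ f ξ := by
    intro ξ
    rw [Real.fourierInv_eq, VectorFourier.fourierIntegral, ← integral_neg_eq_self]
    simp
  have e2 : ∀ ξ, VectorFourier.fourierIntegral Real.fourierChar volume (innerₗ V)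
      (fun x => (𝓕 g : 𝓢(V, ℂ)) x) ξ = g (-ξ) := by
    intro ξ
    have : (𝓕⁻ (𝓕 g) : 𝓢(V, ℂ)) (-ξ) = g (-ξ) := by simp
    rw [← this, SchwartzMap.fourierInv_coe, Real.fourierInv_eq_fourier_neg, neg_neg]
    rfl
  simp only [e1, e2] at h
  rw [← h, ← integral_neg_eq_self]
  simp only [neg_neg]
  refine integral_congr_ae ?_
  filter_upwards [hf.coeFn_toLp] with x hx
  rw [hx]

/-- Plancherel's identity on `L¹ ∩ L²`. -/
theorem eLpNorm_fourier_eq {f : V → ℂ} (hf : MemLp f 2) (hf1 : Integrable f) :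
    eLpNorm (𝓕 f) 2 volume = eLpNorm f 2 volume := by
  rw [← eLpNorm_congr_ae (fourier_toLp_ae_eq hf hf1), ← eLpNorm_congr_ae hf.coeFn_toLp,
    ← Lp.enorm_def, ← Lp.enorm_def, ← ofReal_norm, ← ofReal_norm, Lp.norm_fourier_eq]

/-- Fourier characterization of the Sobolev spaces based on `L²`. -/
theorem memSobolev_iff_memLp_fourier (k : ℝ) (f : Lp (α := V) ℂ 2 volume) :
    TemperedDistribution.MemSobolev k 2 (f : 𝓢'(V, ℂ)) ↔
      MemLp (fun ξ => (((1 + ‖ξ‖ ^ 2) ^ (k / 2) : ℝ) : ℂ) *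
        (𝓕 f : Lp (α := V) ℂ 2 volume) ξ) 2 volume := by
  have htg : Function.HasTemperateGrowth
      (fun ξ : V => (((1 + ‖ξ‖ ^ 2) ^ (k / 2) : ℝ) : ℂ)) := by fun_prop
  have hcont : Continuous (fun ξ : V => (((1 + ‖ξ‖ ^ 2) ^ (k / 2) : ℝ) : ℂ)) := htg.1.continuous
  have hpair : ∀ g : 𝓢(V, ℂ), TemperedDistribution.smulLeftCLM ℂ
      (fun ξ : V => (((1 + ‖ξ‖ ^ 2) ^ (k / 2) : ℝ) : ℂ)) (𝓕 (f : 𝓢'(V, ℂ))) g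
      = ∫ ξ, g ξ * ((((1 + ‖ξ‖ ^ 2) ^ (k / 2) : ℝ) : ℂ) *
        (𝓕 f : Lp (α := V) ℂ 2 volume) ξ) := by
    intro g
    rw [TemperedDistribution.smulLeftCLM_apply_apply, Lp.fourier_toTemperedDistribution_eq,
      Lp.toTemperedDistribution_apply]
    refine integral_congr_ae (Eventually.of_forall fun ξ => ?_)
    simp only [SchwartzMap.smulLeftCLM_apply_apply htg, smul_eq_mul]
    ring
  have hloc : LocallyIntegrable (fun ξ => (((1 + ‖ξ‖ ^ 2) ^ (k / 2) : ℝ) : ℂ) *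
        (𝓕 f : Lp (α := V) ℂ 2 volume) ξ) := by
    have := ((Lp.memLp (𝓕 f : Lp (α := V) ℂ 2 volume)).locallyIntegrable (by norm_num))
    exact this.continuous_smul hcont
  rw [TemperedDistribution.memSobolev_iff_exists_smulLeftCLM_fourier]
  constructor
  · rintro ⟨f', hf'⟩
    refine (memLp_congr_ae ?_).1 (Lp.memLp f')
    refine ae_eq_of_forall_schwartz ((Lp.memLp _).locallyIntegrable (by norm_num)) hloc fun g => ?_
    rw [← hpair, hf', Lp.toTemperedDistribution_apply]
    rfl
  · intro h
    refine ⟨h.toLp _, ?_⟩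
    ext g
    rw [hpair, Lp.toTemperedDistribution_apply]
    refine integral_congr_ae ?_
    filter_upwards [h.coeFn_toLp] with x hx
    rw [hx]
    rfl

end FourierLp

end PointInteraction

/-! ### The energy variable -/

namespace PointInteraction

/-- The symbol `ω = |p|²` of `-Δ`, in the variable `ξ = p/2π`. -/
noncomputable def freq (ξ : Plane) : ℝ := (2 * Real.pi * ‖ξ‖) ^ 2

theorem continuous_freq : Continuous freq := by unfold freq; fun_prop

theorem freq_nonneg (ξ : Plane) : 0 ≤ freq ξ := sq_nonneg _

/-- The set is a disc of radius `√a/2π`. Its area is linear in `a`, which is the two-dimensional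
fact that the density of states is constant. -/
theorem volume_freq_lt {a : ℝ} (ha : 0 ≤ a) :
    volume {ξ : Plane | freq ξ < a} = ENNReal.ofReal (a / (4 * Real.pi)) := by
  have : {ξ : Plane | freq ξ < a} = Metric.ball 0 (Real.sqrt a / (2 * Real.pi)) := by
    ext ξ
    rw [mem_ofPred_eq, mem_ball_zero_iff, lt_div_iff₀ (by positivity), freq,
      ← Real.lt_sqrt (by positivity), mul_comm]
  rw [this, EuclideanSpace.volume_ball_fin_two, ← ENNReal.ofReal_pow (by positivity),
    ← ENNReal.ofReal_mul (by positivity), div_pow, Real.sq_sqrt ha]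
  congr 1
  field_simp
  norm_num

theorem volume_freq_le {a : ℝ} (ha : 0 ≤ a) :
    volume {ξ : Plane | freq ξ ≤ a} = ENNReal.ofReal (a / (4 * Real.pi)) := by
  have : {ξ : Plane | freq ξ ≤ a} = Metric.closedBall 0 (Real.sqrt a / (2 * Real.pi)) := by
    ext ξ
    rw [mem_ofPred_eq, mem_closedBall_zero_iff, le_div_iff₀ (by positivity), freq,
      ← Real.le_sqrt (by positivity) ha, mul_comm]
  rw [this, EuclideanSpace.volume_closedBall_fin_two, ← ENNReal.ofReal_pow (by positivity),
    ← ENNReal.ofReal_mul (by positivity), div_pow, Real.sq_sqrt ha]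
  congr 1
  field_simp
  norm_num

/-- The image of Lebesgue measure on the plane under `freq`. -/
theorem map_freq_volume :
    Measure.map freq volume = ENNReal.ofReal (1 / (4 * Real.pi)) • volume.restrict (Ioi (0 : ℝ)) := by
  have hmeas : Measurable freq := continuous_freq.measurable
  have : IsLocallyFiniteMeasure
      (ENNReal.ofReal (1 / (4 * Real.pi)) • volume.restrict (Ioi (0 : ℝ))) :=
    inferInstanceAs (IsLocallyFiniteMeasure
      ((Real.toNNReal (1 / (4 * Real.pi))) • volume.restrict (Ioi (0 : ℝ))))
  refine (Real.measure_ext_Ioo_rat fun p q => ?_).symm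
  rw [Measure.map_apply hmeas measurableSet_Ioo, Measure.smul_apply,
    Measure.restrict_apply measurableSet_Ioo, smul_eq_mul]
  generalize (p : ℝ) = p
  generalize (q : ℝ) = q
  have hI : Ioo p q ∩ Ioi 0 = Ioo (max p 0) q := by
    ext x; simp only [mem_inter_iff, mem_Ioo, mem_Ioi, max_lt_iff]; tauto
  rw [hI, Real.volume_Ioo, ← ENNReal.ofReal_mul (by positivity)]
  rcases lt_or_ge q 0 with hq | hq
  · have : freq ⁻¹' Ioo p q = ∅ := by
      ext ξ
      simp only [mem_preimage, mem_Ioo, mem_empty_iff_false, iff_false, not_and, not_lt]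
      intro _
      linarith [freq_nonneg ξ]
    rw [this, measure_empty, ENNReal.ofReal_eq_zero]
    exact mul_nonpos_of_nonneg_of_nonpos (by positivity) (by linarith [le_max_right p 0])
  rcases lt_or_ge p 0 with hp | hp
  · have : freq ⁻¹' Ioo p q = {ξ : Plane | freq ξ < q} := by
      ext ξ
      simp only [mem_preimage, mem_Ioo, mem_ofPred_eq, and_iff_right_iff_imp]
      intro _
      linarith [freq_nonneg ξ]
    rw [this, volume_freq_lt hq, max_eq_right hp.le]
    congr 1; ring
  · rcases le_total q p with hqp | hpq
    · rw [Ioo_eq_empty (not_lt.2 hqp), preimage_empty, measure_empty, ENNReal.ofReal_eq_zero]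
      exact mul_nonpos_of_nonneg_of_nonpos (by positivity) (by linarith [le_max_left p 0])
    have : freq ⁻¹' Ioo p q = {ξ : Plane | freq ξ < q} \ {ξ : Plane | freq ξ ≤ p} := by
      ext ξ
      simp only [mem_preimage, mem_Ioo, mem_ofPred_eq, Set.mem_sdiff, not_le]
      tauto
    rcases hpq.eq_or_lt with h | hlt
    · subst h
      simp [max_eq_left hp]
    rw [this, measure_sdiff, volume_freq_lt hq, volume_freq_le hp, max_eq_left hp,
      ← ENNReal.ofReal_sub _ (by positivity)]
    · congr 1; ring
    · intro ξ hξ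
      exact lt_of_le_of_lt hξ hlt
    · exact (measurableSet_le hmeas measurable_const).nullMeasurableSet
    · rw [volume_freq_le hp]; exact ENNReal.ofReal_ne_top

theorem lintegral_freq {f : ℝ → ℝ≥0∞} (hf : Measurable f) :
    ∫⁻ ξ : Plane, f (freq ξ) = ENNReal.ofReal (1 / (4 * Real.pi)) * ∫⁻ w in Ioi (0 : ℝ), f w := by
  rw [← lintegral_map hf continuous_freq.measurable, map_freq_volume, lintegral_smul_measure,
    smul_eq_mul]

/-! ### Heat kernels at complex times -/

/-- The heat kernel of the plane at complex time `z`. -/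
noncomputable def heatKernel (z : ℂ) (x : Plane) : ℂ :=
  Complex.exp (-(‖x‖ : ℂ) ^ 2 / (4 * z)) / (4 * Real.pi * z)

theorem norm_exp_neg_sq_div (z : ℂ) (r : ℝ) :
    ‖Complex.exp (-(r : ℂ) ^ 2 / (4 * z))‖ = Real.exp (-(r ^ 2 * z.re) / (4 * Complex.normSq z)) := by
  rw [Complex.norm_exp]
  congr 1
  have : (-(r : ℂ) ^ 2 / (4 * z)) = ((-(r ^ 2) / 4 : ℝ) : ℂ) * z⁻¹ := by
    push_cast
    rw [div_eq_mul_inv, mul_inv]; ring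
  rw [this, Complex.re_ofReal_mul, Complex.inv_re]
  ring

theorem norm_exp_neg_sq_div_le {z : ℂ} (hz : 0 ≤ z.re) (r : ℝ) :
    ‖Complex.exp (-(r : ℂ) ^ 2 / (4 * z))‖ ≤ 1 := by
  rw [norm_exp_neg_sq_div, Real.exp_le_one_iff, neg_div, neg_nonpos]
  have := Complex.normSq_nonneg z
  positivity

theorem norm_heatKernel_le {z : ℂ} (hz : 0 ≤ z.re) (x : Plane) :
    ‖heatKernel z x‖ ≤ 1 / (4 * Real.pi * ‖z‖) := by
  rw [heatKernel, norm_div]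
  have : ‖(4 * Real.pi * z : ℂ)‖ = 4 * Real.pi * ‖z‖ := by
    simp [abs_of_pos Real.pi_pos]
  rw [this]
  gcongr
  exact norm_exp_neg_sq_div_le hz _

theorem continuous_heatKernel (z : ℂ) : Continuous (heatKernel z) := by
  unfold heatKernel; fun_prop

/-- This is the Gaussian formula with parameter `1/(4z)`, whose real part is positive with that of
`z`. In dimension two the power in the formula is `1`, so no branch of a complex root enters. -/
theorem fourier_heatKernel {z : ℂ} (hz : 0 < z.re) (y ξ : Plane) :
    𝓕 (fun x => heatKernel z (x - y)) ξ
      = Complex.exp (-(2 * Real.pi * inner ℝ y ξ : ℝ) * Complex.I) *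
        Complex.exp (-(freq ξ : ℂ) * z) := by
  have hz0 : z ≠ 0 := by rintro rfl; simp at hz
  have hb : 0 < (1 / (4 * z)).re := by
    rw [one_div, mul_inv, show (4 : ℂ)⁻¹ = ((1 / 4 : ℝ) : ℂ) by norm_num, Complex.re_ofReal_mul,
      Complex.inv_re]
    have := Complex.normSq_pos.2 hz0
    positivity
  have h0 : ∀ ξ, 𝓕 (heatKernel z) ξ = Complex.exp (-(freq ξ : ℂ) * z) := by
    intro ξ
    have h := fourier_gaussian_innerProductSpace (V := Plane) hb ξ
    have hk : heatKernel z = fun v => (1 / (4 * Real.pi * z)) •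
        Complex.exp (-(1 / (4 * z)) * ‖v‖ ^ 2) := by
      ext v
      rw [heatKernel, smul_eq_mul]
      rw [div_eq_mul_one_div, mul_comm]
      congr 2
      ring
    rw [hk, Real.fourier_eq]
    simp_rw [smul_comm _ (1 / (4 * (Real.pi : ℂ) * z))]
    rw [integral_smul, ← Real.fourier_eq, h]
    have : ((Module.finrank ℝ Plane : ℂ) / 2) = 1 := by simp
    rw [this, Complex.cpow_one, smul_eq_mul, ← mul_assoc]
    have hpi : (Real.pi : ℂ) ≠ 0 := by exact_mod_cast Real.pi_ne_zero
    have e1 : 1 / (4 * (Real.pi : ℂ) * z) * (Real.pi / (1 / (4 * z))) = 1 := by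
      field_simp
    rw [e1, one_mul]
    congr 1
    rw [freq]; push_cast; field_simp; ring
  rw [← h0, Real.fourier_eq', Real.fourier_eq', ← integral_add_right_eq_self _ y,
    ← integral_const_mul]
  refine integral_congr_ae (Eventually.of_forall fun x => ?_)
  simp only [add_sub_cancel_right, smul_eq_mul]
  rw [← mul_assoc, ← Complex.exp_add]
  congr 2
  rw [inner_add_left]; push_cast; ring

theorem integrable_heatKernel {z : ℂ} (hz : 0 < z.re) : Integrable (heatKernel z) := by
  have hz0 : z ≠ 0 := by rintro rfl; simp at hz
  have hb : 0 < (1 / (4 * z)).re := by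
    rw [one_div, mul_inv, show (4 : ℂ)⁻¹ = ((1 / 4 : ℝ) : ℂ) by norm_num, Complex.re_ofReal_mul,
      Complex.inv_re]
    have := Complex.normSq_pos.2 hz0
    positivity
  have h := (GaussianFourier.integrable_cexp_neg_mul_sq_norm_add (V := Plane) hb 0 0).div_const
    (4 * Real.pi * z)
  refine h.congr (Eventually.of_forall fun x => ?_)
  simp only [heatKernel]
  congr 2
  simp; ring

/-- The plane wave `ξ ↦ e^{-2πi⟨y, ξ⟩}`. -/
noncomputable def planeWave (y ξ : Plane) : ℂ := Complex.exp (-(2 * Real.pi * inner ℝ y ξ : ℝ) * Complex.I)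

theorem norm_planeWave (y ξ : Plane) : ‖planeWave y ξ‖ = 1 := by
  rw [planeWave, ← Complex.ofReal_neg, Complex.norm_exp_ofReal_mul_I]

theorem continuous_planeWave (y : Plane) : Continuous (planeWave y) := by
  unfold planeWave; fun_prop

theorem integral_fourier_mul_heatKernel_of_pos {z : ℂ} (hz : 0 < z.re) (y : Plane) (g : 𝓢(Plane, ℂ)) :
    ∫ x, (𝓕 g : 𝓢(Plane, ℂ)) x * heatKernel z (x - y)
      = ∫ ξ, g ξ * (planeWave y ξ * Complex.exp (-(freq ξ : ℂ) * z)) := by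
  have h := VectorFourier.integral_fourierIntegral_smul_eq_flip (L := innerₗ Plane)
    (μ := volume) (ν := volume) Real.continuous_fourierChar (by exact continuous_inner)
    g.integrable ((integrable_heatKernel hz).comp_sub_right y)
  rw [flip_innerₗ] at h
  simp only [smul_eq_mul] at h
  refine h.trans (integral_congr_ae (Eventually.of_forall fun ξ => ?_))
  simp only
  congr 1
  exact fourier_heatKernel hz y ξ

theorem norm_exp_neg_freq_mul_le {z : ℂ} (hz : 0 ≤ z.re) {w : ℝ} (hw : 0 ≤ w) :
    ‖Complex.exp (-(w : ℂ) * z)‖ ≤ 1 := by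
  rw [Complex.norm_exp, Real.exp_le_one_iff, ← Complex.ofReal_neg, Complex.re_ofReal_mul]
  nlinarith [mul_nonneg hw hz]

/-- Pairing of the heat kernel at complex time with a Fourier transform, up to the imaginary
axis. -/
theorem integral_fourier_mul_heatKernel {z : ℂ} (hz : 0 ≤ z.re) (hz0 : z ≠ 0) (y : Plane)
    (g : 𝓢(Plane, ℂ)) :
    ∫ x, (𝓕 g : 𝓢(Plane, ℂ)) x * heatKernel z (x - y)
      = ∫ ξ, g ξ * (planeWave y ξ * Complex.exp (-(freq ξ : ℂ) * z)) := by
  -- On the imaginary axis the kernel is not integrable, so `z` is approached from the open half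
  -- plane. Adding a positive real number does not decrease the modulus, so `1/(4π‖z‖)` bounds all
  -- the kernels at once.
  let u : ℕ → ℂ := fun n => z + ((1 / ((n : ℝ) + 1) : ℝ) : ℂ)
  have hu : Tendsto u atTop (𝓝 z) := by
    have := (Complex.continuous_ofReal.tendsto 0).comp
      (tendsto_one_div_add_atTop_nhds_zero_nat (𝕜 := ℝ))
    simpa [u] using tendsto_const_nhds.add this
  have hre : ∀ n, 0 < (u n).re := by
    intro n
    have : 0 < 1 / ((n : ℝ) + 1) := by positivity
    simp only [u, Complex.add_re, Complex.ofReal_re]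
    linarith
  have hnorm : ∀ n, ‖z‖ ≤ ‖u n‖ := by
    intro n
    have : 0 < 1 / ((n : ℝ) + 1) := by positivity
    rw [Complex.norm_def, Complex.norm_def]
    refine Real.sqrt_le_sqrt ?_
    rw [Complex.normSq_apply, Complex.normSq_apply]
    simp only [u, Complex.add_re, Complex.ofReal_re, Complex.add_im, Complex.ofReal_im, add_zero]
    nlinarith
  have hzn : 0 < ‖z‖ := norm_pos_iff.2 hz0
  have L : Tendsto (fun n => ∫ x, (𝓕 g : 𝓢(Plane, ℂ)) x * heatKernel (u n) (x - y)) atTop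
      (𝓝 (∫ x, (𝓕 g : 𝓢(Plane, ℂ)) x * heatKernel z (x - y))) := by
    refine tendsto_integral_of_dominated_convergence
      (fun x => ‖(𝓕 g : 𝓢(Plane, ℂ)) x‖ * (1 / (4 * Real.pi * ‖z‖))) (fun n => ?_)
      ((𝓕 g : 𝓢(Plane, ℂ)).integrable.norm.mul_const _) (fun n => ?_) ?_
    · exact ((𝓕 g : 𝓢(Plane, ℂ)).continuous.mul
        ((continuous_heatKernel _).comp (continuous_sub_right y))).aestronglyMeasurable
    · refine Eventually.of_forall fun x => ?_
      rw [norm_mul]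
      gcongr
      refine (norm_heatKernel_le (hre n).le _).trans ?_
      gcongr
      exact hnorm n
    · refine Eventually.of_forall fun x => ?_
      refine tendsto_const_nhds.mul ?_
      unfold heatKernel
      have hpi : (Real.pi : ℂ) ≠ 0 := by exact_mod_cast Real.pi_ne_zero
      refine Tendsto.div ?_ (hu.const_mul _) (by simp [hz0])
      refine (Complex.continuous_exp.tendsto _).comp ?_
      exact tendsto_const_nhds.div (hu.const_mul _) (by simp [hz0])
  have Rr : Tendsto (fun n => ∫ ξ, g ξ * (planeWave y ξ * Complex.exp (-(freq ξ : ℂ) * u n))) atTop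
      (𝓝 (∫ ξ, g ξ * (planeWave y ξ * Complex.exp (-(freq ξ : ℂ) * z)))) := by
    refine tendsto_integral_of_dominated_convergence
      (fun x => ‖g x‖) (fun n => ?_) g.integrable.norm (fun n => ?_) ?_
    · have := continuous_freq
      have h2 := continuous_planeWave y
      have h3 := g.continuous
      have : Continuous (fun ξ => g ξ * (planeWave y ξ * Complex.exp (-(freq ξ : ℂ) * u n))) := by
        fun_prop
      exact this.aestronglyMeasurable
    · refine Eventually.of_forall fun x => ?_
      rw [norm_mul, norm_mul, norm_planeWave, one_mul]
      exact mul_le_of_le_one_right (norm_nonneg _)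
        (norm_exp_neg_freq_mul_le (hre n).le (freq_nonneg x))
    · refine Eventually.of_forall fun x => ?_
      refine tendsto_const_nhds.mul (tendsto_const_nhds.mul ?_)
      exact (Complex.continuous_exp.tendsto _).comp (hu.const_mul _)
  refine tendsto_nhds_unique L (Rr.congr fun n => ?_)
  rw [integral_fourier_mul_heatKernel_of_pos (hre n)]

end PointInteraction

/-! ### Bounds for `1/Γ` and for the Volterra function -/

namespace PointInteraction

/-- Only the part `x > M` of Euler's integral is kept, where `x^u ≥ M^u`. The free parameter `M`
later makes `1/Γ` beat any given exponential. -/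
theorem rpow_mul_exp_le_Gamma_add_one {u M : ℝ} (hu : 0 ≤ u) (hM : 0 < M) :
    M ^ u * Real.exp (-M) ≤ Real.Gamma (u + 1) := by
  have hint := Real.GammaIntegral_convergent (s := u + 1) (by linarith)
  rw [Real.Gamma_eq_integral (by linarith)]
  calc M ^ u * Real.exp (-M) = ∫ x in Ioi M, M ^ u * Real.exp (-x) := by
        rw [integral_const_mul, integral_exp_neg_Ioi]
    _ ≤ ∫ x in Ioi M, Real.exp (-x) * x ^ (u + 1 - 1) := by
        refine setIntegral_mono_on ((integrableOn_exp_neg_Ioi M).const_mul _)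
          (hint.mono_set (Ioi_subset_Ioi hM.le)) measurableSet_Ioi fun x hx => ?_
        rw [add_sub_cancel_right, mul_comm]
        gcongr
        exact (mem_Ioi.1 hx).le
    _ ≤ ∫ x in Ioi 0, Real.exp (-x) * x ^ (u + 1 - 1) := by
        refine setIntegral_mono_set hint ?_ (Ioi_subset_Ioi hM.le).eventuallyLE
        filter_upwards [ae_restrict_mem measurableSet_Ioi] with x hx
        have := mem_Ioi.1 hx
        positivity

theorem inv_Gamma_add_one_le {u M : ℝ} (hu : 0 ≤ u) (hM : 0 < M) :
    (Real.Gamma (u + 1))⁻¹ ≤ Real.exp M * M ^ (-u) := by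
  have h := rpow_mul_exp_le_Gamma_add_one hu hM
  have hp : 0 < M ^ u * Real.exp (-M) := by positivity
  refine (inv_anti₀ hp h).trans (le_of_eq ?_)
  rw [mul_inv, Real.rpow_neg hM.le, Real.exp_neg, inv_inv, mul_comm]

theorem inv_Gamma_le {u M : ℝ} (hu : 0 < u) (hM : 0 < M) :
    (Real.Gamma u)⁻¹ ≤ u * (Real.exp M * M ^ (-u)) := by
  rw [← div_le_iff₀' hu]
  refine le_trans (le_of_eq ?_) (inv_Gamma_add_one_le hu.le hM)
  rw [Real.Gamma_add_one hu.ne', mul_inv, div_eq_mul_inv, mul_comm]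

theorem continuousAt_Gamma {u : ℝ} (hu : 0 < u) : ContinuousAt Real.Gamma u :=
  (Real.differentiableAt_Gamma fun m => by
    have : (0 : ℝ) ≤ m := m.cast_nonneg
    linarith).continuousAt

theorem continuousOn_Gamma_Ioi : ContinuousOn Real.Gamma (Ioi 0) := fun _ hu =>
  (continuousAt_Gamma hu).continuousWithinAt

theorem continuousOn_inv_Gamma_Ioi : ContinuousOn (fun u => (Real.Gamma u)⁻¹) (Ioi 0) :=
  continuousOn_Gamma_Ioi.inv₀ fun _ hu => (Real.Gamma_pos_of_pos hu).ne'

theorem integrableOn_polynomial_mul_exp_neg (a b c : ℝ) :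
    IntegrableOn (fun u : ℝ => (a + b * u + c * u ^ 2) * Real.exp (-u)) (Ioi 0) := by
  have h1 := Real.GammaIntegral_convergent (s := 1) (by norm_num)
  have h2 := Real.GammaIntegral_convergent (s := 2) (by norm_num)
  have h3 := Real.GammaIntegral_convergent (s := 3) (by norm_num)
  refine IntegrableOn.congr_fun (Integrable.add (h1.const_mul a)
    (Integrable.add (h2.const_mul b) (h3.const_mul c))) (fun u hu => ?_) measurableSet_Ioi
  simp only [Pi.add_apply]
  norm_num
  ring

/-- Integrability of `(1 + u) T^u / Γ(u)`. -/
theorem integrableOn_rpow_div_Gamma {T : ℝ} (hT : 0 < T) :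
    IntegrableOn (fun u : ℝ => (1 + u) * T ^ u * (Real.Gamma u)⁻¹) (Ioi 0) := by
  -- With this `M` the product `T^u M^{-u}` equals `e^{-u}`, so a polynomial times `e^{-u}`
  -- dominates.
  set M := Real.exp 1 * T with hMd
  have hM : 0 < M := by positivity
  have h := (integrableOn_polynomial_mul_exp_neg 0 1 1).const_mul (Real.exp M)
  refine Integrable.mono' h ?_ ?_
  · refine ContinuousOn.aestronglyMeasurable ?_ measurableSet_Ioi
    refine ((continuousOn_const.add continuousOn_id).mul ?_).mul continuousOn_inv_Gamma_Ioi
    exact fun u _ => (Real.continuousAt_const_rpow hT.ne').continuousWithinAt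
  · filter_upwards [ae_restrict_mem measurableSet_Ioi] with u hu
    have hu : 0 < u := hu
    have hG := Real.Gamma_pos_of_pos hu
    rw [Real.norm_of_nonneg (by positivity)]
    calc (1 + u) * T ^ u * (Real.Gamma u)⁻¹
        ≤ (1 + u) * T ^ u * (u * (Real.exp M * M ^ (-u))) := by
          gcongr
          exact inv_Gamma_le hu hM
      _ = _ := by
          rw [hMd, Real.mul_rpow (Real.exp_pos 1).le hT.le, ← Real.exp_mul, Real.rpow_neg hT.le]
          have : T ^ u ≠ 0 := (Real.rpow_pos_of_pos hT u).ne'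
          field_simp
          ring

theorem volterraI_of_pos {t : ℝ} (ht : 0 < t) :
    volterraI t = ∫ u in Ioi (0 : ℝ), t ^ (u - 1) / Real.Gamma u := by
  rw [volterraI, Real.sign_of_pos ht, abs_of_pos ht, one_mul]

theorem volterraI_neg (t : ℝ) : volterraI (-t) = -volterraI t := by
  rw [volterraI, volterraI, abs_neg]
  have : Real.sign (-t) = -Real.sign t := Real.sign_neg
  rw [this, neg_mul]

theorem volterraI_nonneg {t : ℝ} (ht : 0 < t) : 0 ≤ volterraI t := by
  rw [volterraI_of_pos ht]
  refine setIntegral_nonneg measurableSet_Ioi fun u hu => ?_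
  have := Real.Gamma_pos_of_pos hu
  positivity

theorem integrableOn_volterra_integrand {t : ℝ} (ht : 0 < t) :
    IntegrableOn (fun u : ℝ => t ^ (u - 1) / Real.Gamma u) (Ioi 0) := by
  have h := (integrableOn_rpow_div_Gamma ht).const_mul t⁻¹
  refine Integrable.mono' h ?_ ?_
  · refine ContinuousOn.aestronglyMeasurable ?_ measurableSet_Ioi
    refine ContinuousOn.div ?_ continuousOn_Gamma_Ioi fun _ hu => (Real.Gamma_pos_of_pos hu).ne'
    exact fun u _ => ((Real.continuous_const_rpow ht.ne').comp
      (continuous_sub_right (1 : ℝ))).continuousWithinAt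
  · filter_upwards [ae_restrict_mem measurableSet_Ioi] with u hu
    have hu : 0 < u := hu
    have hG := Real.Gamma_pos_of_pos hu
    rw [Real.norm_of_nonneg (by positivity), Real.rpow_sub_one ht.ne']
    have : 0 < t ^ u := Real.rpow_pos_of_pos ht u
    rw [div_div, div_eq_mul_inv, mul_inv]
    have h1 : 0 ≤ t ^ u * t⁻¹ * (Real.Gamma u)⁻¹ := by positivity
    nlinarith

/-- `𝓘(t) ≤ C/t` on bounded intervals, and `𝓘` is Lipschitz there with constant `C/t²`. -/
theorem exists_volterraI_bounds (T : ℝ) : ∃ A : ℝ, 0 < A ∧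
    (∀ t, 0 < t → t ≤ T → volterraI t ≤ A / t) ∧
    ∀ t t', 0 < t → t ≤ t' → t' ≤ T → |volterraI t' - volterraI t| ≤ A * (t' - t) / t ^ 2 := by
  set T' := max T 1
  have hT' : 1 ≤ T' := le_max_right _ _
  have hT0 : 0 < T' := by linarith
  have hint := integrableOn_rpow_div_Gamma hT0
  set A := ∫ u in Ioi (0 : ℝ), (1 + u) * T' ^ u * (Real.Gamma u)⁻¹
  have hA : 0 ≤ A := setIntegral_nonneg measurableSet_Ioi fun u hu => by
    have := Real.Gamma_pos_of_pos hu
    have : 0 < u := hu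
    positivity
  -- The added `1` only makes the constant strictly positive.
  refine ⟨A + 1, by linarith, fun t ht htT => ?_, fun t t' ht htt' ht'T => ?_⟩
  · rw [volterraI_of_pos ht]
    have : ∫ u in Ioi (0 : ℝ), t ^ (u - 1) / Real.Gamma u ≤ t⁻¹ * A := by
      rw [← integral_const_mul]
      refine setIntegral_mono_on (integrableOn_volterra_integrand ht) (hint.const_mul _)
        measurableSet_Ioi fun u hu => ?_
      have hu : 0 < u := hu
      have hG := Real.Gamma_pos_of_pos hu
      rw [Real.rpow_sub_one ht.ne', div_div, div_eq_mul_inv, mul_inv]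
      have h1 : t ^ u ≤ T' ^ u := Real.rpow_le_rpow ht.le (htT.trans (le_max_left _ _)) hu.le
      have h3 : t ^ u ≤ (1 + u) * T' ^ u := by
        have : 0 < T' ^ u := by positivity
        nlinarith
      calc t ^ u * (t⁻¹ * (Real.Gamma u)⁻¹) ≤ ((1 + u) * T' ^ u) * (t⁻¹ * (Real.Gamma u)⁻¹) := by
            gcongr
        _ = _ := by ring
    refine this.trans ?_
    rw [inv_mul_eq_div]
    gcongr
    linarith
  · have ht' : 0 < t' := by linarith
    rw [volterraI_of_pos ht, volterraI_of_pos ht', ← integral_sub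
      (integrableOn_volterra_integrand ht') (integrableOn_volterra_integrand ht),
      ← Real.norm_eq_abs]
    have : ‖∫ u in Ioi (0 : ℝ), (t' ^ (u - 1) / Real.Gamma u - t ^ (u - 1) / Real.Gamma u)‖
        ≤ ∫ u in Ioi (0 : ℝ), (t' - t) / t ^ 2 * ((1 + u) * T' ^ u * (Real.Gamma u)⁻¹) := by
      refine norm_integral_le_of_norm_le (hint.const_mul _) ?_
      filter_upwards [ae_restrict_mem measurableSet_Ioi] with u hu
      have hu : 0 < u := hu
      have hG := Real.Gamma_pos_of_pos hu
      -- The derivative of `x^(u-1)` brings down `|u - 1| ≤ 1 + u`; this is why the integral `A`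
      -- carries the weight `1 + u`.
      have hmv : ‖t' ^ (u - 1) - t ^ (u - 1)‖ ≤ ((1 + u) * T' ^ u / t ^ 2) * ‖t' - t‖ := by
        refine Convex.norm_image_sub_le_of_norm_hasDerivWithin_le (f := fun x => x ^ (u - 1))
          (f' := fun x => (u - 1) * x ^ (u - 1 - 1)) (fun x hx => ?_) (fun x hx => ?_)
          (convex_Icc t t') (left_mem_Icc.2 htt') (right_mem_Icc.2 htt')
        · have hx0 : x ≠ 0 := (lt_of_lt_of_le ht hx.1).ne'
          exact (Real.hasDerivAt_rpow_const (Or.inl hx0)).hasDerivWithinAt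
        · have hx0 : 0 < x := lt_of_lt_of_le ht hx.1
          rw [norm_mul, Real.norm_eq_abs, Real.norm_of_nonneg (by positivity),
            show u - 1 - 1 = u - (2 : ℕ) by push_cast; ring, Real.rpow_sub_natCast hx0.ne',
            mul_div_assoc]
          gcongr
          · rw [abs_le]; constructor <;> linarith
          · exact hx.2.trans (ht'T.trans (le_max_left _ _))
          · exact hx.1
      rw [← sub_div, norm_div, Real.norm_of_nonneg hG.le, div_eq_mul_inv]
      rw [Real.norm_of_nonneg (sub_nonneg.2 htt')] at hmv
      calc _ ≤ ((1 + u) * T' ^ u / t ^ 2) * (t' - t) * (Real.Gamma u)⁻¹ := by gcongr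
        _ = _ := by ring
    refine this.trans ?_
    rw [integral_const_mul, mul_comm, mul_div_assoc]
    have : 0 ≤ (t' - t) / t ^ 2 := div_nonneg (sub_nonneg.2 htt') (sq_nonneg t)
    gcongr
    exact le_add_of_nonneg_right zero_le_one

/-- Near `t` the points may be taken in `(t/2, t + 1)`, where the Lipschitz estimate holds with a
constant of order `1/(t/2)²`. -/
theorem continuousOn_volterraI : ContinuousOn volterraI (Ioi 0) := by
  intro t ht
  have ht : 0 < t := ht
  refine ContinuousAt.continuousWithinAt ?_
  obtain ⟨A, hA, -, h⟩ := exists_volterraI_bounds (t + 1)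
  rw [Metric.continuousAt_iff']
  intro ε hε
  have hev : ∀ᶠ x in 𝓝 t, A * |x - t| / (t / 2) ^ 2 < ε := by
    have : Tendsto (fun x => A * |x - t| / (t / 2) ^ 2) (𝓝 t) (𝓝 (A * |t - t| / (t / 2) ^ 2)) :=
      Continuous.tendsto (by fun_prop) t
    refine this.eventually_lt_const ?_
    simpa using hε
  filter_upwards [hev, lt_mem_nhds (show t / 2 < t by linarith),
    gt_mem_nhds (show t < t + 1 by linarith)] with x hx h1 h2
  refine lt_of_le_of_lt ?_ hx
  rw [Real.dist_eq]
  have hx0 : 0 < x := by linarith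
  rcases le_total x t with hxt | hxt
  · rw [abs_sub_comm, abs_sub_comm x t, abs_of_nonneg (sub_nonneg.2 hxt)]
    refine (h x t hx0 hxt (by linarith)).trans ?_
    have := sub_nonneg.2 hxt
    gcongr
  · rw [abs_of_nonneg (sub_nonneg.2 hxt)]
    refine (h t x ht hxt h2.le).trans ?_
    have := sub_nonneg.2 hxt
    gcongr
    linarith

end PointInteraction

/-! ### Convolutions with `𝓘` and Volterra's identity -/

namespace PointInteraction

theorem integrableOn_beta {a b r : ℝ} (ha : 0 < a) (hb : 0 < b) (hr : 0 < r) :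
    IntegrableOn (fun ρ => (r - ρ) ^ (a - 1) * ρ ^ (b - 1)) (Ioo 0 r) ∧
    ∫ ρ in Ioo 0 r, (r - ρ) ^ (a - 1) * ρ ^ (b - 1)
      = r ^ (a + b - 1) * (Real.Gamma a * Real.Gamma b / Real.Gamma (a + b)) := by
  have hval := Complex.betaIntegral_scaled b a hr
  rw [Complex.betaIntegral_eq_Gamma_mul_div _ _ (by simpa) (by simpa)] at hval
  have hcongr : ∀ ρ ∈ Ioo 0 r, (ρ : ℂ) ^ ((b : ℂ) - 1) * ((r : ℂ) - ρ) ^ ((a : ℂ) - 1)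
      = (((r - ρ) ^ (a - 1) * ρ ^ (b - 1) : ℝ) : ℂ) := by
    intro ρ hρ
    rw [← Complex.ofReal_sub, ← Complex.ofReal_one, ← Complex.ofReal_sub, ← Complex.ofReal_sub,
      ← Complex.ofReal_cpow hρ.1.le, ← Complex.ofReal_cpow (sub_nonneg.2 hρ.2.le),
      ← Complex.ofReal_mul, mul_comm]
  rw [intervalIntegral.integral_of_le hr.le, integral_Ioc_eq_integral_Ioo,
    setIntegral_congr_fun measurableSet_Ioo hcongr, integral_complex_ofReal] at hval
  have hv : ∫ ρ in Ioo 0 r, (r - ρ) ^ (a - 1) * ρ ^ (b - 1)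
      = r ^ (a + b - 1) * (Real.Gamma a * Real.Gamma b / Real.Gamma (a + b)) := by
    apply Complex.ofReal_injective
    rw [hval, ← Complex.ofReal_add, Complex.Gamma_ofReal, Complex.Gamma_ofReal, Complex.Gamma_ofReal]
    push_cast
    rw [Complex.ofReal_cpow hr.le]
    push_cast
    rw [add_comm (b : ℂ) a, mul_comm (Real.Gamma b : ℂ)]
    simp only [add_comm b a]
  refine ⟨?_, hv⟩
  -- Integrability comes for free from the value: a non-integrable function would have integral `0`,
  -- but the Beta formula gives a positive number.
  by_contra hni
  have h0 : ∫ ρ in Ioo 0 r, (r - ρ) ^ (a - 1) * ρ ^ (b - 1) = 0 := integral_undef hni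
  rw [h0] at hv
  have := Real.Gamma_pos_of_pos ha
  have := Real.Gamma_pos_of_pos hb
  have := Real.Gamma_pos_of_pos (add_pos ha hb)
  have : 0 < r ^ (a + b - 1) * (Real.Gamma a * Real.Gamma b / Real.Gamma (a + b)) := by positivity
  linarith

theorem integrableOn_rpow_div_Gamma_add {ε r : ℝ} (hε : -1 < ε) (hr : 0 < r) :
    IntegrableOn (fun u => r ^ (u + ε) / Real.Gamma (u + ε + 1)) (Ioi 0) := by
  have h := integrableOn_rpow_div_Gamma hr
  have h2 : IntegrableOn (fun u : ℝ => (1 + u) * r ^ u * (Real.Gamma u)⁻¹) (Ioi (ε + 1)) :=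
    h.mono_set (Ioi_subset_Ioi (by linarith))
  have h3 : IntegrableOn (fun u : ℝ => r ^ u * (Real.Gamma u)⁻¹) (Ioi (ε + 1)) := by
    refine Integrable.mono' h2 ?_ ?_
    · refine ContinuousOn.aestronglyMeasurable ?_ measurableSet_Ioi
      refine ContinuousOn.mul ?_ (continuousOn_inv_Gamma_Ioi.mono (Ioi_subset_Ioi (by linarith)))
      exact fun u _ => (Real.continuousAt_const_rpow hr.ne').continuousWithinAt
    · filter_upwards [ae_restrict_mem measurableSet_Ioi] with u hu
      have hu : 0 < u := lt_trans (by linarith) (mem_Ioi.1 hu)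
      have hG := Real.Gamma_pos_of_pos hu
      have : 0 < r ^ u := Real.rpow_pos_of_pos hr u
      rw [Real.norm_of_nonneg (by positivity), mul_assoc]
      have : 0 < r ^ u * (Real.Gamma u)⁻¹ := by positivity
      nlinarith
  have h4 := ((measurePreserving_add_right volume (ε + 1)).integrableOn_comp_preimage
    (measurableEmbedding_addRight (ε + 1))).2 h3
  rw [show (fun x => x + (ε + 1)) ⁻¹' Ioi (ε + 1) = Ioi 0 by ext x; simp] at h4
  refine IntegrableOn.congr_fun (Integrable.const_mul (show IntegrableOn _ _ _ from h4) r⁻¹) (fun u hu => ?_) measurableSet_Ioi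
  have hu : 0 < u := hu
  simp only [Function.comp, ← add_assoc]
  rw [Real.rpow_add_one hr.ne']
  field_simp

/-- Convolution of `𝓘` with a power. -/
theorem volterraI_conv_rpow {ε r : ℝ} (hε : -1 < ε) (hr : 0 < r) :
    IntegrableOn (fun ρ => volterraI (r - ρ) * (ρ ^ ε / Real.Gamma (ε + 1))) (Ioo 0 r) ∧
    ∫ ρ in Ioo 0 r, volterraI (r - ρ) * (ρ ^ ε / Real.Gamma (ε + 1))
      = ∫ u in Ioi (0 : ℝ), r ^ (u + ε) / Real.Gamma (u + ε + 1) := by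
  have hGε : 0 < Real.Gamma (ε + 1) := Real.Gamma_pos_of_pos (by linarith)
  let F : ℝ → ℝ → ℝ := fun ρ u => (r - ρ) ^ (u - 1) / Real.Gamma u * (ρ ^ ε / Real.Gamma (ε + 1))
  have hF : ∀ u, 0 < u → IntegrableOn (fun ρ => F ρ u) (Ioo 0 r) ∧
      ∫ ρ in Ioo 0 r, F ρ u = r ^ (u + ε) / Real.Gamma (u + ε + 1) := by
    intro u hu
    have hGu : 0 < Real.Gamma u := Real.Gamma_pos_of_pos hu
    obtain ⟨h1, h2⟩ := integrableOn_beta hu (show 0 < ε + 1 by linarith) hr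
    have e : ∀ ρ, F ρ u = (1 / (Real.Gamma u * Real.Gamma (ε + 1))) *
        ((r - ρ) ^ (u - 1) * ρ ^ (ε + 1 - 1)) := by
      intro ρ
      simp only [F, add_sub_cancel_right]
      field_simp
    simp only [e]
    refine ⟨h1.const_mul _, ?_⟩
    rw [integral_const_mul, h2, ← add_assoc, add_sub_cancel_right]
    field_simp
  have hmeas : AEStronglyMeasurable (Function.uncurry F)
      ((volume.restrict (Ioo 0 r)).prod (volume.restrict (Ioi (0 : ℝ)))) := by
    rw [Measure.prod_restrict]
    refine ContinuousOn.aestronglyMeasurable ?_ (measurableSet_Ioo.prod measurableSet_Ioi)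
    rintro ⟨ρ, u⟩ ⟨hρ, hu⟩
    refine ContinuousAt.continuousWithinAt ?_
    have hρ1 : 0 < ρ := hρ.1
    have hρ2 : 0 < r - ρ := sub_pos.2 hρ.2
    have hu : 0 < u := hu
    have hG : ContinuousAt (fun x : ℝ × ℝ => Real.Gamma x.2) (ρ, u) :=
      ContinuousAt.comp (f := Prod.snd) (continuousAt_Gamma hu) continuousAt_snd
    refine ContinuousAt.mul (ContinuousAt.div ?_ hG (Real.Gamma_pos_of_pos hu).ne') ?_
    · exact ContinuousAt.rpow (by fun_prop) (by fun_prop) (Or.inl hρ2.ne')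
    · exact (ContinuousAt.rpow (by fun_prop) (by fun_prop) (Or.inl hρ1.ne')).div_const _
  have hpos : ∀ u, 0 < u → ∀ ρ ∈ Ioo 0 r, 0 ≤ F ρ u := by
    intro u hu ρ hρ
    have := Real.Gamma_pos_of_pos hu
    have := hρ.1
    have := sub_pos.2 hρ.2
    positivity
  -- The integrand is nonnegative, so integrability on the product follows from the iterated
  -- integral with `ρ` inside, which is a Beta integral for each `u`.
  have hint : Integrable (Function.uncurry F)
      ((volume.restrict (Ioo 0 r)).prod (volume.restrict (Ioi (0 : ℝ)))) := by
    rw [integrable_prod_iff' hmeas]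
    constructor
    · filter_upwards [ae_restrict_mem measurableSet_Ioi] with u hu
      exact (hF u hu).1
    · refine IntegrableOn.congr_fun (integrableOn_rpow_div_Gamma_add hε hr) (fun u hu => ?_)
        measurableSet_Ioi
      rw [← (hF u hu).2]
      refine setIntegral_congr_fun measurableSet_Ioo fun ρ hρ => ?_
      exact (Real.norm_of_nonneg (hpos u hu ρ hρ)).symm
  have hI : ∀ ρ ∈ Ioo 0 r, ∫ u in Ioi (0 : ℝ), F ρ u
      = volterraI (r - ρ) * (ρ ^ ε / Real.Gamma (ε + 1)) := by
    intro ρ hρ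
    rw [volterraI_of_pos (sub_pos.2 hρ.2), integral_mul_const]
  constructor
  · exact IntegrableOn.congr_fun hint.integral_prod_left hI measurableSet_Ioo
  · rw [← setIntegral_congr_fun measurableSet_Ioo hI, integral_integral_swap hint]
    exact setIntegral_congr_fun measurableSet_Ioi fun u hu => (hF u hu).2

theorem integrableOn_volterraI_sub {r : ℝ} (hr : 0 < r) :
    IntegrableOn (fun ρ => volterraI (r - ρ)) (Ioo 0 r) := by
  simpa using (volterraI_conv_rpow (ε := 0) (by norm_num) hr).1

theorem integrableOn_volterraI {r : ℝ} (hr : 0 < r) : IntegrableOn volterraI (Ioo 0 r) := by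
  have h := ((Measure.measurePreserving_sub_left volume r).integrableOn_comp_preimage
    (MeasurableEquiv.subLeft r).measurableEmbedding).2 (integrableOn_volterraI_sub hr)
  simpa [Function.comp_def] using h

theorem integral_volterraI {r : ℝ} (hr : 0 < r) :
    ∫ ρ in Ioo 0 r, volterraI ρ = ∫ u in Ioi (0 : ℝ), r ^ u / Real.Gamma (u + 1) := by
  have h := (volterraI_conv_rpow (ε := 0) (by norm_num) hr).2
  simp only [Real.rpow_zero, zero_add, Real.Gamma_one, div_one, mul_one, add_zero] at h
  rw [← h, ← integral_Ioc_eq_integral_Ioo, ← integral_Ioc_eq_integral_Ioo,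
    ← intervalIntegral.integral_of_le hr.le, ← intervalIntegral.integral_of_le hr.le,
    intervalIntegral.integral_comp_sub_left (fun x => volterraI x)]
  simp

/-- The mass of `𝓘` near `0` is only logarithmically small. -/
theorem integral_volterraI_le {r : ℝ} (hr : 0 < r) (hr1 : r < 1) :
    ∫ ρ in Ioo 0 r, volterraI ρ ≤ Real.exp 1 / -Real.log r := by
  rw [integral_volterraI hr]
  have hlog : Real.log r < 0 := Real.log_neg hr hr1
  have hint : IntegrableOn (fun u => Real.exp (Real.log r * u)) (Ioi 0) :=
    integrableOn_exp_mul_Ioi hlog 0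
  -- The bound on `1/Γ(u+1)` with `M = 1` is just `e`, and `∫_0^∞ r^u du = 1/|log r|`.
  calc ∫ u in Ioi (0 : ℝ), r ^ u / Real.Gamma (u + 1)
      ≤ ∫ u in Ioi (0 : ℝ), Real.exp 1 * Real.exp (Real.log r * u) := by
        refine setIntegral_mono_on ?_ (hint.const_mul _) measurableSet_Ioi fun u hu => ?_
        · simpa using integrableOn_rpow_div_Gamma_add (ε := 0) (by norm_num) hr
        · have hu : 0 < u := hu
          rw [← Real.rpow_def_of_pos hr, div_eq_mul_inv, mul_comm]
          gcongr
          simpa using inv_Gamma_add_one_le hu.le one_pos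
    _ = _ := by
        rw [integral_const_mul, integral_exp_mul_Ioi hlog]
        simp [div_eq_mul_inv, inv_neg]

/-- Apply `log x ≤ x - 1` to `ρ` and to `ρ^(-1/2)`. A power greater than `-1` is needed because
`volterraI_conv_rpow` covers exactly those. -/
theorem abs_log_le_rpow {ρ : ℝ} (hρ : 0 < ρ) : |Real.log ρ| ≤ 2 * ρ ^ (-(1 / 2) : ℝ) + ρ := by
  have h0 : 0 < ρ ^ (-(1 / 2) : ℝ) := Real.rpow_pos_of_pos hρ _
  have h1 : Real.log ρ ≤ ρ := (Real.log_le_sub_one_of_pos hρ).trans (by linarith)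
  have h2 : Real.log (ρ ^ (-(1 / 2) : ℝ)) ≤ ρ ^ (-(1 / 2) : ℝ) :=
    (Real.log_le_sub_one_of_pos h0).trans (by linarith)
  rw [Real.log_rpow hρ] at h2
  rw [abs_le]
  constructor <;> linarith

theorem integrableOn_volterraI_mul_log {r : ℝ} (hr : 0 < r) :
    IntegrableOn (fun ρ => volterraI (r - ρ) * |Real.log ρ|) (Ioo 0 r) := by
  have h1 := (volterraI_conv_rpow (ε := -(1 / 2)) (by norm_num) hr).1
  have h2 := integrableOn_volterraI_sub hr
  refine Integrable.mono' (g := fun ρ => 2 * Real.Gamma (-(1 / 2) + 1) *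
    (volterraI (r - ρ) * (ρ ^ (-(1 / 2) : ℝ) / Real.Gamma (-(1 / 2) + 1))) +
    r * volterraI (r - ρ)) ((h1.const_mul _).add (h2.const_mul _)) ?_ ?_
  · refine h2.aestronglyMeasurable.mul ?_
    exact (Real.measurable_log.norm).aestronglyMeasurable
  · filter_upwards [ae_restrict_mem measurableSet_Ioo] with ρ hρ
    have hI := volterraI_nonneg (sub_pos.2 hρ.2)
    have hG : 0 < Real.Gamma (-(1 / 2) + 1) := Real.Gamma_pos_of_pos (by norm_num)
    rw [Real.norm_of_nonneg (by positivity)]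
    have := abs_log_le_rpow hρ.1
    calc _ ≤ volterraI (r - ρ) * (2 * ρ ^ (-(1 / 2) : ℝ) + r) := by
            gcongr
            linarith [hρ.2]
      _ = _ := by field_simp

/-- Difference quotient bound for `ε ↦ ρ^ε`. -/
theorem abs_rpow_sub_one_le {ρ ε : ℝ} (hρ : 0 < ρ) (hε : 0 < ε) (hε1 : ε ≤ 1) :
    |ρ ^ ε - 1| ≤ ε * (|Real.log ρ| * max 1 ρ) := by
  have hmax : ∀ x : ℝ, 0 ≤ x → x ≤ ε → ρ ^ x ≤ max 1 ρ := by
    intro x hx hxε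
    rcases le_total ρ 1 with h | h
    · exact (Real.rpow_le_one hρ.le h hx).trans (le_max_left _ _)
    · refine le_trans ?_ (le_max_right _ _)
      calc ρ ^ x ≤ ρ ^ (1 : ℝ) := Real.rpow_le_rpow_of_exponent_le h (hxε.trans hε1)
        _ = ρ := Real.rpow_one ρ
  have := Convex.norm_image_sub_le_of_norm_hasDerivWithin_le (f := fun x : ℝ => ρ ^ x)
    (f' := fun x => ρ ^ x * Real.log ρ) (C := |Real.log ρ| * max 1 ρ) (s := Icc 0 ε)
    (x := 0) (y := ε) (fun x _ => (Real.hasStrictDerivAt_const_rpow hρ x).hasDerivAt.hasDerivWithinAt)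
    (fun x hx => ?_) (convex_Icc _ _) (left_mem_Icc.2 hε.le) (right_mem_Icc.2 hε.le)
  · simp only [Real.rpow_zero, sub_zero, Real.norm_eq_abs, abs_of_pos hε] at this
    linarith
  · rw [norm_mul, Real.norm_of_nonneg (Real.rpow_nonneg hρ.le x), Real.norm_eq_abs, mul_comm]
    gcongr
    exact hmax x hx.1 hx.2

/-- Volterra's identity: `𝓘` is the resolvent of the logarithmic kernel `-γ - log`. -/
theorem volterraI_conv_log {r : ℝ} (hr : 0 < r) :
    ∫ ρ in Ioo 0 r, volterraI (r - ρ) * (-Real.eulerMascheroniConstant - Real.log ρ) = 1 := by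
  -- The function `-γ - log ρ` is minus the derivative at `ε = 0` of `ρ^ε/Γ(ε+1)`. Convolving this
  -- power with `𝓘` gives `∫_ε^∞ F` with `F(u) = r^u/Γ(u+1)`. The convolved difference quotients are
  -- therefore the means of `F` over `[0, ε]`, which tend to `F(0) = 1`.
  let ε : ℕ → ℝ := fun n => 1 / ((n : ℝ) + 1)
  have hε : ∀ n, 0 < ε n := fun n => by positivity
  have hε1 : ∀ n, ε n ≤ 1 := fun n => by
    simp only [ε]
    rw [div_le_one (by positivity)]
    linarith [n.cast_nonneg (α := ℝ)]
  have hε0 : Tendsto ε atTop (𝓝 0) := tendsto_one_div_add_atTop_nhds_zero_nat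
  have hε0' : Tendsto ε atTop (𝓝[≠] 0) :=
    tendsto_nhdsWithin_iff.2 ⟨hε0, Eventually.of_forall fun n => (hε n).ne'⟩
  let P : ℝ → ℝ → ℝ := fun e ρ => ρ ^ e / Real.Gamma (e + 1)
  let φ : ℕ → ℝ → ℝ := fun n ρ => (1 - P (ε n) ρ) / ε n
  have hΓ : HasDerivAt (fun e : ℝ => Real.Gamma (e + 1)) (-Real.eulerMascheroniConstant) 0 := by
    have h := Real.hasDerivAt_Gamma_one
    have h2 := HasDerivAt.comp_add_const (f := Real.Gamma) (x := 0) (a := 1) (by simpa using h)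
    exact h2
  have hφlim : ∀ ρ, 0 < ρ → Tendsto (fun n => φ n ρ) atTop
      (𝓝 (-Real.eulerMascheroniConstant - Real.log ρ)) := by
    intro ρ hρ
    have hP : HasDerivAt (fun e => P e ρ) (Real.log ρ + Real.eulerMascheroniConstant) 0 := by
      have h1 : HasDerivAt (fun e : ℝ => ρ ^ e) (ρ ^ (0 : ℝ) * Real.log ρ) 0 :=
        (Real.hasStrictDerivAt_const_rpow hρ 0).hasDerivAt
      have h2 := h1.div hΓ (by simp)
      refine h2.congr_deriv ?_
      simp
    have h := (hasDerivAt_iff_tendsto_slope.1 hP).comp hε0'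
    refine (h.neg.congr fun n => ?_).trans (le_of_eq ?_)
    · simp only [Function.comp, slope_def_field, φ, P]
      simp only [Real.rpow_zero, zero_add, Real.Gamma_one, div_one, sub_zero]
      rw [← neg_div, neg_sub]
    · congr 1; ring
  -- At `ρ = 1` the power drops out, and the bound for the Gamma factor is the boundedness of a
  -- convergent sequence.
  obtain ⟨D, hD⟩ : ∃ D : ℝ, ∀ n, |1 - 1 / Real.Gamma (ε n + 1)| / ε n ≤ D := by
    have h := (hφlim 1 one_pos).abs.bddAbove_range
    obtain ⟨D, hD⟩ := h
    refine ⟨D, fun n => ?_⟩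
    refine le_trans (le_of_eq ?_) (hD ⟨n, rfl⟩)
    simp only [φ, P, Real.one_rpow]
    rw [abs_div, abs_of_pos (hε n)]
  have hbound : ∀ n, ∀ ρ ∈ Ioo 0 r, |φ n ρ| ≤ D + Real.exp 1 * (|Real.log ρ| * max 1 r) := by
    intro n ρ hρ
    have hG : 0 < Real.Gamma (ε n + 1) := Real.Gamma_pos_of_pos (by linarith [hε n])
    have e : φ n ρ = (1 - 1 / Real.Gamma (ε n + 1)) / ε n -
        (Real.Gamma (ε n + 1))⁻¹ * ((ρ ^ ε n - 1) / ε n) := by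
      simp only [φ, P]
      have := (hε n).ne'
      field_simp
      ring
    rw [e]
    refine (abs_sub _ _).trans (add_le_add ?_ ?_)
    · rw [abs_div, abs_of_pos (hε n)]; exact hD n
    · rw [abs_mul, abs_of_pos (inv_pos.2 hG), abs_div, abs_of_pos (hε n)]
      gcongr
      · simpa using inv_Gamma_add_one_le (hε n).le one_pos
      · rw [div_le_iff₀ (hε n), mul_comm]
        refine (abs_rpow_sub_one_le hρ.1 (hε n) (hε1 n)).trans ?_
        have := hε n
        gcongr
        exact hρ.2.le
  have hL : Tendsto (fun n => ∫ ρ in Ioo 0 r, volterraI (r - ρ) * φ n ρ) atTop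
      (𝓝 (∫ ρ in Ioo 0 r, volterraI (r - ρ) * (-Real.eulerMascheroniConstant - Real.log ρ))) := by
    refine tendsto_integral_of_dominated_convergence
      (fun ρ => D * volterraI (r - ρ) + Real.exp 1 * max 1 r * (volterraI (r - ρ) * |Real.log ρ|))
      (fun n => ?_) (((integrableOn_volterraI_sub hr).const_mul _).add
        ((integrableOn_volterraI_mul_log hr).const_mul _)) (fun n => ?_) ?_
    · refine (integrableOn_volterraI_sub hr).aestronglyMeasurable.mul ?_
      refine Measurable.aestronglyMeasurable ?_
      simp only [φ, P]
      fun_prop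
    · filter_upwards [ae_restrict_mem measurableSet_Ioo] with ρ hρ
      have hI := volterraI_nonneg (sub_pos.2 hρ.2)
      rw [norm_mul, Real.norm_of_nonneg hI, Real.norm_eq_abs]
      have := mul_le_mul_of_nonneg_left (hbound n ρ hρ) hI
      refine this.trans (le_of_eq ?_)
      ring
    · filter_upwards [ae_restrict_mem measurableSet_Ioo] with ρ hρ
      exact (hφlim ρ hρ.1).const_mul _
  let F : ℝ → ℝ := fun u => r ^ u / Real.Gamma (u + 1)
  have hFint : IntegrableOn F (Ioi 0) := by
    simpa using integrableOn_rpow_div_Gamma_add (ε := 0) (by norm_num) hr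
  have hFc : ∀ u, -1 < u → ContinuousAt F u := by
    intro u hu
    refine ContinuousAt.div (Real.continuousAt_const_rpow hr.ne') ?_
      (Real.Gamma_pos_of_pos (by linarith)).ne'
    exact ContinuousAt.comp (f := fun u : ℝ => u + 1) (continuousAt_Gamma (by linarith))
      (by fun_prop)
  have hval : ∀ n, ∫ ρ in Ioo 0 r, volterraI (r - ρ) * φ n ρ = (∫ u in (0 : ℝ)..ε n, F u) / ε n := by
    intro n
    have h0 := volterraI_conv_rpow (ε := 0) (by norm_num) hr
    have h1 := volterraI_conv_rpow (ε := ε n) (by linarith [hε n]) hr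
    have e : ∀ ρ, volterraI (r - ρ) * φ n ρ = (volterraI (r - ρ) * (ρ ^ (0 : ℝ) / Real.Gamma (0 + 1))
        - volterraI (r - ρ) * (ρ ^ ε n / Real.Gamma (ε n + 1))) / ε n := by
      intro ρ
      simp only [φ, P, Real.rpow_zero, zero_add, Real.Gamma_one, div_one]
      ring
    simp only [e]
    rw [integral_div, integral_sub h0.1 h1.1, h0.2, h1.2]
    congr 1
    have hs : ∫ u in Ioi (0 : ℝ), r ^ (u + ε n) / Real.Gamma (u + ε n + 1)
        = ∫ u in Ioi (ε n), F u := by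
      have := (measurePreserving_add_right volume (ε n)).setIntegral_preimage_emb
        (measurableEmbedding_addRight (ε n)) F (Ioi (ε n))
      simpa [F] using this
    have hsplit := intervalIntegral.integral_Ioi_sub_Ioi hFint (hε n).le
    rw [hs, ← hsplit]
    simp [F]
  have hR : Tendsto (fun n => (∫ u in (0 : ℝ)..ε n, F u) / ε n) atTop (𝓝 (F 0)) := by
    have hd : HasDerivAt (fun x => ∫ u in (0 : ℝ)..x, F u) (F 0) 0 := by
      refine intervalIntegral.integral_hasDerivAt_right (by simp) ?_ (hFc 0 (by norm_num))
      have : ContinuousOn F (Ioi (-1)) := fun u hu => (hFc u hu).continuousWithinAt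
      exact this.stronglyMeasurableAtFilter isOpen_Ioi 0 (by norm_num)
    refine ((hasDerivAt_iff_tendsto_slope.1 hd).comp hε0').congr fun n => ?_
    simp [slope_def_field]
  have := tendsto_nhds_unique (hL.congr hval) hR
  rw [this]
  simp [F]

end PointInteraction

/-! ### Young and Gronwall inequalities in `L²` -/

namespace PointInteraction

theorem ennreal_add_sq_le (a b : ℝ≥0∞) : (a + b) ^ 2 ≤ 2 * a ^ 2 + 2 * b ^ 2 := by
  induction a with
  | top => simp
  | coe a =>
    induction b with
    | top => simp
    | coe b =>
      norm_cast
      rw [← NNReal.coe_le_coe]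
      push_cast
      nlinarith [sq_nonneg ((a : ℝ) - b)]

/-- Cauchy–Schwarz for the measure `k du`, obtained by splitting the weight as `k^(1/2) · k^(1/2)`.
-/
theorem lintegral_mul_sq_le {k F : ℝ → ℝ≥0∞} (hk : Measurable k) (hF : Measurable F) :
    (∫⁻ u, k u * F u) ^ 2 ≤ (∫⁻ u, k u) * ∫⁻ u, k u * F u ^ 2 := by
  have h := ENNReal.lintegral_mul_le_Lp_mul_Lq volume Real.HolderConjugate.two_two
    (f := fun u => k u ^ (1 / 2 : ℝ)) (g := fun u => k u ^ (1 / 2 : ℝ) * F u)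
    (by fun_prop) (by fun_prop)
  have hk2 : ∀ u, k u ^ (1 / 2 : ℝ) * k u ^ (1 / 2 : ℝ) = k u := by
    intro u
    rw [← ENNReal.rpow_add_of_nonneg _ _ (by norm_num) (by norm_num)]
    norm_num
  have e1 : ∀ u, (fun u => k u ^ (1 / 2 : ℝ)) u ^ (2 : ℝ) = k u := by
    intro u
    simp only [ENNReal.rpow_two, sq, hk2]
  have e2 : ∀ u, (fun u => k u ^ (1 / 2 : ℝ) * F u) u ^ (2 : ℝ) = k u * F u ^ 2 := by
    intro u
    simp only [ENNReal.rpow_two, mul_pow]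
    rw [sq (k u ^ (1 / 2 : ℝ)), hk2]
  simp only [e1, e2, Pi.mul_apply, ← mul_assoc, hk2] at h
  calc _ ≤ ((∫⁻ u, k u) ^ (1 / 2 : ℝ) * (∫⁻ u, k u * F u ^ 2) ^ (1 / 2 : ℝ)) ^ 2 := by gcongr
    _ = _ := by
      rw [mul_pow, ← ENNReal.rpow_two, ← ENNReal.rpow_two, ← ENNReal.rpow_mul, ← ENNReal.rpow_mul]
      norm_num

/-- Young's inequality for the convolution of an integrable with a square integrable function. -/
theorem lintegral_conv_sq_le {k F : ℝ → ℝ≥0∞} (hk : Measurable k) (hF : Measurable F) :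
    ∫⁻ r, (∫⁻ u, k u * F (r - u)) ^ 2 ≤ (∫⁻ u, k u) ^ 2 * ∫⁻ r, F r ^ 2 := by
  calc ∫⁻ r, (∫⁻ u, k u * F (r - u)) ^ 2
      ≤ ∫⁻ r, (∫⁻ u, k u) * ∫⁻ u, k u * F (r - u) ^ 2 := by
        refine lintegral_mono fun r => ?_
        exact lintegral_mul_sq_le hk (hF.comp (measurable_const.sub measurable_id))
    _ = (∫⁻ u, k u) * ∫⁻ u, ∫⁻ r, k u * F (r - u) ^ 2 := by
        rw [lintegral_const_mul, lintegral_lintegral_swap]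
        · fun_prop
        · fun_prop
    _ = _ := by
        have : ∀ u, ∫⁻ r, k u * F (r - u) ^ 2 = k u * ∫⁻ r, F r ^ 2 := by
          intro u
          rw [lintegral_const_mul _ (by fun_prop)]
          rw [lintegral_sub_right_eq_self (fun r => F r ^ 2) u]
        simp only [this]
        rw [lintegral_mul_const _ hk, sq, mul_assoc]

/-- A Gronwall inequality in `L²` for integral inequalities with an integrable causal kernel. -/
theorem exists_lintegral_sq_le_of_le_conv {k : ℝ → ℝ≥0∞} (hk : Measurable k)
    (hk0 : ∀ u ≤ 0, k u = 0) (hki : ∫⁻ u, k u ≠ ∞) (C : NNReal) (R : ℝ) :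
    ∃ K : ℝ≥0∞, K ≠ ∞ ∧ ∀ X E : ℝ → ℝ≥0∞, Measurable X → Measurable E →
      (∀ r, X r ≠ 0 → |r| ≤ R) → (∀ r, E r ≠ 0 → |r| ≤ R) → (∃ b : NNReal, ∀ r, X r ≤ b) →
      (∀ r, X r ≤ ∫⁻ u, k u * (E (r - u) + C * X (r - u))) →
      ∫⁻ r, X r ^ 2 ≤ K * ∫⁻ r, E r ^ 2 := by
  -- An exponential weight distributes over convolutions, since `w μ r = w μ u * w μ (r - u)`.
  -- Because `k` lives on `u > 0`, the weighted mass of `k` tends to `0` as `μ → ∞`, by dominated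
  -- convergence.
  let w : ℝ → ℝ → ℝ≥0∞ := fun μ r => ENNReal.ofReal (Real.exp (-(μ * r)))
  have hwm : ∀ μ, Measurable (w μ) := fun μ => by fun_prop
  have hlim : Tendsto (fun n : ℕ => ∫⁻ u, w n u * k u) atTop (𝓝 0) := by
    have h := tendsto_lintegral_of_dominated_convergence (μ := volume)
      (F := fun n : ℕ => fun u => w n u * k u) (f := fun _ => 0) k
      (fun n => (hwm n).mul hk) (fun n => Eventually.of_forall fun u => ?_) hki
      ?_
    · simpa using h
    · rcases le_or_gt u 0 with hu | hu
      · simp [hk0 u hu]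
      · refine mul_le_of_le_one_left (zero_le) ?_
        simp only [w]
        rw [ENNReal.ofReal_le_one, Real.exp_le_one_iff]
        have : 0 ≤ (n : ℝ) * u := by positivity
        linarith
    · filter_upwards [ae_lt_top hk hki] with u hfin
      rcases le_or_gt u 0 with hu | hu
      · simp [hk0 u hu]
      · have h1 : Tendsto (fun n : ℕ => w n u) atTop (𝓝 0) := by
          have h2 : Tendsto (fun n : ℕ => Real.exp (-((n : ℝ) * u))) atTop (𝓝 0) :=
            Real.tendsto_exp_neg_atTop_nhds_zero.comp
              (tendsto_natCast_atTop_atTop.atTop_mul_const hu)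
          simpa using ENNReal.tendsto_ofReal h2
        have := ENNReal.Tendsto.mul_const h1 (Or.inr hfin.ne) (b := k u)
        simpa using this
  -- With this choice of `μ`, Young's inequality puts at most `Y/2` on the right, where `Y` is the
  -- weighted square integral of `X`.
  have hev : ∀ᶠ n : ℕ in atTop, (∫⁻ u, w n u * k u) ^ 2 * (2 * (C : ℝ≥0∞) ^ 2) ≤ 1 / 2 := by
    have h2 : Tendsto (fun n : ℕ => (∫⁻ u, w n u * k u) ^ 2 * (2 * (C : ℝ≥0∞) ^ 2)) atTop
        (𝓝 0) := by
      have hc : (2 * (C : ℝ≥0∞) ^ 2) ≠ ∞ := by finiteness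
      have := ENNReal.Tendsto.mul_const (ENNReal.Tendsto.pow (n := 2) hlim) (Or.inr hc)
      simpa using this
    exact h2.eventually_le_const (by norm_num)
  obtain ⟨n, hn⟩ := hev.exists
  set μ : ℝ := ((n : ℕ) : ℝ) with hμd
  have hμ : 0 ≤ μ := n.cast_nonneg
  set κ := ∫⁻ u, w μ u * k u
  set B : ℝ≥0∞ := ENNReal.ofReal (Real.exp (μ * R))
  have hB : B ≠ ∞ := ENNReal.ofReal_ne_top
  have hκ : κ ≠ ∞ := by
    refine ne_top_of_le_ne_top hki (lintegral_mono fun u => ?_)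
    rcases le_or_gt u 0 with hu | hu
    · simp [hk0 u hu]
    · refine mul_le_of_le_one_left (zero_le) ?_
      simp only [w]
      rw [ENNReal.ofReal_le_one, Real.exp_le_one_iff]
      have : 0 ≤ μ * u := by positivity
      linarith
  refine ⟨B ^ 2 * (2 * (κ ^ 2 * (2 * B ^ 2))), by finiteness, ?_⟩
  intro X E hX hE hXs hEs ⟨b, hb⟩ hle
  have hwB : ∀ r, |r| ≤ R → w μ r ≤ B := by
    intro r hr
    refine ENNReal.ofReal_le_ofReal (Real.exp_le_exp.2 ?_)
    have := (abs_le.1 hr).1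
    nlinarith
  have hBw : ∀ r, |r| ≤ R → 1 ≤ B * w μ r := by
    intro r hr
    simp only [B, w]
    rw [← ENNReal.ofReal_mul (Real.exp_pos _).le, ← Real.exp_add, ENNReal.one_le_ofReal,
      Real.one_le_exp_iff]
    have := (abs_le.1 hr).2
    nlinarith
  set Y : ℝ≥0∞ := ∫⁻ r, (w μ r * X r) ^ 2
  have hYX : ∫⁻ r, X r ^ 2 ≤ B ^ 2 * Y := by
    rw [← lintegral_const_mul _ (by fun_prop)]
    refine lintegral_mono fun r => ?_
    by_cases hr : X r = 0
    · simp [hr]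
    · calc X r ^ 2 = (1 * X r) ^ 2 := by rw [one_mul]
        _ ≤ (B * w μ r * X r) ^ 2 := by gcongr; exact hBw r (hXs r hr)
        _ = _ := by rw [mul_assoc, mul_pow]
  -- Finiteness is what permits the subtraction of `Y/2` below. The bound on `X` and its bounded
  -- support are used for this only; they do not enter the constant.
  have hYfin : Y ≠ ∞ := by
    have : Y ≤ ∫⁻ r, (Icc (-R) R).indicator (fun _ => (B * b) ^ 2) r := by
      refine lintegral_mono fun r => ?_
      by_cases hr : X r = 0
      · simp [hr]
      · have hmem : r ∈ Icc (-R) R := abs_le.1 (hXs r hr)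
        rw [indicator_of_mem hmem]
        gcongr
        · exact hwB r (hXs r hr)
        · exact hb r
    refine ne_top_of_le_ne_top ?_ this
    rw [lintegral_indicator measurableSet_Icc, lintegral_const, Measure.restrict_apply_univ,
      Real.volume_Icc]
    exact ENNReal.mul_ne_top (ENNReal.pow_ne_top (ENNReal.mul_ne_top hB ENNReal.coe_ne_top))
      ENNReal.ofReal_ne_top
  have hwE : ∫⁻ r, (w μ r * E r) ^ 2 ≤ B ^ 2 * ∫⁻ r, E r ^ 2 := by
    rw [← lintegral_const_mul _ (by fun_prop)]
    refine lintegral_mono fun r => ?_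
    by_cases hr : E r = 0
    · simp [hr]
    · rw [mul_pow]; gcongr; exact hwB r (hEs r hr)
  have hconv : ∀ r, w μ r * X r ≤
      ∫⁻ u, (w μ u * k u) * (fun v => w μ v * E v + C * (w μ v * X v)) (r - u) := by
    intro r
    calc w μ r * X r ≤ w μ r * ∫⁻ u, k u * (E (r - u) + C * X (r - u)) := by gcongr; exact hle r
      _ = ∫⁻ u, w μ r * (k u * (E (r - u) + C * X (r - u))) := by
          rw [lintegral_const_mul _ (by fun_prop)]
      _ = _ := by
          refine lintegral_congr fun u => ?_
          have : w μ r = w μ u * w μ (r - u) := by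
            simp only [w]
            rw [← ENNReal.ofReal_mul (Real.exp_pos _).le, ← Real.exp_add]
            congr 2; ring
          rw [this]
          ring
  have hmain : Y ≤ κ ^ 2 * (2 * B ^ 2) * (∫⁻ r, E r ^ 2) + Y / 2 := by
    calc Y ≤ ∫⁻ r, (∫⁻ u, (w μ u * k u) *
          (fun v => w μ v * E v + C * (w μ v * X v)) (r - u)) ^ 2 := by
          refine lintegral_mono fun r => ?_
          gcongr
          exact hconv r
      _ ≤ κ ^ 2 * ∫⁻ r, (w μ r * E r + C * (w μ r * X r)) ^ 2 :=
          lintegral_conv_sq_le ((hwm μ).mul hk) (by fun_prop)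
      _ ≤ κ ^ 2 * ∫⁻ r, (2 * (w μ r * E r) ^ 2 + 2 * (C : ℝ≥0∞) ^ 2 * (w μ r * X r) ^ 2) := by
          gcongr with r
          refine (ennreal_add_sq_le _ _).trans (le_of_eq ?_)
          rw [mul_pow (C : ℝ≥0∞)]; ring
      _ = κ ^ 2 * (2 * (∫⁻ r, (w μ r * E r) ^ 2) + 2 * (C : ℝ≥0∞) ^ 2 * Y) := by
          rw [lintegral_add_left (by fun_prop), lintegral_const_mul _ (by fun_prop),
            lintegral_const_mul _ (by fun_prop)]
      _ ≤ κ ^ 2 * (2 * (B ^ 2 * ∫⁻ r, E r ^ 2) + 2 * (C : ℝ≥0∞) ^ 2 * Y) := by gcongr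
      _ = κ ^ 2 * (2 * B ^ 2) * (∫⁻ r, E r ^ 2) + κ ^ 2 * (2 * (C : ℝ≥0∞) ^ 2) * Y := by ring
      _ ≤ κ ^ 2 * (2 * B ^ 2) * (∫⁻ r, E r ^ 2) + 1 / 2 * Y := by gcongr
      _ = _ := by rw [one_div, ENNReal.div_eq_inv_mul]
  have hY2 : Y ≤ 2 * (κ ^ 2 * (2 * B ^ 2) * ∫⁻ r, E r ^ 2) := by
    have h1 : Y / 2 + Y / 2 ≤ κ ^ 2 * (2 * B ^ 2) * (∫⁻ r, E r ^ 2) + Y / 2 := by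
      rwa [ENNReal.add_halves]
    have hfin : Y / 2 ≠ ∞ := ENNReal.div_ne_top hYfin (by norm_num)
    have h2 := (ENNReal.add_le_add_iff_right hfin).1 h1
    calc Y = 2 * (Y / 2) := by rw [ENNReal.mul_div_cancel (by norm_num) (by norm_num)]
      _ ≤ _ := by gcongr
  calc ∫⁻ r, X r ^ 2 ≤ B ^ 2 * Y := hYX
    _ ≤ B ^ 2 * (2 * (κ ^ 2 * (2 * B ^ 2) * ∫⁻ r, E r ^ 2)) := by gcongr
    _ = _ := by ring

/-! ### Families with `L²` increments of order one half -/

/-- A family of functions depending on an increment `δ` whose square integrals over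
`(-∞, R - δ]` are `O(δ)`. -/
def HalfSq (R : ℝ) (F : ℝ → ℝ → ℝ≥0∞) : Prop :=
  ∃ C : ℝ≥0∞, C ≠ ∞ ∧ ∀ δ ∈ Ioc 0 R, ∫⁻ r in Iic (R - δ), F δ r ^ 2 ≤ C * ENNReal.ofReal δ

theorem HalfSq.add {R : ℝ} {F G : ℝ → ℝ → ℝ≥0∞} (hF : HalfSq R F) (hG : HalfSq R G)
    (hFm : ∀ δ, Measurable (F δ)) : HalfSq R (fun δ r => F δ r + G δ r) := by
  obtain ⟨C, hC, hF⟩ := hF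
  obtain ⟨D, hD, hG⟩ := hG
  refine ⟨2 * C + 2 * D, by finiteness, fun δ hδ => ?_⟩
  have := hFm δ
  calc _ ≤ ∫⁻ r in Iic (R - δ), (2 * F δ r ^ 2 + 2 * G δ r ^ 2) :=
        lintegral_mono fun r => ennreal_add_sq_le _ _
    _ = 2 * (∫⁻ r in Iic (R - δ), F δ r ^ 2) + 2 * (∫⁻ r in Iic (R - δ), G δ r ^ 2) := by
        rw [lintegral_add_left (by fun_prop), lintegral_const_mul _ (by fun_prop),
          lintegral_const_mul' _ _ (by norm_num)]
    _ ≤ 2 * (C * ENNReal.ofReal δ) + 2 * (D * ENNReal.ofReal δ) := by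
        gcongr
        · exact hF δ hδ
        · exact hG δ hδ
    _ = _ := by ring

theorem HalfSq.const_mul {R : ℝ} {F : ℝ → ℝ → ℝ≥0∞} (hF : HalfSq R F) {c : ℝ≥0∞} (hc : c ≠ ∞) :
    HalfSq R (fun δ r => c * F δ r) := by
  obtain ⟨C, hC, hF⟩ := hF
  refine ⟨c ^ 2 * C, by finiteness, fun δ hδ => ?_⟩
  simp only [mul_pow]
  rw [lintegral_const_mul' _ _ (by finiteness), mul_assoc]
  gcongr
  exact hF δ hδ

theorem HalfSq.mono {R : ℝ} {F G : ℝ → ℝ → ℝ≥0∞} (hF : HalfSq R F)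
    (h : ∀ δ ∈ Ioc 0 R, ∀ r ≤ R - δ, G δ r ≤ F δ r) : HalfSq R G := by
  obtain ⟨C, hC, hF⟩ := hF
  refine ⟨C, hC, fun δ hδ => le_trans ?_ (hF δ hδ)⟩
  refine setLIntegral_mono' measurableSet_Iic fun r hr => ?_
  gcongr
  exact h δ hδ r hr

theorem HalfSq.sum {R : ℝ} {ι : Type*} (s : Finset ι) {F : ι → ℝ → ℝ → ℝ≥0∞}
    (hF : ∀ i ∈ s, HalfSq R (F i)) (hFm : ∀ i ∈ s, ∀ δ, Measurable (F i δ)) :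
    HalfSq R (fun δ r => ∑ i ∈ s, F i δ r) := by
  classical
  induction s using Finset.induction_on with
  | empty => exact ⟨0, by simp, fun δ _ => by simp⟩
  | insert i s his ih =>
    simp only [Finset.sum_insert his]
    refine HalfSq.add (hF i (Finset.mem_insert_self i s)) (ih (fun j hj => hF j
      (Finset.mem_insert_of_mem hj)) fun j hj => hFm j (Finset.mem_insert_of_mem hj))
      (hFm i (Finset.mem_insert_self i s))

/-- The increments of `f`. -/
noncomputable def incr (f : ℝ → ℂ) (δ r : ℝ) : ℝ≥0∞ := ‖f (r + δ) - f r‖ₑ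

theorem measurable_incr {f : ℝ → ℂ} (hf : Measurable f) (δ : ℝ) : Measurable (incr f δ) := by
  unfold incr; fun_prop

end PointInteraction

/-! ### Increments of convolutions and Volterra systems -/

namespace PointInteraction

theorem enorm_le_coe {z : ℂ} {M : NNReal} (h : ‖z‖ ≤ M) : ‖z‖ₑ ≤ M := by
  rw [← ofReal_norm, ← ENNReal.ofReal_coe_nnreal]
  exact ENNReal.ofReal_le_ofReal h

theorem integrable_kernel_mul {k : ℝ → ℝ} (hki : Integrable k) {h : ℝ → ℂ} (hm : Measurable h)
    {M : ℝ} (hM : ∀ r, ‖h r‖ ≤ M) (r : ℝ) : Integrable fun u => (k u : ℂ) * h (r - u) :=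
  (hki.ofReal (𝕜 := ℂ)).mul_bdd (c := M) (hm.comp (measurable_const.sub measurable_id)).aestronglyMeasurable
    (Eventually.of_forall fun _ => hM _)

/-- Increments of a convolution. -/
theorem incr_conv_le {k : ℝ → ℝ} (hki : Integrable k) {h P : ℝ → ℂ} (hm : Measurable h) {M : ℝ}
    (hM : ∀ r, ‖h r‖ ≤ M) {R : ℝ} (hP : ∀ r ≤ R, P r = ∫ u, (k u : ℂ) * h (r - u)) {δ r : ℝ}
    (hδ : 0 < δ) (hr : r ≤ R - δ) :
    incr P δ r ≤ ∫⁻ u, ‖k u‖ₑ * incr h δ (r - u) := by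
  rw [incr, hP (r + δ) (by linarith), hP r (by linarith),
    ← integral_sub (integrable_kernel_mul hki hm hM _) (integrable_kernel_mul hki hm hM _)]
  refine (enorm_integral_le_lintegral_enorm _).trans (lintegral_mono fun u => ?_)
  rw [← mul_sub, enorm_mul, incr]
  refine mul_le_mul' (le_of_eq ?_) (le_of_eq ?_)
  · rw [← ofReal_norm, ← ofReal_norm, Complex.norm_real]
  · congr 3; ring

theorem incr_mul_le {A P : ℝ → ℂ} {M : NNReal} (hA : ∀ r, ‖A r‖ ≤ M) (hP : ∀ r, ‖P r‖ ≤ M)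
    (δ r : ℝ) : incr (fun r => A r * P r) δ r ≤ M * incr A δ r + M * incr P δ r := by
  have e : A (r + δ) * P (r + δ) - A r * P r
      = P (r + δ) * (A (r + δ) - A r) + A r * (P (r + δ) - P r) := by ring
  simp only [incr]
  rw [e]
  refine (enorm_add_le _ _).trans ?_
  rw [enorm_mul, enorm_mul]
  gcongr
  · exact enorm_le_coe (hP _)
  · exact enorm_le_coe (hA _)

theorem incr_add_le (f g : ℝ → ℂ) (δ r : ℝ) :
    incr (fun r => f r + g r) δ r ≤ incr f δ r + incr g δ r := by
  simp only [incr]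
  rw [add_sub_add_comm]
  exact enorm_add_le _ _

theorem incr_sum_le {ι : Type*} (s : Finset ι) (f : ι → ℝ → ℂ) (δ r : ℝ) :
    incr (fun r => ∑ i ∈ s, f i r) δ r ≤ ∑ i ∈ s, incr (f i) δ r := by
  simp only [incr]
  rw [← Finset.sum_sub_distrib]
  exact enorm_sum_le _ _

theorem norm_volterra_rhs_le {N : ℕ} {G P : Fin N → ℝ → ℂ} {A : Fin N → Fin N → ℝ → ℂ} {M : NNReal}
    (hGM : ∀ j r, ‖G j r‖ ≤ M) (hAM : ∀ j k r, ‖A j k r‖ ≤ M) (hPM : ∀ j r, ‖P j r‖ ≤ M)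
    (j : Fin N) (r : ℝ) :
    ‖G j r + ∑ l, A j l r * P l r‖ ≤ ((M + N * M ^ 2 : NNReal) : ℝ) := by
  refine (norm_add_le _ _).trans ?_
  push_cast
  refine add_le_add (hGM j r) ((norm_sum_le _ _).trans ?_)
  calc ∑ l, ‖A j l r * P l r‖ ≤ ∑ _l : Fin N, (M : ℝ) ^ 2 := by
        refine Finset.sum_le_sum fun l _ => ?_
        rw [norm_mul, sq]
        exact mul_le_mul (hAM j l r) (hPM l r) (norm_nonneg _) M.coe_nonneg
    _ = _ := by simp

/-- Solutions of a linear Volterra system with coefficients of order one half are of order one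
half. -/
theorem halfSq_of_volterra {N : ℕ} {R : ℝ} {k : ℝ → ℝ} (hk : Measurable k)
    (hki : Integrable k) (hk0 : ∀ u ≤ 0, k u = 0)
    {G P : Fin N → ℝ → ℂ} {A : Fin N → Fin N → ℝ → ℂ}
    (hGm : ∀ j, Measurable (G j)) (hAm : ∀ j l, Measurable (A j l)) (hPm : ∀ j, Measurable (P j))
    {M : NNReal} (hGM : ∀ j r, ‖G j r‖ ≤ M) (hAM : ∀ j l r, ‖A j l r‖ ≤ M)
    (hPM : ∀ j r, ‖P j r‖ ≤ M)
    (hG0 : ∀ j, ∀ r ≤ 0, G j r = 0) (hA0 : ∀ j l, ∀ r ≤ 0, A j l r = 0)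
    (hP0 : ∀ j, ∀ r ≤ 0, P j r = 0)
    (hP : ∀ j, ∀ r ≤ R, P j r = ∫ u, (k u : ℂ) * (G j (r - u) + ∑ l, A j l (r - u) * P l (r - u)))
    (hG : ∀ j, HalfSq R (incr (G j))) (hA : ∀ j l, HalfSq R (incr (A j l))) :
    ∀ j, HalfSq R (incr (fun r => G j r + ∑ l, A j l r * P l r)) := by
  have hhm : ∀ j, Measurable (fun r => G j r + ∑ l, A j l r * P l r) := by
    intro j
    exact (hGm j).add (Finset.measurable_fun_sum _ fun l _ => (hAm j l).mul (hPm l))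
  have hhM := norm_volterra_rhs_le hGM hAM hPM
  -- This collects the increments of the data. In the product rule the increment of `A` meets the
  -- bounded factor `P`, while the increment of `P` is left for the Gronwall inequality.
  let E0 : ℝ → ℝ → ℝ≥0∞ := fun δ r => ∑ j, (incr (G j) δ r + ∑ l, M * incr (A j l) δ r)
  have hmG := fun j δ => measurable_incr (hGm j) δ
  have hmA := fun j l δ => measurable_incr (hAm j l) δ
  have hmP := fun j δ => measurable_incr (hPm j) δ
  have hE0m : ∀ δ, Measurable (E0 δ) := fun δ => by
    refine Finset.measurable_fun_sum _ fun j _ => ?_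
    exact (hmG j δ).add (Finset.measurable_fun_sum _ fun l _ => (hmA j l δ).const_mul _)
  have hE0 : HalfSq R E0 := by
    refine HalfSq.sum _ (fun j _ => ?_) fun j _ δ => ?_
    · refine HalfSq.add (hG j) (HalfSq.sum _ (fun l _ => (hA j l).const_mul ENNReal.coe_ne_top)
        fun l _ δ => (hmA j l δ).const_mul _) (hmG j)
    · exact (hmG j δ).add (Finset.measurable_fun_sum _ fun l _ => (hmA j l δ).const_mul _)
  have hincr : ∀ j δ r, incr (fun r => G j r + ∑ l, A j l r * P l r) δ r
      ≤ (incr (G j) δ r + ∑ l, M * incr (A j l) δ r) + M * ∑ l, incr (P l) δ r := by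
    intro j δ r
    refine (incr_add_le _ _ δ r).trans ?_
    rw [add_assoc]
    gcongr
    refine (incr_sum_le _ _ δ r).trans ?_
    rw [Finset.mul_sum, ← Finset.sum_add_distrib]
    exact Finset.sum_le_sum fun l _ => incr_mul_le (hAM j l) (hPM l) δ r
  have hkm : Measurable fun u => ‖k u‖ₑ := hk.enorm
  -- Each of the `N` components contributes `M` times the sum of all increments of `P`, whence the
  -- factor `N * M`. The constant `K` is fixed before `δ`.
  obtain ⟨K, hK, hgron⟩ := exists_lintegral_sq_le_of_le_conv (k := fun u => ‖k u‖ₑ) hkm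
    (fun u hu => by simp [hk0 u hu]) hki.2.ne (N * M) R
  have hXhalf : HalfSq R (fun δ r => ∑ l, incr (P l) δ r) := by
    obtain ⟨D, hD, hE0⟩ := hE0
    refine ⟨K * D, by finiteness, fun δ hδ => ?_⟩
    have hX0 : ∀ f : ℝ → ℂ, (∀ r ≤ 0, f r = 0) → ∀ r, r < -δ → incr f δ r = 0 := by
      intro f hf r hr
      simp [incr, hf (r + δ) (by linarith), hf r (by linarith [hδ.1])]
    have hmX : Measurable fun r => ∑ l, incr (P l) δ r :=
      Finset.measurable_fun_sum _ fun l _ => hmP l δ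
    -- Truncation to `r ≤ R - δ` is compatible with the convolution: the kernel lives on `u > 0`, so
    -- `r - u` stays in the truncated range. On the left the increments vanish before `-δ`, which
    -- bounds the supports by `R`.
    have h := hgron ((Iic (R - δ)).indicator fun r => ∑ l, incr (P l) δ r)
      ((Iic (R - δ)).indicator (E0 δ)) (hmX.indicator measurableSet_Iic)
      ((hE0m δ).indicator measurableSet_Iic) ?_ ?_ ?_ ?_
    · have e : ∀ F : ℝ → ℝ≥0∞, ∫⁻ r, (Iic (R - δ)).indicator F r ^ 2
          = ∫⁻ r in Iic (R - δ), F r ^ 2 := by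
        intro F
        rw [← lintegral_indicator measurableSet_Iic]
        refine lintegral_congr fun r => ?_
        by_cases hr : r ∈ Iic (R - δ) <;> simp [hr]
      rw [e, e] at h
      refine h.trans ?_
      rw [mul_assoc]
      gcongr
      exact hE0 δ hδ
    · intro r hr
      have hr1 : r ≤ R - δ := by
        by_contra hc
        exact hr (indicator_of_notMem (by simpa using hc) _)
      rw [indicator_of_mem (show r ∈ Iic (R - δ) from hr1)] at hr
      have hr2 : -δ ≤ r := by
        by_contra hc
        exact hr (Finset.sum_eq_zero fun l _ => hX0 _ (hP0 l) r (not_le.1 hc))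
      rw [abs_le]; constructor <;> linarith [hδ.1, hδ.2]
    · intro r hr
      have hr1 : r ≤ R - δ := by
        by_contra hc
        exact hr (indicator_of_notMem (by simpa using hc) _)
      rw [indicator_of_mem (show r ∈ Iic (R - δ) from hr1)] at hr
      have hr2 : -δ ≤ r := by
        by_contra hc
        refine hr (Finset.sum_eq_zero fun j _ => ?_)
        rw [hX0 _ (hG0 j) r (not_le.1 hc), zero_add]
        exact Finset.sum_eq_zero fun l _ => by rw [hX0 _ (hA0 j l) r (not_le.1 hc), mul_zero]
      rw [abs_le]; constructor <;> linarith [hδ.1, hδ.2]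
    · refine ⟨N * (M + M), fun r => (indicator_le_self _ _ r).trans ?_⟩
      calc ∑ l, incr (P l) δ r ≤ ∑ _l : Fin N, ((M + M : NNReal) : ℝ≥0∞) := by
            refine Finset.sum_le_sum fun l _ => enorm_le_coe ((norm_sub_le _ _).trans ?_)
            push_cast
            exact add_le_add (hPM _ _) (hPM _ _)
        _ = _ := by simp [mul_add]
    · intro r
      by_cases hr : r ∈ Iic (R - δ)
      swap
      · rw [indicator_of_notMem hr]; exact zero_le
      rw [indicator_of_mem hr]
      calc ∑ j, incr (P j) δ r
          ≤ ∑ j, ∫⁻ u, ‖k u‖ₑ * incr (fun r => G j r + ∑ l, A j l r * P l r) δ (r - u) :=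
            Finset.sum_le_sum fun j _ => incr_conv_le hki (hhm j) (hhM j) (hP j) hδ.1 hr
        _ = ∫⁻ u, ∑ j, ‖k u‖ₑ * incr (fun r => G j r + ∑ l, A j l r * P l r) δ (r - u) := by
            rw [lintegral_finsetSum]
            intro j _
            exact hkm.mul ((measurable_incr (hhm j) δ).comp (measurable_const.sub measurable_id))
        _ ≤ _ := by
            refine lintegral_mono fun u => ?_
            rcases le_or_gt u 0 with hu | hu
            · simp [hk0 u hu]
            have hru : r - u ∈ Iic (R - δ) := by
              have := mem_Iic.1 hr
              exact mem_Iic.2 (by linarith)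
            rw [← Finset.mul_sum, indicator_of_mem hru, indicator_of_mem hru]
            gcongr
            refine (Finset.sum_le_sum fun j _ => hincr j δ (r - u)).trans ?_
            rw [Finset.sum_add_distrib]
            gcongr
            simp [mul_assoc]
  intro j
  refine HalfSq.mono (HalfSq.add (F := fun δ r => incr (G j) δ r + ∑ l, M * incr (A j l) δ r)
    (HalfSq.add (hG j) (HalfSq.sum _ (fun l _ => (hA j l).const_mul ENNReal.coe_ne_top)
        fun l _ δ => (hmA j l δ).const_mul _) (hmG j)) (hXhalf.const_mul (c := M)
          ENNReal.coe_ne_top) ?_) ?_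
  · intro δ
    exact (hmG j δ).add (Finset.measurable_fun_sum _ fun l _ => (hmA j l δ).const_mul _)
  · intro δ _ r _
    exact hincr j δ r

/-! ### The truncated Volterra kernel, near and far from zero -/

/-- `𝓘` cut off to `(0, R)`. -/
noncomputable def cutKernel (R : ℝ) : ℝ → ℝ := (Ioo 0 R).indicator volterraI

theorem measurable_cutKernel (R : ℝ) : Measurable (cutKernel R) := by
  unfold cutKernel
  have h : ContinuousOn volterraI (Ioo 0 R) := continuousOn_volterraI.mono fun u hu => hu.1
  have := h.measurable_piecewise (g := fun _ => (0 : ℝ)) continuousOn_const measurableSet_Ioo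
  rwa [show (fun _ => (0 : ℝ)) = (0 : ℝ → ℝ) from rfl, piecewise_eq_indicator] at this

theorem integrable_cutKernel {R : ℝ} (hR : 0 < R) : Integrable (cutKernel R) :=
  (integrable_indicator_iff measurableSet_Ioo).2 (integrableOn_volterraI hR)

theorem cutKernel_of_nonpos (R : ℝ) {u : ℝ} (hu : u ≤ 0) : cutKernel R u = 0 :=
  indicator_of_notMem (fun h => absurd h.1 (not_lt.2 hu)) _

/-- The part of `cutKernel` near `0`. -/
theorem lintegral_cutKernel_near_le {a R : ℝ} (ha : 0 < a) (ha1 : a < 1) :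
    ∫⁻ u, ‖(Iio a).indicator (cutKernel R) u‖ₑ ≤ ENNReal.ofReal (Real.exp 1 / -Real.log a) := by
  calc ∫⁻ u, ‖(Iio a).indicator (cutKernel R) u‖ₑ
      ≤ ∫⁻ u, (Ioo 0 a).indicator (fun u => ‖volterraI u‖ₑ) u := by
        refine lintegral_mono fun u => ?_
        by_cases hu : u ∈ Iio a
        swap
        · simp [indicator_of_notMem hu]
        rw [indicator_of_mem hu, cutKernel]
        by_cases hu0 : u ∈ Ioo 0 R
        swap
        · simp [indicator_of_notMem hu0]
        rw [indicator_of_mem hu0, indicator_of_mem (show u ∈ Ioo 0 a from ⟨hu0.1, hu⟩)]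
    _ = ENNReal.ofReal (∫ u in Ioo 0 a, volterraI u) := by
        rw [lintegral_indicator measurableSet_Ioo,
          ofReal_integral_eq_lintegral_ofReal (integrableOn_volterraI ha)]
        · refine setLIntegral_congr_fun measurableSet_Ioo fun u hu => ?_
          exact Real.enorm_of_nonneg (volterraI_nonneg hu.1)
        · filter_upwards [ae_restrict_mem measurableSet_Ioo] with u hu
          exact volterraI_nonneg hu.1
    _ ≤ _ := ENNReal.ofReal_le_ofReal (integral_volterraI_le ha ha1)

/-- The part of `cutKernel` away from `0` has increments of small mass. -/
theorem exists_lintegral_cutKernel_far_le {R : ℝ} (hR : 0 < R) : ∃ C : ℝ, 0 < C ∧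
    ∀ a δ, 0 < a → a ≤ 1 → a ≤ R / 2 → 0 < δ → δ ≤ a / 2 →
    ∫⁻ u, ‖(Ici a).indicator (cutKernel R) (u + δ) - (Ici a).indicator (cutKernel R) u‖ₑ
      ≤ ENNReal.ofReal (C * (δ / a ^ 2)) := by
  obtain ⟨A, hA, hA1, hA2⟩ := exists_volterraI_bounds R
  -- The increment lives on three windows. On `[a - δ, a)` and `[R - δ, R)` one of the two values
  -- vanishes and the other is at most `A/a ≤ A/a²`, as `a ≤ 1`; each contributes `Aδ/a²`. On `[a, R
  -- - δ)` the Lipschitz bound `Aδ/a²` acts on a length of at most `R`.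
  refine ⟨A * (R + 2), by positivity, fun a δ ha ha1 haR hδ hδa => ?_⟩
  set f := (Ici a).indicator (cutKernel R)
  have hf1 : ∀ u, a ≤ u → u < R → f u = volterraI u := by
    intro u h1 h2
    simp only [f]
    rw [indicator_of_mem (show u ∈ Ici a from h1), cutKernel,
      indicator_of_mem (show u ∈ Ioo 0 R from ⟨by linarith, h2⟩)]
  have hf2 : ∀ u, u < a → f u = 0 := fun u hu => indicator_of_notMem (by simpa using hu) _
  have hf3 : ∀ u, R ≤ u → f u = 0 := by
    intro u hu
    simp only [f, indicator_apply_eq_zero, cutKernel]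
    intro _ h
    exact absurd h.2 (not_lt.2 hu)
  have hfb : ∀ u, |f u| ≤ A / a ^ 2 := by
    intro u
    rcases lt_or_ge u a with h | h
    · rw [hf2 u h, abs_zero]; positivity
    rcases lt_or_ge u R with h' | h'
    swap
    · rw [hf3 u h', abs_zero]; positivity
    rw [hf1 u h h', abs_of_nonneg (volterraI_nonneg (by linarith))]
    refine (hA1 u (by linarith) h'.le).trans ?_
    gcongr
    nlinarith
  calc ∫⁻ u, ‖f (u + δ) - f u‖ₑ
      ≤ ∫⁻ u, ((Ico (a - δ) a).indicator (fun _ => ENNReal.ofReal (A / a ^ 2)) u +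
          ((Ico a (R - δ)).indicator (fun _ => ENNReal.ofReal (A * δ / a ^ 2)) u +
          (Ico (R - δ) R).indicator (fun _ => ENNReal.ofReal (A / a ^ 2)) u)) := by
        refine lintegral_mono fun u => ?_
        rw [← ofReal_norm, Real.norm_eq_abs]
        rcases lt_or_ge u (a - δ) with h1 | h1
        · rw [hf2 u (by linarith), hf2 (u + δ) (by linarith)]; simp
        rcases lt_or_ge u a with h2 | h2
        · rw [hf2 u h2, sub_zero, indicator_of_mem (show u ∈ Ico (a - δ) a from ⟨h1, h2⟩)]
          exact le_add_right (ENNReal.ofReal_le_ofReal (hfb _))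
        rcases lt_or_ge u (R - δ) with h3 | h3
        · rw [indicator_of_mem (show u ∈ Ico a (R - δ) from ⟨h2, h3⟩)]
          refine le_trans ?_ (le_add_left (le_add_right le_rfl))
          refine ENNReal.ofReal_le_ofReal ?_
          rw [hf1 u h2 (by linarith), hf1 (u + δ) (by linarith) (by linarith)]
          refine (hA2 u (u + δ) (by linarith) (by linarith) (by linarith)).trans ?_
          rw [add_sub_cancel_left]
          gcongr
        rcases lt_or_ge u R with h4 | h4
        · rw [hf3 (u + δ) (by linarith), zero_sub, abs_neg,
            indicator_of_mem (show u ∈ Ico (R - δ) R from ⟨h3, h4⟩)]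
          exact le_add_left (le_add_left (ENNReal.ofReal_le_ofReal (hfb _)))
        · rw [hf3 (u + δ) (by linarith), hf3 u h4]; simp
    _ = ENNReal.ofReal (A / a ^ 2 * δ + (A * δ / a ^ 2 * (R - δ - a) + A / a ^ 2 * δ)) := by
        rw [lintegral_add_left (by measurability), lintegral_add_left (by measurability),
          lintegral_indicator measurableSet_Ico, lintegral_indicator measurableSet_Ico,
          lintegral_indicator measurableSet_Ico, lintegral_const, lintegral_const, lintegral_const]
        simp only [Measure.restrict_apply_univ, Real.volume_Ico]
        have h5 : 0 ≤ R - δ - a := by linarith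
        rw [← ENNReal.ofReal_mul (by positivity), ← ENNReal.ofReal_mul (by positivity),
          ← ENNReal.ofReal_mul (by positivity), ← ENNReal.ofReal_add (by positivity) (by
            rw [show R - (R - δ) = δ by ring]; positivity), ← ENNReal.ofReal_add (by
            rw [show a - (a - δ) = δ by ring]; positivity) (by
            rw [show R - (R - δ) = δ by ring]; positivity)]
        congr 1; ring
    _ ≤ _ := by
        refine ENNReal.ofReal_le_ofReal ?_
        have h5 : A * δ / a ^ 2 * (R - δ - a) ≤ A * δ / a ^ 2 * R := by
          gcongr; linarith
        have : A * (R + 2) * (δ / a ^ 2) = A / a ^ 2 * δ + (A * δ / a ^ 2 * R + A / a ^ 2 * δ) := by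
          ring
        rw [this]
        gcongr

end PointInteraction

/-! ### The logarithmic gain of the Volterra kernel -/

namespace PointInteraction

theorem neg_log_le_inv {a : ℝ} (ha : 0 < a) : -Real.log a ≤ a⁻¹ := by
  rw [← Real.log_inv]
  linarith [Real.log_le_sub_one_of_pos (inv_pos.2 ha)]

/-- The kernel is split at `a`. For the near part the increment is taken of `h`; for the far part a
translation moves it onto the kernel, and `h` is estimated by its supremum. -/
theorem incr_conv_cutKernel_le {R : ℝ} (hR : 0 < R) {h P : ℝ → ℂ} (hm : Measurable h) {M : NNReal}
    (hM : ∀ r, ‖h r‖ ≤ M) (hP : ∀ r ≤ R, P r = ∫ u, (cutKernel R u : ℂ) * h (r - u))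
    {δ a r : ℝ} (hδ : 0 < δ) (hr : r ≤ R - δ) :
    incr P δ r ≤ (∫⁻ u, ‖(Iio a).indicator (cutKernel R) u‖ₑ * incr h δ (r - u)) +
      M * ∫⁻ u, ‖(Ici a).indicator (cutKernel R) (u + δ) - (Ici a).indicator (cutKernel R) u‖ₑ := by
  have hk := integrable_cutKernel hR
  set k1 := (Iio a).indicator (cutKernel R)
  set k2 := (Ici a).indicator (cutKernel R)
  have hk1 : Integrable k1 := hk.indicator measurableSet_Iio
  have hk2 : Integrable k2 := hk.indicator measurableSet_Ici
  have hk12 : ∀ u, cutKernel R u = k1 u + k2 u := by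
    intro u
    rcases lt_or_ge u a with hu | hu
    · simp [k1, k2, hu, not_le.2 hu]
    · simp [k1, k2, hu, not_lt.2 hu]
  have hsplit : ∀ r, ∫ u, (cutKernel R u : ℂ) * h (r - u)
      = (∫ u, (k1 u : ℂ) * h (r - u)) + ∫ u, (k2 u : ℂ) * h (r - u) := by
    intro r
    rw [← integral_add (integrable_kernel_mul hk1 hm hM r) (integrable_kernel_mul hk2 hm hM r)]
    refine integral_congr_ae (Eventually.of_forall fun u => ?_)
    simp only [hk12 u]; push_cast; ring
  have hshift : ∫ u, (k2 u : ℂ) * h (r + δ - u) = ∫ u, (k2 (u + δ) : ℂ) * h (r - u) := by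
    rw [← integral_add_right_eq_self _ δ]
    refine integral_congr_ae (Eventually.of_forall fun u => ?_)
    simp only
    congr 2; ring
  have hk2s : Integrable fun u => k2 (u + δ) := hk2.comp_add_right δ
  rw [incr, hP (r + δ) (by linarith), hP r (by linarith), hsplit, hsplit, hshift, add_sub_add_comm,
    ← integral_sub (integrable_kernel_mul hk1 hm hM _) (integrable_kernel_mul hk1 hm hM _),
    ← integral_sub (integrable_kernel_mul hk2s hm hM _) (integrable_kernel_mul hk2 hm hM _)]
  refine (enorm_add_le _ _).trans (add_le_add ?_ ?_)
  · refine (enorm_integral_le_lintegral_enorm _).trans (lintegral_mono fun u => ?_)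
    rw [← mul_sub, enorm_mul, incr]
    refine mul_le_mul' (le_of_eq ?_) (le_of_eq ?_)
    · rw [← ofReal_norm, ← ofReal_norm, Complex.norm_real]
    · congr 3; ring
  · refine (enorm_integral_le_lintegral_enorm _).trans ?_
    rw [← lintegral_const_mul' _ _ ENNReal.coe_ne_top]
    refine lintegral_mono fun u => ?_
    rw [← sub_mul, enorm_mul, mul_comm]
    refine mul_le_mul' (enorm_le_coe (hM _)) (le_of_eq ?_)
    rw [← ofReal_norm, ← ofReal_norm, ← Complex.ofReal_sub, Complex.norm_real]

/-- Convolution with `𝓘` gains a logarithm over order one half. -/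
theorem exists_incr_conv_le {R : ℝ} (hR : 0 < R) {h P : ℝ → ℂ} (hm : Measurable h) {M : NNReal}
    (hM : ∀ r, ‖h r‖ ≤ M) (hP0 : ∀ r ≤ 0, P r = 0)
    (hP : ∀ r ≤ R, P r = ∫ u, (cutKernel R u : ℂ) * h (r - u)) (hh : HalfSq R (incr h)) :
    ∃ C δ₀ : ℝ, 0 < C ∧ 0 < δ₀ ∧ δ₀ < 1 ∧ δ₀ ≤ R ∧ ∀ δ ∈ Ioo 0 δ₀,
      (∀ r ≤ R - δ, incr P δ r ≤ ENNReal.ofReal (C / -Real.log δ)) ∧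
      ∫⁻ r in Iic (R - δ), incr P δ r ^ 2 ≤ ENNReal.ofReal (C * (δ / Real.log δ ^ 2)) := by
  obtain ⟨D, hD, hh⟩ := hh
  obtain ⟨C, hC, hfar⟩ := exists_lintegral_cutKernel_far_le hR
  -- The threshold for the splitting point `a`; as `δ = a^8`, the threshold for `δ` is `a₀^8`.
  set a₀ := min (1 / 2) (R / 2)
  have ha₀ : 0 < a₀ := by positivity
  have ha₀1 : a₀ ≤ 1 / 2 := min_le_left _ _
  have ha₀R : a₀ ≤ R / 2 := min_le_right _ _
  have h8 : a₀ ^ 8 ≤ a₀ := pow_le_of_le_one ha₀.le (by linarith) (by norm_num)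
  refine ⟨2 * (8 * Real.exp 1) ^ 2 * D.toReal + 2 * (M * C * 8) ^ 2 * R + 16 * Real.exp 1 * M
    + M * C * 8 + 1, a₀ ^ 8, by positivity, by positivity, by linarith, by linarith,
    fun δ hδ => ?_⟩
  -- A small power of `δ` has a logarithm comparable to `log δ`, so the near mass is still `O(1/|log
  -- δ|)`. The far mass is `O(δ/a²) = O(a^6)`, and `a^6 ≤ 8 a^4/|log δ|`, whose square is `64
  -- δ/log²δ`.
  set a := δ ^ (1 / 8 : ℝ) with hadef
  have ha : 0 < a := Real.rpow_pos_of_pos hδ.1 _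
  have haδ : a ^ 8 = δ := by
    rw [hadef, ← Real.rpow_natCast, ← Real.rpow_mul hδ.1.le]; norm_num
  have haa₀ : a < a₀ := by
    refine lt_of_pow_lt_pow_left₀ 8 ha₀.le ?_
    rw [haδ]; exact hδ.2
  have ha1 : a < 1 := by linarith
  have hlogδ : Real.log δ = 8 * Real.log a := by
    rw [← haδ, Real.log_pow]; norm_num
  have hloga : 0 < -Real.log a := by linarith [Real.log_neg ha ha1]
  have hdiv : δ / a ^ 2 = a ^ 6 := by rw [← haδ]; field_simp
  have ha6 : a ^ 6 ≤ 8 * a ^ 4 / -Real.log δ := by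
    rw [hlogδ, le_div_iff₀ (by linarith)]
    have h1 := neg_log_le_inv ha
    calc a ^ 6 * -(8 * Real.log a) = 8 * a ^ 6 * -Real.log a := by ring
      _ ≤ 8 * a ^ 6 * a⁻¹ := by gcongr
      _ = 8 * a ^ 4 * a := by field_simp
      _ ≤ 8 * a ^ 4 * 1 := by gcongr
      _ = _ := by ring
  have hδa : δ ≤ a / 2 := by
    have h7 : a ^ 7 ≤ a := pow_le_of_le_one ha.le ha1.le (by norm_num)
    rw [← haδ]
    calc a ^ 8 = a ^ 7 * a := by ring
      _ ≤ 1 / 2 * a := by gcongr; linarith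
      _ = a / 2 := by ring
  have hL : 0 < -Real.log δ := by linarith
  have hfar' := hfar a δ ha ha1.le (by linarith) hδ.1 hδa
  rw [hdiv] at hfar'
  have hnear := lintegral_cutKernel_near_le (R := R) ha ha1
  have hnear_eq : Real.exp 1 / -Real.log a = 8 * Real.exp 1 / -Real.log δ := by
    rw [hlogδ]; field_simp
  rw [hnear_eq] at hnear
  -- The indicator may be inserted since the near kernel vanishes for `u ≤ 0`; it makes the
  -- hypothesis on the increments of `h` applicable after Young's inequality.
  have hpt : ∀ r ≤ R - δ, incr P δ r ≤
      (∫⁻ u, ‖(Iio a).indicator (cutKernel R) u‖ₑ * (Iic (R - δ)).indicator (incr h δ) (r - u)) +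
      ENNReal.ofReal (M * C * 8 * a ^ 4 / -Real.log δ) := by
    intro r hr
    refine (incr_conv_cutKernel_le (a := a) hR hm hM hP hδ.1 hr).trans (add_le_add ?_ ?_)
    · refine lintegral_mono fun u => ?_
      rcases le_or_gt u 0 with hu | hu
      · have : (Iio a).indicator (cutKernel R) u = 0 := by
          rw [indicator_apply_eq_zero]
          intro _
          exact cutKernel_of_nonpos R hu
        simp [this]
      · rw [indicator_of_mem (show r - u ∈ Iic (R - δ) from mem_Iic.2 (by linarith))]
    · calc (M : ℝ≥0∞) * _ ≤ M * ENNReal.ofReal (C * a ^ 6) := by gcongr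
        _ = ENNReal.ofReal (M * (C * a ^ 6)) := by
            rw [ENNReal.ofReal_mul M.coe_nonneg, ENNReal.ofReal_coe_nnreal]
        _ ≤ _ := by
            refine ENNReal.ofReal_le_ofReal ?_
            calc (M : ℝ) * (C * a ^ 6) ≤ M * (C * (8 * a ^ 4 / -Real.log δ)) := by gcongr
              _ = _ := by ring
  constructor
  · intro r hr
    refine (hpt r hr).trans ?_
    calc _ ≤ (∫⁻ u, ‖(Iio a).indicator (cutKernel R) u‖ₑ * ((2 * M : NNReal) : ℝ≥0∞)) +
          ENNReal.ofReal (M * C * 8 * a ^ 4 / -Real.log δ) := by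
          gcongr with u
          refine (indicator_le_self _ _ _).trans (enorm_le_coe ((norm_sub_le _ _).trans ?_))
          push_cast
          linarith [hM (r - u + δ), hM (r - u)]
      _ ≤ ENNReal.ofReal (8 * Real.exp 1 / -Real.log δ) * ((2 * M : NNReal) : ℝ≥0∞) +
          ENNReal.ofReal (M * C * 8 * a ^ 4 / -Real.log δ) := by
          rw [lintegral_mul_const' _ _ ENNReal.coe_ne_top]
          gcongr
      _ = ENNReal.ofReal (8 * Real.exp 1 / -Real.log δ * (2 * M) +
            M * C * 8 * a ^ 4 / -Real.log δ) := by
          rw [ENNReal.ofReal_add (by positivity) (by positivity),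
            ENNReal.ofReal_mul (by positivity)]
          congr 2
          rw [← ENNReal.ofReal_coe_nnreal]; push_cast; rfl
      _ ≤ _ := by
          refine ENNReal.ofReal_le_ofReal ?_
          rw [div_mul_eq_mul_div, ← add_div]
          refine div_le_div_of_nonneg_right ?_ hL.le
          have h4 : a ^ 4 ≤ 1 := pow_le_one₀ ha.le ha1.le
          have : (M : ℝ) * C * 8 * a ^ 4 ≤ M * C * 8 * 1 := by gcongr
          have h9 : 0 ≤ 2 * (8 * Real.exp 1) ^ 2 * D.toReal + 2 * (M * C * 8) ^ 2 * R := by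
            positivity
          linarith
  · set F := (Iic (R - δ)).indicator (incr h δ)
    have hFm : Measurable F := (measurable_incr hm δ).indicator measurableSet_Iic
    have hk1m : Measurable fun u => ‖(Iio a).indicator (cutKernel R) u‖ₑ :=
      ((measurable_cutKernel R).indicator measurableSet_Iio).enorm
    set c₁ := M * C * 8 * a ^ 4 / -Real.log δ
    have hc₁ : 0 ≤ c₁ := by positivity
    have hF2 : ∫⁻ r, F r ^ 2 ≤ D * ENNReal.ofReal δ := by
      have e : ∫⁻ r, F r ^ 2 = ∫⁻ r in Iic (R - δ), incr h δ r ^ 2 := by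
        rw [← lintegral_indicator measurableSet_Iic]
        refine lintegral_congr fun r => ?_
        by_cases hr : r ∈ Iic (R - δ) <;> simp [F, hr]
      rw [e]
      refine hh δ ⟨hδ.1, ?_⟩
      linarith [hδ.2]
    calc ∫⁻ r in Iic (R - δ), incr P δ r ^ 2
        ≤ ∫⁻ r, (2 * (∫⁻ u, ‖(Iio a).indicator (cutKernel R) u‖ₑ * F (r - u)) ^ 2 +
            (Icc (-δ) (R - δ)).indicator (fun _ => 2 * ENNReal.ofReal c₁ ^ 2) r) := by
          rw [← lintegral_indicator measurableSet_Iic]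
          refine lintegral_mono fun r => ?_
          by_cases hr : r ∈ Iic (R - δ)
          swap
          · simp only [indicator_of_notMem hr]; exact zero_le
          rw [indicator_of_mem hr]
          rcases lt_or_ge r (-δ) with hr2 | hr2
          · have : incr P δ r = 0 := by
              simp [incr, hP0 (r + δ) (by linarith), hP0 r (by linarith [hδ.1])]
            simp [this]
          · rw [indicator_of_mem (show r ∈ Icc (-δ) (R - δ) from ⟨hr2, hr⟩)]
            refine le_trans ?_ (ennreal_add_sq_le _ _)
            gcongr
            exact hpt r hr
      _ ≤ 2 * ((ENNReal.ofReal (8 * Real.exp 1 / -Real.log δ)) ^ 2 * (D * ENNReal.ofReal δ)) +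
          2 * ENNReal.ofReal c₁ ^ 2 * ENNReal.ofReal R := by
          rw [lintegral_add_right _ (by measurability), lintegral_const_mul' _ _ (by norm_num),
            lintegral_indicator measurableSet_Icc, lintegral_const, Measure.restrict_apply_univ,
            Real.volume_Icc, sub_neg_eq_add, sub_add_cancel]
          gcongr
          refine (lintegral_conv_sq_le hk1m hFm).trans ?_
          gcongr
      _ = ENNReal.ofReal (2 * ((8 * Real.exp 1 / -Real.log δ) ^ 2 * (D.toReal * δ)) +
          2 * c₁ ^ 2 * R) := by
          have hDr : D = ENNReal.ofReal D.toReal := (ENNReal.ofReal_toReal hD).symm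
          have hδ0 := hδ.1.le
          rw [ENNReal.ofReal_add (by positivity) (by positivity),
            ENNReal.ofReal_mul (by positivity), ENNReal.ofReal_mul (by positivity),
            ENNReal.ofReal_mul (by positivity), ENNReal.ofReal_mul (by positivity),
            ENNReal.ofReal_mul (by positivity), ENNReal.ofReal_pow (by positivity),
            ENNReal.ofReal_pow (by positivity), ← hDr]
          norm_num
      _ ≤ _ := by
          refine ENNReal.ofReal_le_ofReal ?_
          have hsq : c₁ ^ 2 = (M * C * 8) ^ 2 * (δ / Real.log δ ^ 2) := by
            simp only [c₁]
            rw [div_pow, neg_sq, mul_pow _ (a ^ 4), ← pow_mul, haδ]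
            ring
          have e1 : (8 * Real.exp 1 / -Real.log δ) ^ 2 * (D.toReal * δ)
              = (8 * Real.exp 1) ^ 2 * D.toReal * (δ / Real.log δ ^ 2) := by
            rw [div_pow, neg_sq]; ring
          rw [hsq, e1]
          have hX : 0 ≤ δ / Real.log δ ^ 2 := by have := hδ.1; positivity
          have hY : 0 ≤ (16 * Real.exp 1 * M + M * C * 8 + 1) * (δ / Real.log δ ^ 2) := by positivity
          linarith

/-- A function of the class obtained in `exists_incr_conv_le`, corrected at both ends of `[0, R]` by
a Lipschitz function and extended by zero. -/
theorem exists_lintegral_incr_cut_le {R : ℝ} (hR : 0 < R) {P : ℝ → ℂ} (hPm : Measurable P)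
    (hP0 : ∀ r ≤ 0, P r = 0)
    (hP : ∃ C δ₀ : ℝ, 0 < C ∧ 0 < δ₀ ∧ δ₀ < 1 ∧ δ₀ ≤ R ∧ ∀ δ ∈ Ioo 0 δ₀,
      (∀ r ≤ R - δ, incr P δ r ≤ ENNReal.ofReal (C / -Real.log δ)) ∧
      ∫⁻ r in Iic (R - δ), incr P δ r ^ 2 ≤ ENNReal.ofReal (C * (δ / Real.log δ ^ 2)))
    {ℓ : ℝ → ℂ} {L : ℝ} (hL : 0 ≤ L)
    (hℓ : ∀ r ∈ Icc 0 R, ∀ r' ∈ Icc 0 R, ‖ℓ r' - ℓ r‖ ≤ L * |r' - r|)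
    (hℓR : ℓ R = ℓ 0 + P R) :
    ∃ C δ₀ : ℝ, 0 < C ∧ 0 < δ₀ ∧ δ₀ < 1 ∧ ∀ δ ∈ Ioo 0 δ₀,
      ∫⁻ r, incr ((Ioc 0 R).indicator fun r => ℓ 0 + P r - ℓ r) δ r ^ 2
        ≤ ENNReal.ofReal (C * (δ / Real.log δ ^ 2)) := by
  obtain ⟨C, δ₀, hC, hδ₀, hδ₀1, hδ₀R, hP⟩ := hP
  refine ⟨2 * C + 2 * C ^ 2 * 2 + 4 * L ^ 2 * (2 * R) * 4, δ₀, by positivity, hδ₀, hδ₀1,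
    fun δ hδ => ?_⟩
  set Z := (Ioc 0 R).indicator fun r => ℓ 0 + P r - ℓ r
  have hZ : ∀ r, 0 ≤ r → r ≤ R → Z r = ℓ 0 + P r - ℓ r := by
    intro r h1 h2
    rcases h1.eq_or_lt with h | h
    · subst h
      simp [Z, hP0 0 le_rfl]
    · exact indicator_of_mem (show r ∈ Ioc 0 R from ⟨h, h2⟩) _
  have hZ0 : ∀ r ≤ 0, Z r = 0 := fun r hr =>
    indicator_of_notMem (fun h => absurd h.1 (not_lt.2 hr)) _
  have hZR : ∀ r, R ≤ r → Z r = 0 := by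
    intro r hr
    rcases hr.eq_or_lt with h | h
    · subst h
      rw [hZ _ hR.le le_rfl, hℓR]; ring
    · exact indicator_of_notMem (fun h' => absurd h'.2 (not_le.2 h)) _
  have hδ1 : δ < 1 := hδ.2.trans hδ₀1
  have hlog : 0 < -Real.log δ := by linarith [Real.log_neg hδ.1 hδ1]
  set b := ENNReal.ofReal (C / -Real.log δ)
  set e := ENNReal.ofReal (L * δ)
  obtain ⟨hsup, hint⟩ := hP δ hδ
  have hpt : ∀ r, incr Z δ r ^ 2 ≤ (Iic (R - δ)).indicator (fun r => 2 * incr P δ r ^ 2) r +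
      ((Icc (-δ) R).indicator (fun _ => 2 * e ^ 2) r +
        (Icc (R - δ) R).indicator (fun _ => 2 * b ^ 2) r) := by
    intro r
    rcases lt_or_ge r (-δ) with h1 | h1
    · simp [incr, hZ0 (r + δ) (by linarith), hZ0 r (by linarith [hδ.1])]
    rcases lt_or_ge R r with h2 | h2
    · simp [incr, hZR (r + δ) (by linarith [hδ.1]), hZR r h2.le]
    rw [indicator_of_mem (show r ∈ Icc (-δ) R from ⟨h1, h2⟩)]
    rcases le_or_gt r (R - δ) with h3 | h3
    · rw [indicator_of_mem (show r ∈ Iic (R - δ) from h3)]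
      have hle : incr Z δ r ≤ incr P δ r + e := by
        simp only [incr]
        rcases lt_or_ge r 0 with h4 | h4
        · rw [hZ (r + δ) (by linarith) (by linarith), hZ0 r h4.le, hP0 r h4.le, sub_zero, sub_zero]
          have : ℓ 0 + P (r + δ) - ℓ (r + δ) = P (r + δ) + -(ℓ (r + δ) - ℓ 0) := by ring
          rw [this]
          refine (enorm_add_le _ _).trans (add_le_add le_rfl ?_)
          rw [enorm_neg, ← ofReal_norm]
          refine ENNReal.ofReal_le_ofReal ((hℓ 0 ⟨le_rfl, hR.le⟩ (r + δ)
            ⟨by linarith, by linarith⟩).trans ?_)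
          gcongr
          rw [abs_of_nonneg (by linarith)]; linarith
        · rw [hZ (r + δ) (by linarith [hδ.1]) (by linarith), hZ r h4 h2]
          have : ℓ 0 + P (r + δ) - ℓ (r + δ) - (ℓ 0 + P r - ℓ r)
              = (P (r + δ) - P r) + -(ℓ (r + δ) - ℓ r) := by ring
          rw [this]
          refine (enorm_add_le _ _).trans (add_le_add le_rfl ?_)
          rw [enorm_neg, ← ofReal_norm]
          refine ENNReal.ofReal_le_ofReal ((hℓ r ⟨h4, h2⟩ (r + δ)
            ⟨by linarith [hδ.1], by linarith⟩).trans ?_)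
          gcongr
          rw [abs_of_nonneg (by linarith [hδ.1])]; linarith
      calc incr Z δ r ^ 2 ≤ (incr P δ r + e) ^ 2 := by gcongr
        _ ≤ 2 * incr P δ r ^ 2 + 2 * e ^ 2 := ennreal_add_sq_le _ _
        _ ≤ _ := by
            gcongr
            exact le_self_add
    · rw [indicator_of_notMem (show r ∉ Iic (R - δ) from not_le.2 h3),
        indicator_of_mem (show r ∈ Icc (R - δ) R from ⟨h3.le, h2⟩), zero_add]
      have hle : incr Z δ r ≤ e + b := by
        simp only [incr]
        rcases h2.eq_or_lt with h5 | h5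
        · rw [hZR r h5.ge, hZR (r + δ) (by linarith [hδ.1])]; simp
        have hr0 : 0 ≤ r := by linarith [hδ.2]
        rw [hZR (r + δ) (by linarith), hZ r hr0 h2, zero_sub, enorm_neg]
        have : ℓ 0 + P r - ℓ r = (ℓ R - ℓ r) + -(P R - P r) := by rw [hℓR]; ring
        rw [this]
        refine (enorm_add_le _ _).trans (add_le_add ?_ ?_)
        · rw [← ofReal_norm]
          refine ENNReal.ofReal_le_ofReal ((hℓ r ⟨hr0, h2⟩ R ⟨hR.le, le_rfl⟩).trans ?_)
          gcongr
          rw [abs_of_nonneg (by linarith)]; linarith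
        · rw [enorm_neg]
          -- Just left of `R` the shifted value has left the interval and vanishes, so `Z r` itself
          -- must be small. It equals an increment over the shorter step `R - r`, for which only the
          -- uniform logarithmic bound serves; the window has length `δ`, so the square integral is
          -- again `O(δ/log²δ)`.
          have hd : R - r ∈ Ioo 0 δ₀ := ⟨by linarith, by linarith [hδ.2]⟩
          have h6 := (hP (R - r) hd).1 r (by linarith)
          simp only [incr, add_sub_cancel] at h6
          refine h6.trans (ENNReal.ofReal_le_ofReal ?_)
          have h7 : Real.log (R - r) ≤ Real.log δ := Real.log_le_log hd.1 (by linarith)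
          gcongr
      calc incr Z δ r ^ 2 ≤ (e + b) ^ 2 := by gcongr
        _ ≤ _ := ennreal_add_sq_le _ _
  have hmP := measurable_incr hPm δ
  calc ∫⁻ r, incr Z δ r ^ 2
      ≤ ∫⁻ r, ((Iic (R - δ)).indicator (fun r => 2 * incr P δ r ^ 2) r +
        ((Icc (-δ) R).indicator (fun _ => 2 * e ^ 2) r +
        (Icc (R - δ) R).indicator (fun _ => 2 * b ^ 2) r)) := lintegral_mono hpt
    _ = 2 * (∫⁻ r in Iic (R - δ), incr P δ r ^ 2) + (2 * e ^ 2 * ENNReal.ofReal (R + δ) +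
        2 * b ^ 2 * ENNReal.ofReal δ) := by
        rw [lintegral_add_right _ (by measurability), lintegral_add_left (by measurability),
          lintegral_indicator measurableSet_Icc, lintegral_indicator measurableSet_Icc,
          lintegral_const, lintegral_const, lintegral_indicator measurableSet_Iic,
          lintegral_const_mul' _ _ (by norm_num)]
        simp
    _ ≤ 2 * ENNReal.ofReal (C * (δ / Real.log δ ^ 2)) + (2 * e ^ 2 * ENNReal.ofReal (R + δ) +
        2 * b ^ 2 * ENNReal.ofReal δ) := by gcongr
    _ = ENNReal.ofReal (2 * (C * (δ / Real.log δ ^ 2)) + (2 * (L * δ) ^ 2 * (R + δ) +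
        2 * (C / -Real.log δ) ^ 2 * δ)) := by
        have hδ0 := hδ.1.le
        have hS : 0 ≤ R + δ := by positivity
        generalize R + δ = S at hS
        rw [ENNReal.ofReal_add (by positivity) (by positivity),
          ENNReal.ofReal_add (by positivity) (by positivity),
          ENNReal.ofReal_mul (p := 2) (by positivity), ENNReal.ofReal_mul (q := S) (by positivity),
          ENNReal.ofReal_mul (q := δ) (by positivity),
          ENNReal.ofReal_mul (q := (L * δ) ^ 2) (by positivity),
          ENNReal.ofReal_mul (q := (C / -Real.log δ) ^ 2) (by positivity),
          ENNReal.ofReal_pow (by positivity), ENNReal.ofReal_pow (by positivity)]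
        norm_num [e, b]
    _ ≤ _ := by
        refine ENNReal.ofReal_le_ofReal ?_
        have hδ0 := hδ.1
        have e1 : 2 * (C / -Real.log δ) ^ 2 * δ = 2 * C ^ 2 * (δ / Real.log δ ^ 2) := by
          rw [div_pow, neg_sq]; ring
        -- The Lipschitz correction contributes `O(δ²)`, far below `δ/log²δ`; the comparison is
        -- `-log √δ ≤ 1/√δ`.
        have e2 : δ ^ 2 ≤ 4 * (δ / Real.log δ ^ 2) := by
          have hs : 0 < Real.sqrt δ := Real.sqrt_pos.2 hδ0
          have h1 := neg_log_le_inv hs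
          rw [Real.log_sqrt hδ0.le] at h1
          have h2 : -Real.log δ ≤ 2 * (Real.sqrt δ)⁻¹ := by linarith
          have h3 : (-Real.log δ) ^ 2 ≤ (2 * (Real.sqrt δ)⁻¹) ^ 2 := by gcongr
          rw [neg_sq, mul_pow, inv_pow, Real.sq_sqrt hδ0.le] at h3
          have hl2 : 0 < Real.log δ ^ 2 := by rw [← neg_sq]; positivity
          rw [mul_div_assoc', le_div_iff₀ hl2]
          calc δ ^ 2 * Real.log δ ^ 2 ≤ δ ^ 2 * (2 ^ 2 * δ⁻¹) := by gcongr
            _ = _ := by field_simp; norm_num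
        have e3 : 2 * (L * δ) ^ 2 * (R + δ) ≤ 4 * L ^ 2 * (2 * R) * 4 * (δ / Real.log δ ^ 2) := by
          calc 2 * (L * δ) ^ 2 * (R + δ) ≤ 2 * (L * δ) ^ 2 * (2 * R) := by
                gcongr; linarith [hδ.2]
            _ = 2 * L ^ 2 * (2 * R) * δ ^ 2 := by ring
            _ ≤ 2 * L ^ 2 * (2 * R) * (4 * (δ / Real.log δ ^ 2)) := by gcongr
            _ ≤ _ := by
                have : 0 ≤ L ^ 2 * R * (δ / Real.log δ ^ 2) := by positivity
                linarith
        rw [e1]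
        have hX : 0 ≤ C ^ 2 * (δ / Real.log δ ^ 2) := by positivity
        linarith

end PointInteraction

/-! ### From `L²` moduli of continuity to half a derivative -/

namespace PointInteraction

theorem fourier_comp_add_right_sub {Z : ℝ → ℂ} (hZ : Integrable Z) (δ ν : ℝ) :
    𝓕 (fun r => Z (r + δ) - Z r) ν
      = (Complex.exp ((2 * Real.pi * (ν * δ) : ℝ) * Complex.I) - 1) * 𝓕 Z ν := by
  have h1 : 𝓕 (fun r => Z (r + δ)) ν
      = Complex.exp ((2 * Real.pi * (ν * δ) : ℝ) * Complex.I) * 𝓕 Z ν := by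
    rw [Real.fourier_real_eq_integral_exp_smul, Real.fourier_real_eq_integral_exp_smul,
      ← integral_const_mul]
    rw [← integral_sub_right_eq_self _ δ]
    refine integral_congr_ae (Eventually.of_forall fun r => ?_)
    simp only [sub_add_cancel, smul_eq_mul]
    rw [← mul_assoc, ← Complex.exp_add]
    congr 2
    push_cast; ring
  have hi := hZ.comp_add_right δ
  rw [sub_mul, one_mul, ← h1]
  rw [Real.fourier_real_eq, Real.fourier_real_eq, Real.fourier_real_eq, ← integral_sub]
  · refine integral_congr_ae (Eventually.of_forall fun r => ?_)
    simp only [smul_sub]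
  · exact (Real.fourierIntegral_convergent_iff ν).2 hi |>.congr
      (Eventually.of_forall fun r => by simp [mul_comm])
  · exact (Real.fourierIntegral_convergent_iff ν).2 hZ |>.congr
      (Eventually.of_forall fun r => by simp [mul_comm])

theorem lower_bound_exp_sub_one {x : ℝ} (hx : |x| ≤ Real.pi) :
    2 / Real.pi * |x| ≤ ‖Complex.exp (x * Complex.I) - 1‖ := by
  have h := Complex.norm_exp_I_mul_ofReal_sub_one (x := x)
  rw [mul_comm] at h
  rw [h, norm_mul, Real.norm_of_nonneg (by norm_num : (0 : ℝ) ≤ 2), Real.norm_eq_abs]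
  have h2 : |x / 2| ≤ Real.pi / 2 := by rw [abs_div, abs_two]; linarith
  have h3 : 2 / Real.pi * |x / 2| ≤ |Real.sin (x / 2)| := Real.mul_abs_le_abs_sin h2
  rw [abs_div, abs_two] at h3
  calc 2 / Real.pi * |x| = 2 * (2 / Real.pi * (|x| / 2)) := by ring
    _ ≤ _ := by gcongr

/-- The antiderivative `-1/log δ` tends to `0` at `0`, which is also its value there under the
conventions for `log 0` and `0⁻¹`; so it is continuous up to the left end. This is where the full
power of the logarithmic gain is spent: `1/δ` alone is not integrable. -/
theorem lintegral_inv_mul_log_sq_lt_top {δ₀ : ℝ} (h1 : δ₀ < 1) :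
    ∫⁻ δ in Ioc 0 δ₀, ENNReal.ofReal (1 / (δ * Real.log δ ^ 2)) < ∞ := by
  have hc : ContinuousOn (fun δ => -(Real.log δ)⁻¹) (Icc 0 δ₀) := by
    intro δ hδ
    rcases hδ.1.eq_or_lt with h | h
    · subst h
      have h2 : Tendsto (fun δ => -(Real.log δ)⁻¹) (𝓝[≠] 0) (𝓝 0) := by
        have := (Real.tendsto_log_nhdsNE_zero).inv_tendsto_atBot
        simpa using this.neg
      have h3 : ContinuousAt (fun δ => -(Real.log δ)⁻¹) 0 := by
        rw [← continuousWithinAt_compl_self]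
        simpa [ContinuousWithinAt] using h2
      exact h3.continuousWithinAt
    · have : Real.log δ < 0 := Real.log_neg h (by linarith [hδ.2])
      exact (((Real.continuousAt_log h.ne').inv₀ this.ne).neg).continuousWithinAt
  have hint : IntegrableOn (fun δ => 1 / (δ * Real.log δ ^ 2)) (Ioc 0 δ₀) := by
    refine intervalIntegral.integrableOn_deriv_of_nonneg hc (fun δ hδ => ?_) (fun δ hδ => ?_)
    · have : Real.log δ < 0 := Real.log_neg hδ.1 (by linarith [hδ.2])
      have hd := ((Real.hasDerivAt_log hδ.1.ne').inv this.ne).neg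
      refine hd.congr_deriv ?_
      have := hδ.1.ne'
      field_simp
    · have := hδ.1
      positivity
  exact hint.lintegral_lt_top

/-- The modulus of the symbol of an increment. -/
noncomputable def phaseIncr (δ ν : ℝ) : ℝ≥0∞ :=
  ‖Complex.exp ((2 * Real.pi * (ν * δ) : ℝ) * Complex.I) - 1‖ₑ

theorem measurable_phaseIncr (ν : ℝ) : Measurable fun δ => phaseIncr δ ν := by
  unfold phaseIncr; fun_prop

theorem measurable_uncurry_phaseIncr : Measurable fun x : ℝ × ℝ => phaseIncr x.2 x.1 := by
  unfold phaseIncr; fun_prop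

/-- Keep only the steps `δ < 1/(2|ν|)`. There Jordan's inequality gives `|e^{2πiνδ} - 1| ≥ 4|ν|δ`,
so the integrand is at least `16ν²` on an interval of length `1/(2|ν|)`. The restriction on `ν`
makes this interval fit into `(0, δ₀)`. -/
theorem le_lintegral_phaseIncr {δ₀ ν : ℝ} (hδ₀ : 0 < δ₀) (hν : 1 / (2 * δ₀) ≤ |ν|) :
    ENNReal.ofReal (8 * |ν|)
      ≤ ∫⁻ δ in Ioo 0 δ₀, phaseIncr δ ν ^ 2 * ENNReal.ofReal (1 / δ ^ 2) := by
  have hν0 : 0 < |ν| := lt_of_lt_of_le (by positivity) hν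
  have hle : 1 / (2 * |ν|) ≤ δ₀ := by
    rw [div_le_iff₀ (by positivity)] at hν ⊢
    linarith
  calc ENNReal.ofReal (8 * |ν|)
      = ∫⁻ _δ in Ioo 0 (1 / (2 * |ν|)), ENNReal.ofReal (16 * ν ^ 2) := by
        rw [lintegral_const, Measure.restrict_apply_univ, Real.volume_Ioo, sub_zero,
          ← ENNReal.ofReal_mul (by positivity)]
        congr 1
        rw [← sq_abs ν]; field_simp; norm_num
    _ ≤ ∫⁻ δ in Ioo 0 (1 / (2 * |ν|)), phaseIncr δ ν ^ 2 * ENNReal.ofReal (1 / δ ^ 2) := by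
        refine setLIntegral_mono' measurableSet_Ioo fun δ hδ => ?_
        have hδ0 := hδ.1
        have hπ := Real.pi_pos
        have hνδ : |ν| * δ ≤ 1 / 2 := by
          have := hδ.2.le
          rw [le_div_iff₀ (by positivity)] at this
          linarith
        have hx : |2 * Real.pi * (ν * δ)| = 2 * Real.pi * (|ν| * δ) := by
          rw [abs_mul, abs_mul ν, abs_of_pos hδ0, abs_of_pos (by positivity)]
        have h1 := lower_bound_exp_sub_one (x := 2 * Real.pi * (ν * δ)) (by
          rw [hx]; nlinarith)
        rw [hx] at h1
        have h2 : 4 * |ν| * δ ≤ ‖Complex.exp ((2 * Real.pi * (ν * δ) : ℝ) * Complex.I) - 1‖ := by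
          refine le_trans (le_of_eq ?_) h1
          field_simp; ring
        have h3 : ENNReal.ofReal (4 * |ν| * δ) ≤ phaseIncr δ ν := by
          rw [phaseIncr]
          rw [← ofReal_norm]
          exact ENNReal.ofReal_le_ofReal h2
        calc ENNReal.ofReal (16 * ν ^ 2)
            = ENNReal.ofReal (4 * |ν| * δ) ^ 2 * ENNReal.ofReal (1 / δ ^ 2) := by
              rw [← ENNReal.ofReal_pow (by positivity), ← ENNReal.ofReal_mul (by positivity)]
              congr 1
              rw [← sq_abs ν]; field_simp; norm_num
          _ ≤ _ := by gcongr
    _ ≤ _ := by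
        refine lintegral_mono_set ?_
        exact Ioo_subset_Ioo_right hle
theorem lintegral_phaseIncr_mul_fourier {Z : ℝ → ℂ} (hZ1 : Integrable Z) (hZ2 : MemLp Z 2) (δ : ℝ) :
    ∫⁻ ν, phaseIncr δ ν ^ 2 * ‖𝓕 Z ν‖ₑ ^ 2 = ∫⁻ r, incr Z δ r ^ 2 := by
  have h1 : Integrable (fun r => Z (r + δ) - Z r) := (hZ1.comp_add_right δ).sub hZ1
  have h2 : MemLp (fun r => Z (r + δ) - Z r) 2 :=
    (hZ2.comp_measurePreserving (measurePreserving_add_right volume δ)).sub hZ2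
  have h := eLpNorm_fourier_eq h2 h1
  rw [eLpNorm_eq_lintegral_rpow_enorm_toReal (by norm_num) (by norm_num),
    eLpNorm_eq_lintegral_rpow_enorm_toReal (by norm_num) (by norm_num)] at h
  have h' := ENNReal.rpow_left_injective (by norm_num) h
  simp only [ENNReal.toReal_ofNat, ENNReal.rpow_two] at h'
  refine Eq.trans ?_ h'
  refine lintegral_congr fun ν => ?_
  rw [fourier_comp_add_right_sub hZ1, enorm_mul, mul_pow, phaseIncr]

attribute [irreducible] phaseIncr

/-- Tonelli: the weight `1/δ²` against the assumed `δ/log²δ` leaves the integrable `1/(δ log²δ)`. -/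
theorem lintegral_lintegral_phaseIncr_lt_top {H : ℝ → ℝ≥0∞} (hm : Measurable H)
    {C δ₀ : ℝ} (hC : 0 < C) (hδ₀1 : δ₀ < 1) (hH : ∀ δ ∈ Ioo 0 δ₀,
      ∫⁻ ν, phaseIncr δ ν ^ 2 * H ν ≤ ENNReal.ofReal (C * (δ / Real.log δ ^ 2))) :
    ∫⁻ ν, (∫⁻ δ in Ioo 0 δ₀, phaseIncr δ ν ^ 2 * ENNReal.ofReal (1 / δ ^ 2)) * H ν
      < ∞ := by
  calc _ = ∫⁻ ν, ∫⁻ δ in Ioo 0 δ₀, phaseIncr δ ν ^ 2 * ENNReal.ofReal (1 / δ ^ 2) * H ν := by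
        refine lintegral_congr fun ν => ?_
        rw [lintegral_mul_const]
        exact ((measurable_phaseIncr ν).pow_const 2).mul
          (measurable_const.div (measurable_id.pow_const 2)).ennreal_ofReal
    _ = ∫⁻ δ in Ioo 0 δ₀, ∫⁻ ν, phaseIncr δ ν ^ 2 * ENNReal.ofReal (1 / δ ^ 2) * H ν := by
        rw [lintegral_lintegral_swap]
        refine Measurable.aemeasurable ?_
        have h2 : Measurable fun x : ℝ × ℝ => ENNReal.ofReal (1 / x.2 ^ 2) :=
          (measurable_const.div (measurable_snd.pow_const 2)).ennreal_ofReal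
        exact ((measurable_uncurry_phaseIncr.pow_const 2).mul h2).mul (hm.comp measurable_fst)
    _ ≤ ∫⁻ δ in Ioo 0 δ₀, ENNReal.ofReal C * ENNReal.ofReal (1 / (δ * Real.log δ ^ 2)) := by
        refine setLIntegral_mono' measurableSet_Ioo fun δ hδ => ?_
        have hδ0 := hδ.1
        calc _ = ENNReal.ofReal (1 / δ ^ 2) * ∫⁻ ν, phaseIncr δ ν ^ 2 * H ν := by
              rw [← lintegral_const_mul' _ _ ENNReal.ofReal_ne_top]
              refine lintegral_congr fun ν => ?_
              ring
          _ ≤ ENNReal.ofReal (1 / δ ^ 2) * ENNReal.ofReal (C * (δ / Real.log δ ^ 2)) := by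
              exact mul_le_mul' le_rfl (hH δ hδ)
          _ = _ := by
              rw [← ENNReal.ofReal_mul (by positivity), ← ENNReal.ofReal_mul hC.le]
              congr 1
              field_simp
    _ ≤ ENNReal.ofReal C * ∫⁻ δ in Ioc 0 δ₀, ENNReal.ofReal (1 / (δ * Real.log δ ^ 2)) := by
        rw [lintegral_const_mul' _ _ ENNReal.ofReal_ne_top]
        exact mul_le_mul' le_rfl (lintegral_mono_set Ioo_subset_Ioc_self)
    _ < ∞ := ENNReal.mul_lt_top ENNReal.ofReal_lt_top (lintegral_inv_mul_log_sq_lt_top hδ₀1)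

/-- Slightly more than half a derivative in the sense of `L²` moduli of continuity controls half a
derivative in the sense of Fourier transforms. -/
theorem lintegral_one_add_abs_mul_fourier_lt_top {Z : ℝ → ℂ} (hZ1 : Integrable Z) (hZ2 : MemLp Z 2)
    (hZ : ∃ C δ₀ : ℝ, 0 < C ∧ 0 < δ₀ ∧ δ₀ < 1 ∧ ∀ δ ∈ Ioo 0 δ₀,
      ∫⁻ r, incr Z δ r ^ 2 ≤ ENNReal.ofReal (C * (δ / Real.log δ ^ 2))) :
    ∫⁻ ν, ENNReal.ofReal (1 + |ν|) * ‖𝓕 Z ν‖ₑ ^ 2 < ∞ := by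
  obtain ⟨C, δ₀, hC, hδ₀, hδ₀1, hZ⟩ := hZ
  have hcont : Continuous (𝓕 Z) := continuous_fourier_of_integrable hZ1
  have hm : Measurable fun ν => ‖𝓕 Z ν‖ₑ ^ 2 := by fun_prop
  have hfin : ∫⁻ ν, ‖𝓕 Z ν‖ₑ ^ 2 < ∞ := by
    have h := eLpNorm_fourier_eq hZ2 hZ1
    have h2 : eLpNorm (𝓕 Z) 2 volume < ∞ := h ▸ hZ2.2
    have := (eLpNorm_lt_top_iff_lintegral_rpow_enorm_lt_top (by norm_num) (by norm_num)).1 h2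
    simpa using this
  have hmain := lintegral_lintegral_phaseIncr_lt_top hm hC hδ₀1 fun δ hδ =>
    (lintegral_phaseIncr_mul_fourier hZ1 hZ2 δ).trans_le (hZ δ hδ)
  have hlow := fun ν => le_lintegral_phaseIncr (ν := ν) hδ₀
  calc ∫⁻ ν, ENNReal.ofReal (1 + |ν|) * ‖𝓕 Z ν‖ₑ ^ 2
      ≤ ∫⁻ ν, (ENNReal.ofReal (1 + 1 / (2 * δ₀)) * ‖𝓕 Z ν‖ₑ ^ 2 +
          (∫⁻ δ in Ioo 0 δ₀, phaseIncr δ ν ^ 2 * ENNReal.ofReal (1 / δ ^ 2)) * ‖𝓕 Z ν‖ₑ ^ 2) := by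
        refine lintegral_mono fun ν => ?_
        rw [← add_mul]
        gcongr
        -- High frequencies are controlled by the integral over the steps; low ones have bounded
        -- weight and need only Plancherel.
        rcases le_total (1 / (2 * δ₀)) |ν| with h | h
        · calc ENNReal.ofReal (1 + |ν|) ≤ ENNReal.ofReal (1 + 1 / (2 * δ₀) + 8 * |ν|) := by
                refine ENNReal.ofReal_le_ofReal ?_
                have : 0 < 1 / (2 * δ₀) := by positivity
                linarith [abs_nonneg ν]
            _ = ENNReal.ofReal (1 + 1 / (2 * δ₀)) + ENNReal.ofReal (8 * |ν|) := by
                rw [ENNReal.ofReal_add (by positivity) (by positivity)]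
            _ ≤ _ := by gcongr; exact hlow ν h
        · exact le_add_right (ENNReal.ofReal_le_ofReal (by linarith))
    _ = ENNReal.ofReal (1 + 1 / (2 * δ₀)) * (∫⁻ ν, ‖𝓕 Z ν‖ₑ ^ 2) + _ := by
        rw [lintegral_add_left (by fun_prop), lintegral_const_mul' _ _ ENNReal.ofReal_ne_top]
    _ < ∞ := ENNReal.add_lt_top.2 ⟨ENNReal.mul_lt_top ENNReal.ofReal_lt_top hfin, hmain⟩

end PointInteraction

/-! ### The amplitude of the regular part at a centre -/

namespace PointInteraction

theorem abs_eq_one_of_sq_eq_one {ε : ℝ} (hε : ε ^ 2 = 1) : |ε| = 1 := by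
  rw [← sq_abs] at hε
  exact (pow_eq_one_iff_of_nonneg (abs_nonneg ε) two_ne_zero).1 hε

/-- The coefficient which multiplies the plane wave of a centre in the Fourier transform of the
regular part, as a function of the energy `w`. -/
noncomputable def boundaryTerm (ε lam R : ℝ) (p : ℝ → ℂ) (w : ℝ) : ℂ :=
  Complex.I * ε * Complex.exp ((-(ε * w * R) : ℝ) * Complex.I) *
      (∫ r in (0 : ℝ)..R, Complex.exp ((ε * w * r : ℝ) * Complex.I) * p r)
    - p R / ((w + lam : ℝ) : ℂ)
    + Complex.exp ((-(ε * w * R) : ℝ) * Complex.I) * p 0 / ((w + lam : ℝ) : ℂ)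

theorem norm_integral_exp_mul_I_le {κ : ℝ} (hκ : κ ≠ 0) (a b : ℝ) :
    ‖∫ r in a..b, Complex.exp ((κ * r : ℝ) * Complex.I)‖ ≤ 2 / |κ| := by
  have h1 : ∀ r : ℝ, Complex.exp ((κ * r : ℝ) * Complex.I) = Complex.exp ((κ * Complex.I) * r) := by
    intro r; congr 1; push_cast; ring
  simp only [h1]
  have hne : (κ : ℂ) * Complex.I ≠ 0 := by simp [hκ]
  rw [integral_exp_mul_complex hne, norm_div, norm_mul, Complex.norm_I, mul_one, Complex.norm_real,
    Real.norm_eq_abs]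
  refine div_le_div_of_nonneg_right ((norm_sub_le _ _).trans ?_) (abs_nonneg _)
  rw [← h1, ← h1, Complex.norm_exp_ofReal_mul_I, Complex.norm_exp_ofReal_mul_I]
  norm_num

theorem integral_exp_mul_affine {μ : ℂ} (hμ : μ ≠ 0) (c b : ℂ) (R : ℝ) :
    ∫ r in (0 : ℝ)..R, Complex.exp (μ * r) * (c + b * r)
      = (Complex.exp (μ * R) * (c + b * R) - c) / μ - b / μ * ∫ r in (0 : ℝ)..R, Complex.exp (μ * r)
    := by
  have hd : ∀ r : ℝ, HasDerivAt (fun r : ℝ => Complex.exp (μ * r) * (c + b * r) / μ)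
      (Complex.exp (μ * r) * (c + b * r) + b / μ * Complex.exp (μ * r)) r := by
    intro r
    have h0 : HasDerivAt (fun r : ℝ => (r : ℂ)) 1 r := Complex.ofRealCLM.hasDerivAt
    have h1 : HasDerivAt (fun r : ℝ => Complex.exp (μ * r)) (Complex.exp (μ * r) * (μ * 1)) r :=
      (h0.const_mul μ).cexp
    have h2 : HasDerivAt (fun r : ℝ => c + b * (r : ℂ)) (b * 1) r := (h0.const_mul b).const_add c
    refine ((h1.mul h2).div_const μ).congr_deriv ?_
    field_simp
  have hi : ∀ f : ℝ → ℂ, Continuous f → IntervalIntegrable f volume 0 R :=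
    fun f hf => hf.intervalIntegrable _ _
  have h := intervalIntegral.integral_eq_sub_of_hasDerivAt (a := 0) (b := R)
    (fun r _ => hd r) (hi _ (by fun_prop))
  rw [intervalIntegral.integral_add (hi _ (by fun_prop)) (hi _ (by fun_prop)),
    intervalIntegral.integral_const_mul] at h
  rw [eq_sub_iff_add_eq, h]
  simp
  ring

/-- From `p` one subtracts `ℓ(r) = e^{iε lam r}(p(0) + b r)`, which agrees with `p` at `0` by form
and at `R` by the choice of `b`. The factor `e^{iε lam r}` shifts the frequency `w` to `w + lam`, so
the boundary terms of the explicit integral of `ℓ` cancel the two fractions exactly, and only a term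
with the factor `b/(w + lam)` remains. -/
theorem boundaryTerm_eq {ε lam R w : ℝ} (hε : ε ^ 2 = 1) (hR : 0 < R) (hw : 0 < w + lam) {p : ℝ → ℂ}
    (hp : ContinuousOn p (Icc 0 R)) {b : ℂ}
    (hb : Complex.exp ((ε * lam * R : ℝ) * Complex.I) * (p 0 + b * R) = p R) :
    boundaryTerm ε lam R p w = Complex.exp ((-(ε * w * R) : ℝ) * Complex.I) *
      (Complex.I * ε * 𝓕 ((Ioc 0 R).indicator fun r : ℝ =>
          p r - Complex.exp ((ε * lam * r : ℝ) * Complex.I) * (p 0 + b * r)) (-(ε * w) / (2 * Real.pi))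
        - b / ((w + lam : ℝ) : ℂ) *
          ∫ r in (0 : ℝ)..R, Complex.exp ((ε * (w + lam) * r : ℝ) * Complex.I)) := by
  have hε0 : (ε : ℂ) ≠ 0 := by
    rintro h
    have : ε = 0 := by exact_mod_cast h
    rw [this] at hε; norm_num at hε
  have hε2 : (ε : ℂ) * ε = 1 := by rw [← sq]; exact_mod_cast hε
  have hκ : ((w + lam : ℝ) : ℂ) ≠ 0 := by exact_mod_cast hw.ne'
  have hF : 𝓕 ((Ioc 0 R).indicator fun r : ℝ =>
      p r - Complex.exp ((ε * lam * r : ℝ) * Complex.I) * (p 0 + b * r)) (-(ε * w) / (2 * Real.pi))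
      = (∫ r in (0 : ℝ)..R, Complex.exp ((ε * w * r : ℝ) * Complex.I) * p r)
        - ∫ r in (0 : ℝ)..R, Complex.exp ((ε * (w + lam) : ℝ) * Complex.I * r) * (p 0 + b * r) := by
    rw [Real.fourier_real_eq_integral_exp_smul, ← intervalIntegral.integral_sub,
      intervalIntegral.integral_of_le hR.le, ← integral_indicator measurableSet_Ioc]
    · refine integral_congr_ae (Eventually.of_forall fun r => ?_)
      by_cases hr : r ∈ Ioc 0 R
      · simp only [indicator_of_mem hr, smul_eq_mul]
        rw [mul_sub, ← mul_assoc, ← Complex.exp_add]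
        congr 2
        · congr 2
          have := Real.pi_pos.ne'
          push_cast; field_simp
        · congr 2
          have := Real.pi_ne_zero
          push_cast; field_simp
      · simp only [indicator_of_notMem hr, smul_zero]
    · refine ContinuousOn.intervalIntegrable ?_
      rw [uIcc_of_le hR.le]
      exact (Continuous.continuousOn (by fun_prop)).mul hp
    · exact Continuous.intervalIntegrable (by fun_prop) _ _
  have hμ : ((ε * (w + lam) : ℝ) : ℂ) * Complex.I ≠ 0 := by
    push_cast at hκ ⊢
    exact mul_ne_zero (mul_ne_zero hε0 hκ) Complex.I_ne_zero
  rw [hF, integral_exp_mul_affine hμ, boundaryTerm, ← hb]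
  have he1 : Complex.exp ((-(ε * w * R) : ℝ) * Complex.I) * Complex.exp ((ε * (w + lam) : ℝ) * Complex.I * R)
      = Complex.exp ((ε * lam * R : ℝ) * Complex.I) := by
    rw [← Complex.exp_add]; congr 1; push_cast; ring
  have he2 : ∀ r : ℝ, Complex.exp ((ε * (w + lam) : ℝ) * Complex.I * r)
      = Complex.exp ((ε * (w + lam) * r : ℝ) * Complex.I) := by
    intro r; congr 1; push_cast; ring
  rw [← he1]
  simp only [he2]
  generalize (∫ r in (0 : ℝ)..R, Complex.exp ((ε * w * r : ℝ) * Complex.I) * p r) = X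
  generalize (∫ r in (0 : ℝ)..R, Complex.exp ((ε * (w + lam) * r : ℝ) * Complex.I)) = Y
  generalize Complex.exp ((-(ε * w * R) : ℝ) * Complex.I) = E
  generalize Complex.exp ((ε * (w + lam) * R : ℝ) * Complex.I) = E'
  have h3 : ∀ z : ℂ, z / (((ε * (w + lam) : ℝ) : ℂ) * Complex.I)
      = -Complex.I * ε * z / ((w + lam : ℝ) : ℂ) := by
    intro z
    rw [div_eq_div_iff hμ hκ]
    have hI := Complex.I_mul_I
    push_cast
    linear_combination (-z * (w + lam)) * hε2 + (z * ε * ε * (w + lam)) * hI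
  rw [h3, h3]
  have hI := Complex.I_mul_I
  field_simp
  have hε3 : (ε : ℂ) ^ 2 = 1 := by exact_mod_cast hε
  linear_combination (-(E * E' * p 0) - E * E' * b * R + E * p 0 + E * b * Y) * (ε : ℂ) ^ 2 * hI
    - (-(E * E' * p 0) - E * E' * b * R + E * p 0 + E * b * Y) * hε3

theorem norm_exp_affine_sub_le (κ : ℝ) (c b : ℂ) {R : ℝ} :
    ∀ r ∈ Icc 0 R, ∀ r' ∈ Icc 0 R,
      ‖Complex.exp ((κ * r' : ℝ) * Complex.I) * (c + b * r')
          - Complex.exp ((κ * r : ℝ) * Complex.I) * (c + b * r)‖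
        ≤ (|κ| * (‖c‖ + ‖b‖ * R) + ‖b‖) * |r' - r| := by
  intro r hr r' hr'
  refine Convex.norm_image_sub_le_of_norm_hasDerivWithin_le
    (f := fun r : ℝ => Complex.exp ((κ * r : ℝ) * Complex.I) * (c + b * r))
    (f' := fun r : ℝ => Complex.exp ((κ * r : ℝ) * Complex.I) * (κ * Complex.I) * (c + b * r)
      + Complex.exp ((κ * r : ℝ) * Complex.I) * b) (s := Icc 0 R) (fun x _ => ?_) (fun x hx => ?_)
      (convex_Icc _ _) hr hr'
  · have h0 : HasDerivAt (fun r : ℝ => (r : ℂ)) 1 x := Complex.ofRealCLM.hasDerivAt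
    have h1 : HasDerivAt (fun r : ℝ => Complex.exp ((κ * r : ℝ) * Complex.I))
        (Complex.exp ((κ * x : ℝ) * Complex.I) * (κ * Complex.I)) x := by
      have := ((h0.const_mul (κ : ℂ)).mul_const Complex.I).cexp
      simp only [mul_one] at this
      push_cast
      exact this
    have h2 : HasDerivAt (fun r : ℝ => c + b * (r : ℂ)) b x := by
      have := (h0.const_mul b).const_add c
      simpa using this
    exact (h1.mul h2).hasDerivWithinAt
  · refine (norm_add_le _ _).trans (add_le_add ?_ ?_)
    · rw [norm_mul, norm_mul, Complex.norm_exp_ofReal_mul_I, one_mul, norm_mul, Complex.norm_I,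
        mul_one, Complex.norm_real, Real.norm_eq_abs]
      refine mul_le_mul_of_nonneg_left ((norm_add_le _ _).trans ?_) (abs_nonneg _)
      rw [norm_mul, Complex.norm_real, Real.norm_of_nonneg hx.1]
      gcongr
      exact hx.2
    · rw [norm_mul, Complex.norm_exp_ofReal_mul_I, one_mul]

theorem lintegral_comp_mul_le {a : ℝ} (ha : a ≠ 0) {F : ℝ → ℝ≥0∞} (hF : Measurable F) :
    ∫⁻ w, F (a * w) = ENNReal.ofReal |a⁻¹| * ∫⁻ ν, F ν := by
  rw [← lintegral_map (f := F) (g := fun w => a * w) hF (measurable_const_mul a),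
    Real.map_volume_mul_left ha, lintegral_smul_measure, smul_eq_mul]

/-- The zero extension of `p - ℓ` has half a derivative by the logarithmic gain and vanishes at both
ends. The explicit remainder is `O((w + lam)⁻²)`, since an oscillating integral of frequency `w +
lam` is at most `2/(w + lam)`, and is thus square integrable with weight `1 + w`. -/
theorem lintegral_boundaryTerm_lt_top {ε lam R : ℝ} (hε : ε ^ 2 = 1) (hR : 0 < R) (hlam : 0 < lam)
    {p P : ℝ → ℂ} (hp : ContinuousOn p (Icc 0 R)) (hPm : Measurable P) (hP0 : ∀ r ≤ 0, P r = 0)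
    (hPp : ∀ r ∈ Ioc 0 R, P r = p r - p 0)
    (hP : ∃ C δ₀ : ℝ, 0 < C ∧ 0 < δ₀ ∧ δ₀ < 1 ∧ δ₀ ≤ R ∧ ∀ δ ∈ Ioo 0 δ₀,
      (∀ r ≤ R - δ, incr P δ r ≤ ENNReal.ofReal (C / -Real.log δ)) ∧
      ∫⁻ r in Iic (R - δ), incr P δ r ^ 2 ≤ ENNReal.ofReal (C * (δ / Real.log δ ^ 2))) :
    ∫⁻ w in Ioi 0, ENNReal.ofReal (1 + w) * ‖boundaryTerm ε lam R p w‖ₑ ^ 2 < ∞ := by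
  obtain ⟨b, hb⟩ : ∃ b : ℂ, Complex.exp ((ε * lam * R : ℝ) * Complex.I) * (p 0 + b * R) = p R := by
    refine ⟨(Complex.exp (-((ε * lam * R : ℝ) * Complex.I)) * p R - p 0) / R, ?_⟩
    have hR' : (R : ℂ) ≠ 0 := by exact_mod_cast hR.ne'
    rw [div_mul_cancel₀ _ hR', add_sub_cancel, ← mul_assoc, ← Complex.exp_add, add_neg_cancel,
      Complex.exp_zero, one_mul]
  set ℓ : ℝ → ℂ := fun r => Complex.exp ((ε * lam * r : ℝ) * Complex.I) * (p 0 + b * r) with hℓ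
  have hℓ0 : ℓ 0 = p 0 := by simp [hℓ]
  set Z : ℝ → ℂ := (Ioc 0 R).indicator fun r : ℝ => p r - ℓ r with hZ
  have hZc : ContinuousOn (fun r => p r - ℓ r) (Icc 0 R) :=
    hp.sub (Continuous.continuousOn (by fun_prop))
  have hZeq : Z = (Ioc 0 R).indicator fun r => ℓ 0 + P r - ℓ r := by
    refine indicator_congr fun r hr => ?_
    rw [hPp r hr, hℓ0]; ring
  have hZ1 : Integrable Z :=
    (integrable_indicator_iff measurableSet_Ioc).2
      ((hZc.integrableOn_Icc).mono_set Ioc_subset_Icc_self)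
  have hZ2 : MemLp Z 2 := by
    obtain ⟨M, hM⟩ := (isCompact_Icc.image_of_continuousOn hZc.norm).bddAbove
    refine (memLp_indicator_iff_restrict measurableSet_Ioc).2 ?_
    refine MemLp.of_bound (C := M) ?_ ?_
    · exact (hZc.mono Ioc_subset_Icc_self).aestronglyMeasurable measurableSet_Ioc
    · filter_upwards [ae_restrict_mem measurableSet_Ioc] with r hr
      exact hM ⟨r, Ioc_subset_Icc_self hr, rfl⟩
  have hmain := lintegral_one_add_abs_mul_fourier_lt_top hZ1 hZ2 (by
    rw [hZeq]
    refine exists_lintegral_incr_cut_le hR hPm hP0 hP (L := |ε * lam| * (‖p 0‖ + ‖b‖ * R) + ‖b‖)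
      (by positivity) (norm_exp_affine_sub_le (ε * lam) (p 0) b) ?_
    rw [hℓ0, hPp R ⟨hR, le_rfl⟩]
    simp only [hℓ, hb]
    ring)
  have hFm : Measurable (𝓕 Z) := (continuous_fourier_of_integrable hZ1).measurable
  have hε1 : |ε| = 1 := abs_eq_one_of_sq_eq_one hε
  set a : ℝ := -ε / (2 * Real.pi) with ha
  have hε0 : ε ≠ 0 := by rintro rfl; simp at hε
  have ha0 : a ≠ 0 := div_ne_zero (neg_ne_zero.2 hε0) (by positivity)
  have haa : |a| = 1 / (2 * Real.pi) := by
    rw [ha, abs_div, abs_neg, hε1, abs_of_pos (by positivity)]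
  -- The minimum serves to compare weights: `m (1 + w) ≤ w + lam`.
  have hm0 : 0 < min 1 lam := lt_min one_pos hlam
  set m := min 1 lam
  have hpoint : ∀ w ∈ Ioi (0 : ℝ), ENNReal.ofReal (1 + w) * ‖boundaryTerm ε lam R p w‖ₑ ^ 2
      ≤ ENNReal.ofReal (4 * Real.pi) * (ENNReal.ofReal (1 + |a * w|) * ‖𝓕 Z (a * w)‖ₑ ^ 2)
        + ENNReal.ofReal (8 * ‖b‖ ^ 2 / m ^ 4 * (1 + w ^ 2)⁻¹) := by
    intro w hw
    have hw : 0 < w := hw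
    have hwl : 0 < w + lam := by linarith
    rw [boundaryTerm_eq hε hR hwl hp hb]
    have haw : -(ε * w) / (2 * Real.pi) = a * w := by rw [ha]; ring
    rw [haw]
    have h1 : ‖b / ((w + lam : ℝ) : ℂ) *
        ∫ r in (0 : ℝ)..R, Complex.exp ((ε * (w + lam) * r : ℝ) * Complex.I)‖
        ≤ 2 * ‖b‖ / (w + lam) ^ 2 := by
      rw [norm_mul, norm_div, Complex.norm_real, Real.norm_of_nonneg hwl.le]
      have := norm_integral_exp_mul_I_le (mul_ne_zero hε0 hwl.ne') 0 R
      rw [abs_mul, hε1, one_mul, abs_of_pos hwl] at this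
      calc _ ≤ ‖b‖ / (w + lam) * (2 / (w + lam)) := by gcongr
        _ = _ := by field_simp
    generalize (∫ r in (0 : ℝ)..R, Complex.exp ((ε * (w + lam) * r : ℝ) * Complex.I)) = Y at h1
    have h2 : ‖Complex.exp ((-(ε * w * R) : ℝ) * Complex.I) *
        (Complex.I * ε * 𝓕 Z (a * w) - b / ((w + lam : ℝ) : ℂ) * Y)‖
        ≤ ‖𝓕 Z (a * w)‖ + 2 * ‖b‖ / (w + lam) ^ 2 := by
      rw [norm_mul, Complex.norm_exp_ofReal_mul_I, one_mul]
      refine (norm_sub_le _ _).trans (add_le_add (le_of_eq ?_) h1)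
      rw [norm_mul, norm_mul, Complex.norm_I, Complex.norm_real, Real.norm_eq_abs, hε1, one_mul,
        one_mul]
    generalize Complex.exp ((-(ε * w * R) : ℝ) * Complex.I) *
        (Complex.I * ε * 𝓕 Z (a * w) - b / ((w + lam : ℝ) : ℂ) * Y) = X at h2
    generalize 𝓕 Z (a * w) = F at h2
    rw [← ofReal_norm, ← ofReal_norm, ← ENNReal.ofReal_pow (norm_nonneg _),
      ← ENNReal.ofReal_pow (norm_nonneg _), ← ENNReal.ofReal_mul (by positivity),
      ← ENNReal.ofReal_mul (by positivity), ← ENNReal.ofReal_mul (by positivity),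
      ← ENNReal.ofReal_add (by positivity) (by positivity)]
    refine ENNReal.ofReal_le_ofReal ?_
    have hml : m * (1 + w) ≤ w + lam := by
      have h3 : m ≤ 1 := min_le_left _ _
      have h4 : m ≤ lam := min_le_right _ _
      nlinarith
    have h5 : 2 * ‖b‖ / (w + lam) ^ 2 ≤ 2 * ‖b‖ / (m * (1 + w)) ^ 2 := by gcongr
    have h6 : ‖X‖ ^ 2 ≤ 2 * ‖F‖ ^ 2 + 2 * (2 * ‖b‖ / (m * (1 + w)) ^ 2) ^ 2 := by
      have h7 : ‖X‖ ≤ ‖F‖ + 2 * ‖b‖ / (m * (1 + w)) ^ 2 := h2.trans (by gcongr)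
      calc ‖X‖ ^ 2 ≤ (‖F‖ + 2 * ‖b‖ / (m * (1 + w)) ^ 2) ^ 2 := by gcongr
        _ ≤ _ := by nlinarith [sq_nonneg (‖F‖ - 2 * ‖b‖ / (m * (1 + w)) ^ 2)]
    calc (1 + w) * ‖X‖ ^ 2
        ≤ (1 + w) * (2 * ‖F‖ ^ 2 + 2 * (2 * ‖b‖ / (m * (1 + w)) ^ 2) ^ 2) := by gcongr
      _ = 2 * (1 + w) * ‖F‖ ^ 2 + 8 * ‖b‖ ^ 2 / m ^ 4 * ((1 + w) ^ 3)⁻¹ := by field_simp; ring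
      _ ≤ _ := by
        have hpi := Real.pi_gt_three
        refine add_le_add ?_ ?_
        · rw [← mul_assoc, abs_mul, haa, abs_of_pos hw]
          refine mul_le_mul_of_nonneg_right ?_ (by positivity)
          have : 4 * Real.pi * (1 + 1 / (2 * Real.pi) * w) = 4 * Real.pi + 2 * w := by
            field_simp
            ring
          rw [this]
          linarith
        · refine mul_le_mul_of_nonneg_left ?_ (by positivity)
          refine inv_anti₀ (by positivity) ?_
          nlinarith [pow_pos hw 3, pow_pos hw 2]
  refine (setLIntegral_mono' measurableSet_Ioi hpoint).trans_lt ?_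
  have hm1 : Measurable fun ν : ℝ => ENNReal.ofReal (1 + |ν|) * ‖𝓕 Z ν‖ₑ ^ 2 := by
    refine Measurable.mul (by fun_prop) (hFm.enorm.pow_const 2)
  refine (setLIntegral_le_lintegral _ _).trans_lt ?_
  rw [lintegral_add_right _ (by fun_prop), ENNReal.add_lt_top]
  constructor
  · rw [lintegral_const_mul' _ _ ENNReal.ofReal_ne_top]
    have := lintegral_comp_mul_le ha0 hm1
    rw [this]
    exact ENNReal.mul_lt_top ENNReal.ofReal_lt_top (ENNReal.mul_lt_top ENNReal.ofReal_lt_top hmain)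
  · have := (integrable_inv_one_add_sq.const_mul (8 * ‖b‖ ^ 2 / m ^ 4)).lintegral_lt_top
    exact this

end PointInteraction

/-! ### Data of order one half, singular at the initial time -/

namespace PointInteraction

/-- Bounded functions on `(0, R]` which are Hölder continuous of order one half away from zero and
whose modulus of continuity may degenerate at zero. -/
structure IsNice (R : ℝ) (f : ℝ → ℂ) : Prop where
  bounded : ∃ M : NNReal, ∀ r ∈ Ioc 0 R, ‖f r‖ ≤ M
  modulus : ∃ C : ℝ, 0 ≤ C ∧ ∀ r r', 0 < r → r < r' → r' ≤ R →
    ‖f r' - f r‖ ≤ C * ((r' - r) / r + √(r' - r))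

namespace IsNice

variable {R : ℝ} {f g : ℝ → ℂ}

theorem of_le {M C : ℝ} (hM : ∀ r ∈ Ioc 0 R, ‖f r‖ ≤ M) (hC : ∀ r r', 0 < r → r < r' → r' ≤ R →
    ‖f r' - f r‖ ≤ C * ((r' - r) / r + √(r' - r))) : IsNice R f := by
  refine ⟨⟨M.toNNReal, fun r hr => (hM r hr).trans (Real.le_coe_toNNReal M)⟩, max C 0,
    le_max_right _ _, fun r r' h0 h1 h2 => (hC r r' h0 h1 h2).trans ?_⟩
  have : 0 ≤ (r' - r) / r := div_nonneg (by linarith) h0.le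
  exact mul_le_mul_of_nonneg_right (le_max_left _ _) (by positivity)

theorem const (z : ℂ) : IsNice R fun _ => z :=
  of_le (M := ‖z‖) (C := 0) (fun _ _ => le_rfl) fun r r' _ _ _ => by simp

theorem add (hf : IsNice R f) (hg : IsNice R g) : IsNice R fun r => f r + g r := by
  obtain ⟨⟨M, hM⟩, C, hC0, hC⟩ := hf
  obtain ⟨⟨M', hM'⟩, C', hC0', hC'⟩ := hg
  refine of_le (M := M + M') (C := C + C')
    (fun r hr => (norm_add_le _ _).trans (add_le_add (hM r hr) (hM' r hr))) fun r r' h0 h1 h2 => ?_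
  rw [add_sub_add_comm, add_mul]
  exact (norm_add_le _ _).trans (add_le_add (hC r r' h0 h1 h2) (hC' r r' h0 h1 h2))

theorem mul (hf : IsNice R f) (hg : IsNice R g) : IsNice R fun r => f r * g r := by
  obtain ⟨⟨M, hM⟩, C, hC0, hC⟩ := hf
  obtain ⟨⟨M', hM'⟩, C', hC0', hC'⟩ := hg
  refine of_le (M := M * M') (C := M * C' + M' * C) (fun r hr => ?_) fun r r' h0 h1 h2 => ?_
  · rw [norm_mul]
    exact mul_le_mul (hM r hr) (hM' r hr) (norm_nonneg _) M.2
  · have h3 : f r' * g r' - f r * g r = f r' * (g r' - g r) + g r * (f r' - f r) := by ring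
    have h4 := hC r r' h0 h1 h2
    have h5 := hC' r r' h0 h1 h2
    have h6 := hM r' ⟨h0.trans h1, h2⟩
    have h7 := hM' r ⟨h0, h1.le.trans h2⟩
    rw [h3, add_mul, mul_assoc, mul_assoc]
    refine (norm_add_le _ _).trans ?_
    rw [norm_mul, norm_mul]
    gcongr

theorem const_mul (z : ℂ) (hf : IsNice R f) : IsNice R fun r => z * f r := (const z).mul hf

theorem sum {ι : Type*} (t : Finset ι) {F : ι → ℝ → ℂ} (hF : ∀ i ∈ t, IsNice R (F i)) :
    IsNice R fun r => ∑ i ∈ t, F i r := by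
  classical
  induction t using Finset.induction_on with
  | empty => simpa using const 0
  | insert a t ha ih =>
    simp only [Finset.sum_insert ha]
    exact (hF a (Finset.mem_insert_self _ _)).add
      (ih fun i hi => hF i (Finset.mem_insert_of_mem hi))

/-- Since `r ≤ R`, a step `r' - r` is at most `R (r' - r)/r`, so the degenerate part of the modulus
absorbs it. -/
theorem of_lipschitz {L : ℝ} (hL : 0 ≤ L) (h : ∀ r ∈ Icc 0 R, ∀ r' ∈ Icc 0 R,
    ‖f r' - f r‖ ≤ L * |r' - r|) : IsNice R f := by
  refine of_le (M := ‖f 0‖ + L * R) (C := L * R) (fun r hr => ?_) fun r r' h0 h1 h2 => ?_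
  · have h1 := h 0 ⟨le_rfl, hr.1.le.trans hr.2⟩ r ⟨hr.1.le, hr.2⟩
    have h2 : ‖f r‖ ≤ ‖f 0‖ + ‖f r - f 0‖ := by
      simpa using norm_add_le (f 0) (f r - f 0)
    rw [sub_zero, abs_of_pos hr.1] at h1
    have h3 := hr.2
    nlinarith
  · refine (h r ⟨h0.le, h1.le.trans h2⟩ r' ⟨(h0.trans h1).le, h2⟩).trans ?_
    rw [abs_of_pos (sub_pos.2 h1), mul_assoc]
    refine mul_le_mul_of_nonneg_left ?_ hL
    have h3 : r' - r ≤ R * ((r' - r) / r) := by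
      rw [mul_div_assoc', le_div_iff₀ h0]
      nlinarith
    have h4 : 0 ≤ R * √(r' - r) := mul_nonneg (by linarith) (Real.sqrt_nonneg _)
    linarith

theorem continuousOn (hf : IsNice R f) : ContinuousOn f (Ioc 0 R) := by
  obtain ⟨-, C, hC0, hC⟩ := hf
  intro r₀ hr₀
  have h0 : 0 < r₀ := hr₀.1
  have hb : ∀ r ∈ Ioc 0 R, r₀ / 2 < r →
      ‖f r - f r₀‖ ≤ C * (|r - r₀| / (r₀ / 2) + √|r - r₀|) := by
    intro r hr h2
    rcases lt_trichotomy r r₀ with h | h | h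
    · have := hC r r₀ hr.1 h hr₀.2
      rw [norm_sub_rev, abs_sub_comm, abs_of_pos (sub_pos.2 h)]
      refine this.trans (mul_le_mul_of_nonneg_left (add_le_add_left ?_ _) hC0)
      exact div_le_div_of_nonneg_left (sub_pos.2 h).le (by linarith) h2.le
    · subst h; simp
    · have := hC r₀ r hr₀.1 h hr.2
      rw [abs_of_pos (sub_pos.2 h)]
      refine this.trans (mul_le_mul_of_nonneg_left (add_le_add_left ?_ _) hC0)
      exact div_le_div_of_nonneg_left (sub_pos.2 h).le (by linarith) (by linarith)
  rw [ContinuousWithinAt, tendsto_iff_norm_sub_tendsto_zero]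
  have hlim : Tendsto (fun r => C * (|r - r₀| / (r₀ / 2) + √|r - r₀|)) (𝓝[Ioc 0 R] r₀) (𝓝 0) := by
    have hc : Continuous fun r => C * (|r - r₀| / (r₀ / 2) + √|r - r₀|) := by fun_prop
    have := hc.tendsto r₀
    simp only [sub_self, abs_zero, zero_div, Real.sqrt_zero, add_zero, mul_zero] at this
    exact this.mono_left nhdsWithin_le_nhds
  refine tendsto_of_tendsto_of_tendsto_of_le_of_le' tendsto_const_nhds hlim
    (Eventually.of_forall fun _ => norm_nonneg _) ?_
  filter_upwards [self_mem_nhdsWithin,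
    mem_nhdsWithin_of_mem_nhds (Ioi_mem_nhds (show r₀ / 2 < r₀ by linarith))] with r h1 h2
  exact hb r h1 h2

theorem measurable_indicator (hf : IsNice R f) : Measurable ((Ioc 0 R).indicator f) := by
  have := hf.continuousOn.measurable_piecewise (g := fun _ => (0 : ℂ)) continuousOn_const
    measurableSet_Ioc
  rwa [show (fun _ => (0 : ℂ)) = (0 : ℝ → ℂ) from rfl, piecewise_eq_indicator] at this

/-- The degeneracy at zero costs no more than a jump. On `(-δ, δ]` the increment is at most `2M`
over a length `2δ`; beyond `δ` the square of `δ/r` integrates to `δ²/δ = δ`, and the square of `√δ`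
over a length `R` gives `Rδ`. -/
theorem halfSq (hf : IsNice R f) : HalfSq R (incr ((Ioc 0 R).indicator f)) := by
  obtain ⟨⟨M, hM⟩, C, hC0, hC⟩ := hf
  set F := (Ioc 0 R).indicator f with hF
  have hFM : ∀ r, ‖F r‖ ≤ M := by
    intro r
    by_cases hr : r ∈ Ioc 0 R
    · rw [hF, indicator_of_mem hr]; exact hM r hr
    · rw [hF, indicator_of_notMem hr, norm_zero]; exact M.2
  rcases le_or_gt R 0 with hR | hR
  · exact ⟨0, by simp, fun δ hδ => absurd (hδ.1.trans_le hδ.2) (not_lt.2 hR)⟩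
  refine ⟨ENNReal.ofReal (8 * M ^ 2 + 2 * C ^ 2 + 2 * C ^ 2 * R), ENNReal.ofReal_ne_top,
    fun δ hδ => ?_⟩
  have hδ0 : 0 < δ := hδ.1
  have hb : ∀ r ∈ Iic (R - δ), incr F δ r ^ 2
      ≤ (Ioc (-δ) δ).indicator (fun _ => ENNReal.ofReal (4 * M ^ 2)) r
        + ((Ioi δ).indicator (fun r => ENNReal.ofReal (2 * C ^ 2 * δ ^ 2 * r ^ (-2 : ℝ))) r
        + (Ioc 0 R).indicator (fun _ => ENNReal.ofReal (2 * C ^ 2 * δ)) r) := by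
    intro r hr
    have hr : r ≤ R - δ := hr
    rw [incr, ← ofReal_norm, ← ENNReal.ofReal_pow (norm_nonneg _)]
    rcases le_or_gt r (-δ) with h1 | h1
    · have h2 : F r = 0 := indicator_of_notMem (fun h => by linarith [h.1]) f
      have h3 : F (r + δ) = 0 := indicator_of_notMem (fun h => by linarith [h.1]) f
      rw [h2, h3]; simp
    rcases le_or_gt r δ with h2 | h2
    · rw [indicator_of_mem (show r ∈ Ioc (-δ) δ from ⟨h1, h2⟩)]
      refine le_add_right (ENNReal.ofReal_le_ofReal ?_)
      have h3 : ‖F (r + δ) - F r‖ ≤ 2 * M := by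
        refine (norm_sub_le _ _).trans ?_
        linarith [hFM r, hFM (r + δ)]
      calc _ ≤ (2 * (M : ℝ)) ^ 2 := by gcongr
        _ = _ := by ring
    · have hr0 : 0 < r := hδ0.trans h2
      rw [indicator_of_mem (show r ∈ Ioi δ from h2),
        indicator_of_mem (show r ∈ Ioc 0 R from ⟨hr0, by linarith⟩)]
      refine le_add_left ?_
      rw [← ENNReal.ofReal_add (by positivity) (by positivity)]
      refine ENNReal.ofReal_le_ofReal ?_
      rw [hF, indicator_of_mem (show r ∈ Ioc 0 R from ⟨hr0, by linarith⟩),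
        indicator_of_mem (show r + δ ∈ Ioc 0 R from ⟨by linarith, by linarith⟩)]
      have h3 := hC r (r + δ) hr0 (by linarith) (by linarith)
      rw [add_sub_cancel_left] at h3
      rw [Real.rpow_neg hr0.le, Real.rpow_two]
      have h4 := Real.sq_sqrt hδ0.le
      calc _ ≤ (C * (δ / r + √δ)) ^ 2 := by gcongr
        _ ≤ C ^ 2 * (2 * (δ / r) ^ 2 + 2 * √δ ^ 2) := by
          rw [mul_pow]
          refine mul_le_mul_of_nonneg_left ?_ (sq_nonneg C)
          nlinarith [sq_nonneg (δ / r - √δ)]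
        _ = _ := by rw [h4, div_pow]; ring
  refine (setLIntegral_mono' measurableSet_Iic hb).trans ((setLIntegral_le_lintegral _ _).trans ?_)
  have hm : Measurable ((Ioc (-δ) δ).indicator fun _ : ℝ => ENNReal.ofReal (4 * (M : ℝ) ^ 2)) :=
    measurable_const.indicator measurableSet_Ioc
  have hm' : Measurable ((Ioc 0 R).indicator fun _ : ℝ => ENNReal.ofReal (2 * C ^ 2 * δ)) :=
    measurable_const.indicator measurableSet_Ioc
  rw [lintegral_add_left hm, lintegral_add_right _ hm', lintegral_indicator measurableSet_Ioc,
    lintegral_indicator measurableSet_Ioc, lintegral_indicator measurableSet_Ioi, setLIntegral_const,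
    setLIntegral_const, Real.volume_Ioc, Real.volume_Ioc,
    ← ofReal_integral_eq_lintegral_ofReal
      ((integrableOn_Ioi_rpow_of_lt (by norm_num) hδ0).const_mul _)
      ((ae_restrict_mem measurableSet_Ioi).mono fun r hr => by
        have : 0 < r := hδ0.trans hr
        positivity),
    integral_const_mul, integral_Ioi_rpow_of_lt (by norm_num) hδ0,
    ← ENNReal.ofReal_mul (by positivity), ← ENNReal.ofReal_mul (by positivity),
    ← ENNReal.ofReal_mul (by positivity)]
  have h1 : -δ ^ ((-2 : ℝ) + 1) / (-2 + 1) = δ⁻¹ := by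
    rw [show (-2 : ℝ) + 1 = -1 by norm_num, Real.rpow_neg_one]; ring
  rw [h1, ← ENNReal.ofReal_add (by positivity) (by positivity),
    ← ENNReal.ofReal_add (by nlinarith [sq_nonneg (M : ℝ)]) (by positivity)]
  refine ENNReal.ofReal_le_ofReal (le_of_eq ?_)
  field_simp
  ring

end IsNice

/-- Here the regularity argument is assembled. The initial values are moved into the source, `G' = G
+ ∑ A p(0)`, so that the unknown `P = p - p(0)` extends by zero without a jump at the initial time.
Then `halfSq_of_volterra`, `exists_incr_conv_le` and `lintegral_boundaryTerm_lt_top` apply in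
succession. -/
theorem lintegral_boundaryTerm_lt_top_of_volterra {N : ℕ} {ε lam R : ℝ} (hε : ε ^ 2 = 1) (hR : 0 < R)
    (hlam : 0 < lam) {p G : Fin N → ℝ → ℂ} {A : Fin N → Fin N → ℝ → ℂ}
    (hp : ∀ j, ContinuousOn (p j) (Icc 0 R)) (hG : ∀ j, IsNice R (G j))
    (hA : ∀ j l, IsNice R (A j l))
    (heq : ∀ j, ∀ r ∈ Ioc 0 R, p j r - p j 0
      = ∫ ρ in Ioo 0 r, (volterraI (r - ρ) : ℂ) * (G j ρ + ∑ l, A j l ρ * p l ρ)) (j : Fin N) :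
    ∫⁻ w in Ioi 0, ENNReal.ofReal (1 + w) * ‖boundaryTerm ε lam R (p j) w‖ₑ ^ 2 < ∞ := by
  set P : Fin N → ℝ → ℂ := fun j => (Ioc 0 R).indicator fun r => p j r - p j 0 with hPdef
  set G' : Fin N → ℝ → ℂ := fun j => (Ioc 0 R).indicator fun r => G j r + ∑ l, A j l r * p l 0
    with hG'def
  set A' : Fin N → Fin N → ℝ → ℂ := fun j l => (Ioc 0 R).indicator (A j l) with hA'def
  have hGn : ∀ j, IsNice R fun r => G j r + ∑ l, A j l r * p l 0 := fun j =>
    (hG j).add (IsNice.sum _ fun l _ => (hA j l).mul (IsNice.const _))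
  have hGm : ∀ j, Measurable (G' j) := fun j => (hGn j).measurable_indicator
  have hAm : ∀ j l, Measurable (A' j l) := fun j l => (hA j l).measurable_indicator
  have hPm : ∀ j, Measurable (P j) := by
    intro j
    have hc : ContinuousOn (fun r => p j r - p j 0) (Ioc 0 R) :=
      ((hp j).mono Ioc_subset_Icc_self).sub continuousOn_const
    have := hc.measurable_piecewise (g := fun _ => (0 : ℂ)) continuousOn_const measurableSet_Ioc
    rwa [show (fun _ => (0 : ℂ)) = (0 : ℝ → ℂ) from rfl, piecewise_eq_indicator] at this
  have hnot : ∀ r ≤ (0 : ℝ), r ∉ Ioc 0 R := fun r hr h => absurd h.1 (not_lt.2 hr)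
  have hP0 : ∀ j, ∀ r ≤ 0, P j r = 0 := fun j r hr => indicator_of_notMem (hnot r hr) _
  have hG0 : ∀ j, ∀ r ≤ 0, G' j r = 0 := fun j r hr => indicator_of_notMem (hnot r hr) _
  have hA0 : ∀ j l, ∀ r ≤ 0, A' j l r = 0 := fun j l r hr => indicator_of_notMem (hnot r hr) _
  have hbdd : ∀ f : ℝ → ℂ, (∃ M : NNReal, ∀ r ∈ Ioc 0 R, ‖f r‖ ≤ M) →
      ∃ M : NNReal, ∀ r, ‖(Ioc 0 R).indicator f r‖ ≤ M := by
    rintro f ⟨M, hM⟩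
    refine ⟨M, fun r => ?_⟩
    by_cases hr : r ∈ Ioc 0 R
    · rw [indicator_of_mem hr]; exact hM r hr
    · rw [indicator_of_notMem hr, norm_zero]; exact M.2
  have hpb : ∀ j, ∃ M : NNReal, ∀ r ∈ Ioc 0 R, ‖p j r - p j 0‖ ≤ M := by
    intro j
    obtain ⟨M, hM⟩ := (isCompact_Icc.image_of_continuousOn
      ((hp j).sub (continuousOn_const (c := p j 0))).norm).bddAbove
    exact ⟨M.toNNReal, fun r hr => (hM ⟨r, Ioc_subset_Icc_self hr, rfl⟩).trans
      (Real.le_coe_toNNReal M)⟩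
  choose MP hMP using fun j => hbdd _ (hpb j)
  choose MG hMG using fun j => hbdd _ (hGn j).bounded
  choose MA hMA using fun j l => hbdd _ (hA j l).bounded
  obtain ⟨M, hM1, hM2, hM3⟩ : ∃ M : NNReal, (∀ j r, ‖G' j r‖ ≤ M) ∧ (∀ j l r, ‖A' j l r‖ ≤ M) ∧
      ∀ j r, ‖P j r‖ ≤ M := by
    refine ⟨∑ j, MG j + ∑ j, ∑ l, MA j l + ∑ j, MP j, fun j r => (hMG j r).trans ?_,
      fun j l r => (hMA j l r).trans ?_, fun j r => (hMP j r).trans ?_⟩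
    · have := Finset.single_le_sum (fun i _ => zero_le) (Finset.mem_univ j) (f := MG)
      exact_mod_cast this.trans (le_add_right (le_add_right le_rfl))
    · have h1 := Finset.single_le_sum (fun i _ => zero_le) (Finset.mem_univ l) (f := MA j)
      have := Finset.single_le_sum (fun i _ => zero_le) (Finset.mem_univ j)
        (f := fun j => ∑ l, MA j l)
      exact_mod_cast (h1.trans this).trans (le_add_right (le_add_left le_rfl))
    · have := Finset.single_le_sum (fun i _ => zero_le) (Finset.mem_univ j) (f := MP)
      exact_mod_cast this.trans (le_add_left le_rfl)
  have hsum : ∀ j, (Ioc 0 R).EqOn (fun r => G' j r + ∑ l, A' j l r * P l r)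
      (fun r => G j r + ∑ l, A j l r * p l r) := by
    intro j r hr
    simp only [hG'def, hA'def, hPdef, indicator_of_mem hr]
    rw [add_assoc, ← Finset.sum_add_distrib]
    congr 1
    refine Finset.sum_congr rfl fun l _ => ?_
    ring
  -- Since the data vanish for nonpositive arguments and the kernel is causal, the integral over
  -- `(0, r)` can be written over the whole line with the kernel truncated at `R`, independently of
  -- `r`.
  have hPeq : ∀ j, ∀ r ≤ R, P j r = ∫ u, (cutKernel R u : ℂ) *
      (G' j (r - u) + ∑ l, A' j l (r - u) * P l (r - u)) := by
    intro j r hr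
    rcases le_or_gt r 0 with h0 | h0
    · rw [hP0 j r h0, eq_comm, integral_eq_zero_of_ae]
      refine Eventually.of_forall fun u => ?_
      simp only [Pi.zero_apply]
      rcases le_or_gt u 0 with hu | hu
      · rw [cutKernel_of_nonpos R hu]; simp
      · rw [hG0 j _ (by linarith)]
        simp [fun l => hA0 j l (r - u) (by linarith)]
    · have h1 : P j r = p j r - p j 0 := indicator_of_mem (show r ∈ Ioc 0 R from ⟨h0, hr⟩) _
      rw [h1, heq j r ⟨h0, hr⟩, ← integral_indicator measurableSet_Ioo,
        ← integral_sub_left_eq_self _ volume r]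
      refine integral_congr_ae ?_
      have hne : ∀ᵐ u : ℝ, u ≠ R := by simp [ae_iff]
      filter_upwards [hne] with u huR
      by_cases hu : u ∈ Ioo 0 r
      · rw [indicator_of_mem (show r - u ∈ Ioo 0 r from ⟨by linarith [hu.2], by linarith [hu.1]⟩)]
        have hmem : r - u ∈ Ioc 0 R := ⟨by linarith [hu.2], by linarith [hu.1]⟩
        rw [cutKernel, indicator_of_mem (show u ∈ Ioo 0 R from ⟨hu.1, by linarith [hu.2]⟩)]
        have := hsum j hmem
        simp only at this
        rw [this, sub_sub_cancel]
      · rw [indicator_of_notMem (fun h => hu ⟨by linarith [h.2], by linarith [h.1]⟩)]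
        rcases le_or_gt u 0 with hu0 | hu0
        · rw [cutKernel_of_nonpos R hu0]; simp
        · have hur : r ≤ u := not_lt.1 fun h => hu ⟨hu0, h⟩
          rw [hG0 j _ (by linarith)]
          simp [fun l => hA0 j l (r - u) (by linarith)]
  have hhalf := halfSq_of_volterra (measurable_cutKernel R) (integrable_cutKernel hR)
    (fun u hu => cutKernel_of_nonpos R hu) hGm hAm hPm hM1 hM2 hM3 hG0 hA0 hP0 hPeq
    (fun j => (hGn j).halfSq) (fun j l => (hA j l).halfSq) j
  refine lintegral_boundaryTerm_lt_top hε hR hlam (hp j) (hPm j) (hP0 j)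
    (fun r hr => indicator_of_mem hr _) ?_
  refine exists_incr_conv_le hR (M := M + ∑ _l : Fin N, M * M) ?_ (fun r => ?_) (hP0 j) (hPeq j) hhalf
  · exact (hGm j).add (Finset.measurable_sum _ fun l _ => (hAm j l).mul (hPm l))
  · push_cast
    refine (norm_add_le _ _).trans (add_le_add (hM1 j r) ((norm_sum_le _ _).trans
      (Finset.sum_le_sum fun l _ => ?_)))
    rw [norm_mul]
    exact mul_le_mul (hM2 j l r) (hM3 l r) (norm_nonneg _) M.2

end PointInteraction

/-! ### The improper time integral of the free kernel -/

namespace PointInteraction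

/-- The oscillation `e^{ib/v}`. -/
noncomputable def inversePhase (b v : ℝ) : ℂ := Complex.exp ((b / v : ℝ) * Complex.I)

theorem norm_inversePhase (b v : ℝ) : ‖inversePhase b v‖ = 1 := Complex.norm_exp_ofReal_mul_I _

theorem intervalIntegrable_inversePhase (b x y : ℝ) :
    IntervalIntegrable (inversePhase b) volume x y := by
  refine (intervalIntegrable_const (c := (1 : ℝ))).mono_fun ?_ ?_
  · refine Measurable.aestronglyMeasurable ?_
    unfold inversePhase
    fun_prop
  · exact Eventually.of_forall fun v => by simp [norm_inversePhase]

theorem continuousOn_inversePhase (b : ℝ) : ContinuousOn (inversePhase b) (Ioi 0) := by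
  unfold inversePhase
  refine Complex.continuous_exp.comp_continuousOn (ContinuousOn.mul ?_ continuousOn_const)
  exact Complex.continuous_ofReal.comp_continuousOn
    (continuousOn_const.div continuousOn_id fun v hv => ne_of_gt hv)

/-- This identity expresses the merely conditionally integrable `e^{ib/v}/v` through the bounded
function `e^{ib/v}` and a total derivative. -/
theorem hasDerivAt_mul_inversePhase (b : ℝ) {v : ℝ} (hv : v ≠ 0) :
    HasDerivAt (fun v : ℝ => v * inversePhase b v)
      (inversePhase b v - Complex.I * b * (inversePhase b v / v)) v := by
  have h0 : HasDerivAt (fun r : ℝ => (r : ℂ)) 1 v := Complex.ofRealCLM.hasDerivAt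
  have h1 : HasDerivAt (fun v : ℝ => b / v) (-b / v ^ 2) v := by
    simpa [div_eq_mul_inv] using (hasDerivAt_inv hv).const_mul b
  have h2 : HasDerivAt (inversePhase b)
      (inversePhase b v * (((-b / v ^ 2 : ℝ) : ℂ) * Complex.I)) v :=
    (h1.ofReal_comp.mul_const Complex.I).cexp
  refine (h0.mul h2).congr_deriv ?_
  have hv' : (v : ℂ) ≠ 0 := by exact_mod_cast hv
  push_cast
  field_simp
  ring

theorem integral_inversePhase_div {b : ℝ} (hb : b ≠ 0) {η T : ℝ} (hη : 0 < η) (hT : 0 < T) :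
    ∫ v in η..T, inversePhase b v / v = 1 / (Complex.I * b) *
      ((∫ v in η..T, inversePhase b v) - (T * inversePhase b T - η * inversePhase b η)) := by
  have hsub : uIcc η T ⊆ Ioi 0 := fun v hv => (lt_min hη hT).trans_le hv.1
  have hi : IntervalIntegrable (fun v : ℝ => inversePhase b v / v) volume η T := by
    refine ContinuousOn.intervalIntegrable ?_
    exact ((continuousOn_inversePhase b).mono hsub).div Complex.continuous_ofReal.continuousOn
      fun v hv => by exact_mod_cast ne_of_gt (hsub hv)
  have h := intervalIntegral.integral_eq_sub_of_hasDerivAt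
    (fun v hv => hasDerivAt_mul_inversePhase b (ne_of_gt (hsub hv)))
    ((intervalIntegrable_inversePhase b η T).sub (hi.const_mul (Complex.I * b)))
  rw [intervalIntegral.integral_sub (intervalIntegrable_inversePhase b η T) (hi.const_mul _),
    intervalIntegral.integral_const_mul] at h
  have hb' : Complex.I * (b : ℂ) ≠ 0 := mul_ne_zero Complex.I_ne_zero (by exact_mod_cast hb)
  rw [← h, sub_sub_cancel, one_div, inv_mul_cancel_left₀ hb']

theorem mul_freeKernel {ε : ℝ} (hε : ε ^ 2 = 1) (v ρ : ℝ) :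
    ε * freeKernel (ε * v) ρ = 1 / (2 * Complex.I) * (inversePhase (ε * (ρ ^ 2 / 4)) v / v) := by
  have hε' : (ε : ℂ) ^ 2 = 1 := by exact_mod_cast hε
  have hε0 : (ε : ℂ) ≠ 0 := by rintro h; rw [h] at hε'; norm_num at hε'
  have hinv : (ε : ℂ)⁻¹ = ε := by
    exact inv_eq_of_mul_eq_one_left (by rw [← sq, hε'])
  have h1 : -(ρ : ℂ) ^ 2 / (4 * Complex.I * ((ε * v : ℝ) : ℂ))
      = ((ε * (ρ ^ 2 / 4) / v : ℝ) : ℂ) * Complex.I := by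
    push_cast
    rw [div_eq_mul_inv, mul_inv, mul_inv, mul_inv, hinv, Complex.inv_I]
    ring
  rw [freeKernel, inversePhase, h1]
  push_cast
  rw [div_eq_mul_inv, mul_inv (2 * Complex.I), mul_inv (ε : ℂ), mul_comm (ε : ℂ)]
  generalize Complex.exp _ = E
  field_simp

/-- After the integration by parts the cut-off integrals have a bounded integrand, and the boundary
term at the cut-off `(1 - θ)T` has that modulus. Both limits as `θ ↑ 1` are then elementary. The
exponent `b` is nonzero because `ρ > 0`. -/
theorem freeKernelIntegral_eq {ε : ℝ} (hε : ε ^ 2 = 1) (s : ℝ) {ρ T : ℝ} (hρ : 0 < ρ) (hT : 0 < T) :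
    freeKernelIntegral s (s + ε * T) ρ = 1 / (2 * Complex.I) * (1 / (Complex.I * (ε * (ρ ^ 2 / 4) : ℝ)) *
      ((∫ v in (0 : ℝ)..T, inversePhase (ε * (ρ ^ 2 / 4)) v)
        - T * inversePhase (ε * (ρ ^ 2 / 4)) T)) := by
  set b := ε * (ρ ^ 2 / 4) with hbdef
  have hε0 : ε ≠ 0 := by rintro rfl; norm_num at hε
  have hb : b ≠ 0 := mul_ne_zero hε0 (by positivity)
  have h1 : ∀ θ ∈ Iio (1 : ℝ), ∫ σ in s..(s + θ * (s + ε * T - s)), freeKernel (s + ε * T - σ) ρ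
      = 1 / (2 * Complex.I) * (1 / (Complex.I * b) *
      ((∫ v in ((1 - θ) * T)..T, inversePhase b v)
        - (T * inversePhase b T - ((1 - θ) * T : ℝ) * inversePhase b ((1 - θ) * T)))) := by
    intro θ hθ
    have hθ : θ < 1 := hθ
    rw [← integral_inversePhase_div hb (mul_pos (by linarith) hT) hT,
      intervalIntegral.integral_comp_sub_left (fun v => freeKernel v ρ),
      show s + ε * T - (s + θ * (s + ε * T - s)) = ε * ((1 - θ) * T) by ring,
      show s + ε * T - s = ε * T by ring,
      ← intervalIntegral.smul_integral_comp_mul_left, Complex.real_smul,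
      ← intervalIntegral.integral_const_mul, ← intervalIntegral.integral_const_mul]
    exact intervalIntegral.integral_congr fun v _ => mul_freeKernel hε v ρ
  refine Tendsto.limUnder_eq ?_
  have h2 : Tendsto (fun θ : ℝ => (1 - θ) * T) (𝓝[<] 1) (𝓝 0) := by
    have : Continuous fun θ : ℝ => (1 - θ) * T := by fun_prop
    have h := this.tendsto 1
    simp only [sub_self, zero_mul] at h
    exact h.mono_left nhdsWithin_le_nhds
  have h3 : Tendsto (fun θ : ℝ => ∫ v in ((1 - θ) * T)..T, inversePhase b v) (𝓝[<] 1)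
      (𝓝 (∫ v in (0 : ℝ)..T, inversePhase b v)) := by
    have hc := intervalIntegral.continuous_primitive
      (fun x y => intervalIntegrable_inversePhase b x y) T
    have := (hc.tendsto 0).comp h2
    have h := this.neg
    rw [← intervalIntegral.integral_symm] at h
    refine h.congr fun θ => ?_
    rw [Function.comp_apply, ← intervalIntegral.integral_symm]
  have h4 : Tendsto (fun θ : ℝ => (((1 - θ) * T : ℝ) : ℂ) * inversePhase b ((1 - θ) * T)) (𝓝[<] 1)
      (𝓝 0) := by
    refine squeeze_zero_norm (a := fun θ => |(1 - θ) * T|) (fun θ => ?_) ?_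
    · rw [norm_mul, norm_inversePhase, mul_one, Complex.norm_real, Real.norm_eq_abs]
    · simpa using h2.abs
  have h5 := ((h3.sub ((tendsto_const_nhds (x := (T : ℂ) * inversePhase b T)).sub h4)).const_mul (1 / (Complex.I * (b : ℂ)))).const_mul
    (1 / (2 * Complex.I))
  rw [sub_zero] at h5
  refine h5.congr' ?_
  filter_upwards [self_mem_nhdsWithin] with θ hθ
  exact (h1 θ hθ).symm

/-- The closed form is bounded. A difference of two values is again the integral of `e^{ib/v}/v`,
now over `[r, r']`, where the modulus of the integrand is at most `1/r`. -/
theorem isNice_freeKernelIntegral {ε : ℝ} (hε : ε ^ 2 = 1) (s : ℝ) {ρ : ℝ} (hρ : 0 < ρ) (R : ℝ) :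
    IsNice R fun r => freeKernelIntegral s (s + ε * r) ρ := by
  set b := ε * (ρ ^ 2 / 4) with hbdef
  have hε0 : ε ≠ 0 := by rintro rfl; norm_num at hε
  have hb : b ≠ 0 := mul_ne_zero hε0 (by positivity)
  have h2 : ‖1 / (2 * Complex.I)‖ = 1 / 2 := by simp
  refine IsNice.of_le (M := 1 / 2 * (1 / |b| * (R + R))) (C := 1) (fun r hr => ?_)
    fun r r' h0 h1 h2' => ?_
  · rw [freeKernelIntegral_eq hε s hρ hr.1, norm_mul, h2, norm_mul, norm_div, norm_one, norm_mul,
      Complex.norm_I, one_mul, Complex.norm_real, Real.norm_eq_abs]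
    refine mul_le_mul_of_nonneg_left (mul_le_mul_of_nonneg_left ?_ (by positivity)) (by norm_num)
    refine (norm_sub_le _ _).trans (add_le_add ?_ ?_)
    · have := intervalIntegral.norm_integral_le_of_norm_le_const (a := 0) (b := r) (C := 1)
        (f := inversePhase b) fun v _ => (norm_inversePhase b v).le
      rw [one_mul, sub_zero, abs_of_pos hr.1] at this
      exact this.trans hr.2
    · rw [norm_mul, norm_inversePhase, mul_one, Complex.norm_real, Real.norm_of_nonneg hr.1.le]
      exact hr.2
  · have hr' : 0 < r' := h0.trans h1
    have hsplit : freeKernelIntegral s (s + ε * r') ρ - freeKernelIntegral s (s + ε * r) ρ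
        = 1 / (2 * Complex.I) * ∫ v in r..r', inversePhase b v / v := by
      rw [freeKernelIntegral_eq hε s hρ hr', freeKernelIntegral_eq hε s hρ h0,
        integral_inversePhase_div hb h0 hr', ← intervalIntegral.integral_add_adjacent_intervals
        (intervalIntegrable_inversePhase b 0 r) (intervalIntegrable_inversePhase b r r')]
      ring
    rw [hsplit, norm_mul, h2, one_mul]
    have h3 := intervalIntegral.norm_integral_le_of_norm_le_const (a := r) (b := r') (C := 1 / r)
      (f := fun v : ℝ => inversePhase b v / v) fun v hv => by
        rw [uIoc_of_le h1.le] at hv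
        rw [norm_div, norm_inversePhase, Complex.norm_real, Real.norm_of_nonneg (h0.trans hv.1).le]
        exact one_div_le_one_div_of_le h0 hv.1.le
    rw [abs_of_pos (sub_pos.2 h1), one_div_mul_eq_div] at h3
    have h4 : 0 ≤ (r' - r) / r := div_nonneg (by linarith) h0.le
    have h5 := Real.sqrt_nonneg (r' - r)
    linarith

end PointInteraction

/-! ### Radial profile of the propagated resolvent kernel -/

namespace PointInteraction

theorem integrableOn_inv_add_sq {σ : ℝ} (hσ : 0 < σ) :
    IntegrableOn (fun u => ((u + σ) ^ 2)⁻¹) (Ioi 0) ∧ ∫ u in Ioi 0, ((u + σ) ^ 2)⁻¹ = σ⁻¹ := by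
  have hd : ∀ u ∈ Ici (0 : ℝ), HasDerivAt (fun u => -(u + σ)⁻¹) (((u + σ) ^ 2)⁻¹) u := by
    intro u hu
    have hu : 0 ≤ u := hu
    have h := ((hasDerivAt_id u).add_const σ).inv (by simp only [id]; linarith)
    refine h.neg.congr_deriv ?_
    simp only [id]; ring
  have hn : ∀ u ∈ Ioi (0 : ℝ), 0 ≤ ((u + σ) ^ 2)⁻¹ := fun u _ => by positivity
  have ht : Tendsto (fun u => -(u + σ)⁻¹) atTop (𝓝 0) := by
    have := (tendsto_inv_atTop_zero.comp (tendsto_atTop_add_const_right atTop σ tendsto_id)).neg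
    simpa [Function.comp_def] using this
  refine ⟨integrableOn_Ioi_deriv_of_nonneg' hd hn ht, ?_⟩
  rw [integral_Ioi_of_hasDerivAt_of_nonneg' hd hn ht]
  simp

theorem integrableOn_exp_neg_mul {b : ℝ} (hb : 0 < b) :
    IntegrableOn (fun u => Real.exp (-(b * u))) (Ioi 0) ∧
      ∫ u in Ioi 0, Real.exp (-(b * u)) = b⁻¹ := by
  have h : ∀ u, Real.exp (-(b * u)) = Real.exp (-b * u) := fun u => by rw [neg_mul]
  simp only [h]
  refine ⟨integrableOn_exp_mul_Ioi (neg_neg_iff_pos.2 hb) 0, ?_⟩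
  rw [integral_exp_mul_Ioi (neg_neg_iff_pos.2 hb)]
  simp

/-- The point `u + iτ`. -/
noncomputable def complexTime (τ u : ℝ) : ℂ := u + τ * Complex.I

theorem complexTime_re (τ u : ℝ) : (complexTime τ u).re = u := by simp [complexTime]

theorem normSq_complexTime (τ u : ℝ) : Complex.normSq (complexTime τ u) = u ^ 2 + τ ^ 2 := by
  rw [complexTime, Complex.normSq_add_mul_I]

theorem norm_complexTime (τ u : ℝ) : ‖complexTime τ u‖ = √(u ^ 2 + τ ^ 2) := by
  rw [Complex.norm_def, normSq_complexTime]

theorem abs_le_norm_complexTime (τ u : ℝ) : |τ| ≤ ‖complexTime τ u‖ := by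
  rw [norm_complexTime]
  exact Real.abs_le_sqrt (by nlinarith [sq_nonneg u])

theorem le_norm_complexTime (τ u : ℝ) : u ≤ ‖complexTime τ u‖ := by
  rw [norm_complexTime]
  exact (le_abs_self u).trans (Real.abs_le_sqrt (by nlinarith [sq_nonneg τ]))

theorem add_le_norm_complexTime {τ u : ℝ} : (u + |τ|) / 2 ≤ ‖complexTime τ u‖ := by
  linarith [abs_le_norm_complexTime τ u, le_norm_complexTime τ u]

theorem complexTime_ne_zero_of_ne {τ : ℝ} (hτ : τ ≠ 0) (u : ℝ) : complexTime τ u ≠ 0 :=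
  norm_pos_iff.1 ((abs_pos.2 hτ).trans_le (abs_le_norm_complexTime τ u))

theorem complexTime_ne_zero_of_pos (τ : ℝ) {u : ℝ} (hu : 0 < u) : complexTime τ u ≠ 0 :=
  norm_pos_iff.1 (hu.trans_le (le_norm_complexTime τ u))

theorem continuous_complexTime (τ : ℝ) : Continuous (complexTime τ) := by
  unfold complexTime; fun_prop

theorem hasDerivAt_complexTime (τ u : ℝ) : HasDerivAt (fun τ => complexTime τ u) Complex.I τ := by
  have h0 : HasDerivAt (fun r : ℝ => (r : ℂ)) 1 τ := Complex.ofRealCLM.hasDerivAt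
  have h1 := (h0.mul_const Complex.I).const_add (u : ℂ)
  rw [one_mul] at h1
  exact h1

/-- The radial profile `e^{-a/z}/z` of the heat kernel at complex time. -/
noncomputable def heatProfile (a : ℝ) (z : ℂ) : ℂ := Complex.exp (-(a : ℂ) / z) / z

/-- The derivative of `heatProfile`. -/
noncomputable def heatProfileDeriv (a : ℝ) (z : ℂ) : ℂ :=
  Complex.exp (-(a : ℂ) / z) * (a / z ^ 3 - 1 / z ^ 2)

theorem hasDerivAt_heatProfile (a : ℝ) {z : ℂ} (hz : z ≠ 0) :
    HasDerivAt (heatProfile a) (heatProfileDeriv a z) z := by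
  have h1 : HasDerivAt (fun z : ℂ => -(a : ℂ) / z) (a / z ^ 2) z := by
    simpa [div_eq_mul_inv] using (hasDerivAt_inv hz).const_mul (-(a : ℂ))
  refine (h1.cexp.div (hasDerivAt_id z) hz).congr_deriv ?_
  simp only [id, heatProfileDeriv]
  field_simp

theorem norm_exp_neg_div_complexTime (a τ u : ℝ) :
    ‖Complex.exp (-(a : ℂ) / complexTime τ u)‖ = Real.exp (-(a * u / (u ^ 2 + τ ^ 2))) := by
  rw [Complex.norm_exp]
  congr 1
  rw [← Complex.ofReal_neg, div_eq_mul_inv, Complex.re_ofReal_mul, Complex.inv_re, complexTime_re,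
    normSq_complexTime]
  ring

theorem norm_exp_neg_div_complexTime_le {a u : ℝ} (ha : 0 ≤ a) (hu : 0 ≤ u) (τ : ℝ) :
    ‖Complex.exp (-(a : ℂ) / complexTime τ u)‖ ≤ 1 := by
  rw [norm_exp_neg_div_complexTime, Real.exp_le_one_iff, neg_nonpos]
  positivity

theorem measurable_heatProfile (a τ : ℝ) : Measurable fun u => heatProfile a (complexTime τ u) := by
  unfold heatProfile
  have := (continuous_complexTime τ).measurable
  fun_prop

theorem measurable_heatProfileDeriv (a τ : ℝ) :
    Measurable fun u => heatProfileDeriv a (complexTime τ u) := by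
  unfold heatProfileDeriv
  have := (continuous_complexTime τ).measurable
  fun_prop

theorem norm_heatProfile_le {a u : ℝ} (ha : 0 ≤ a) (hu : 0 ≤ u) (τ : ℝ) :
    ‖heatProfile a (complexTime τ u)‖ ≤ 1 / ‖complexTime τ u‖ := by
  rw [heatProfile, norm_div]
  exact div_le_div_of_nonneg_right (norm_exp_neg_div_complexTime_le ha hu τ) (norm_nonneg _)

theorem norm_heatProfile_le_abs {a u τ : ℝ} (ha : 0 ≤ a) (hu : 0 ≤ u) (hτ : τ ≠ 0) :
    ‖heatProfile a (complexTime τ u)‖ ≤ 1 / |τ| :=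
  (norm_heatProfile_le ha hu τ).trans
    (one_div_le_one_div_of_le (abs_pos.2 hτ) (abs_le_norm_complexTime τ u))

theorem norm_heatProfileDeriv_le {a u τ : ℝ} (ha : 0 ≤ a) :
    ‖heatProfileDeriv a (complexTime τ u)‖
      ≤ Real.exp (-(a * u / (u ^ 2 + τ ^ 2))) *
        (a / ‖complexTime τ u‖ ^ 3 + 1 / ‖complexTime τ u‖ ^ 2) := by
  rw [heatProfileDeriv, norm_mul, norm_exp_neg_div_complexTime]
  refine mul_le_mul_of_nonneg_left ((norm_sub_le _ _).trans (le_of_eq ?_)) (Real.exp_pos _).le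
  rw [norm_div, norm_div, norm_pow, norm_pow, norm_one, Complex.norm_real, Real.norm_of_nonneg ha]

theorem exp_neg_le_inv {x : ℝ} (hx : 0 < x) : Real.exp (-x) ≤ 1 / x := by
  rw [Real.exp_neg, ← one_div]
  exact one_div_le_one_div_of_le hx (by linarith [Real.add_one_le_exp x])

theorem exp_neg_le_inv_sq {x : ℝ} (hx : 0 < x) : Real.exp (-x) ≤ 2 / x ^ 2 := by
  rw [Real.exp_neg, inv_eq_one_div, div_le_div_iff₀ (Real.exp_pos x) (by positivity)]
  linarith [Real.quadratic_le_exp_of_nonneg hx.le]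

theorem exp_ratio_le_of_le {a u σ : ℝ} (ha : 0 ≤ a) (hu : 0 < u) (h : u ≤ |σ|) :
    Real.exp (-(a * u / (u ^ 2 + σ ^ 2))) ≤ Real.exp (-(a / (2 * σ ^ 2) * u)) := by
  have hσ : u ^ 2 ≤ σ ^ 2 := by rw [← sq_abs σ]; gcongr
  refine Real.exp_le_exp.2 (neg_le_neg ?_)
  rw [div_mul_eq_mul_div]
  exact div_le_div_of_nonneg_left (by positivity) (by positivity) (by linarith)

theorem exp_ratio_le_of_ge {a u σ : ℝ} (ha : 0 ≤ a) (hu : 0 < u) (h : |σ| ≤ u) :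
    Real.exp (-(a * u / (u ^ 2 + σ ^ 2))) ≤ Real.exp (-(a / (2 * u))) := by
  have hσ : σ ^ 2 ≤ u ^ 2 := by rw [← sq_abs σ]; gcongr
  refine Real.exp_le_exp.2 (neg_le_neg ?_)
  have : a / (2 * u) = a * u / (u ^ 2 + u ^ 2) := by field_simp; ring
  rw [this]
  exact div_le_div_of_nonneg_left (by positivity) (by positivity) (by linarith)

/-- Each term, integrated against `e^{-lam u}`, must be `O(1/|σ|)`. The bare bound `a/|σ|³` is too
large for `u ≤ |σ|`, but the damping `e^{-au/(2σ²)}` brings its integral to `2/|σ|`. For `u > |σ|`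
the damping is `e^{-a/(2u)} ≤ 8u²/a²`, and the term without `a` decays like `(u + |σ|)⁻²`. -/
theorem norm_heatProfileDeriv_le' {a u σ : ℝ} (ha : 0 ≤ a) (hu : 0 < u) (hσ : σ ≠ 0) :
    ‖heatProfileDeriv a (complexTime σ u)‖
      ≤ a / |σ| ^ 3 * Real.exp (-(a / (2 * σ ^ 2) * u)) + 8 / (a * |σ|)
        + 4 * ((u + |σ|) ^ 2)⁻¹ := by
  have hσ' : 0 < |σ| := abs_pos.2 hσ
  have hz := abs_le_norm_complexTime σ u
  have hz1 := le_norm_complexTime σ u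
  have hz2 := add_le_norm_complexTime (τ := σ) (u := u)
  refine (norm_heatProfileDeriv_le ha).trans ?_
  set Z := ‖complexTime σ u‖
  have hZ : 0 < Z := hσ'.trans_le hz
  rw [mul_add]
  refine add_le_add ?_ ?_
  · rcases le_or_gt u |σ| with h | h
    · have h1 := exp_ratio_le_of_le ha hu h
      have h2 : a / Z ^ 3 ≤ a / |σ| ^ 3 := by gcongr
      have h3 : 0 ≤ 8 / (a * |σ|) := by positivity
      calc _ ≤ Real.exp (-(a / (2 * σ ^ 2) * u)) * (a / |σ| ^ 3) := by gcongr
        _ ≤ _ := by rw [mul_comm]; linarith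
    · have h1 := exp_ratio_le_of_ge ha hu h.le
      have h3 : 0 ≤ a / |σ| ^ 3 * Real.exp (-(a / (2 * σ ^ 2) * u)) := by positivity
      refine le_trans ?_ (le_add_of_nonneg_left h3)
      -- At `a = 0` the quotient `8/(a|σ|)` is `0` by convention, and so is the term it has to
      -- dominate; the estimate thus also covers the profile at the centre itself.
      rcases ha.eq_or_lt with rfl | ha'
      · simp
      have h4 : a / Z ^ 3 ≤ a / (|σ| * u ^ 2) := by
        refine div_le_div_of_nonneg_left ha (by positivity) ?_
        calc |σ| * u ^ 2 ≤ Z * Z ^ 2 := by gcongr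
          _ = Z ^ 3 := by ring
      calc _ ≤ Real.exp (-(a / (2 * u))) * (a / (|σ| * u ^ 2)) := by gcongr
        _ ≤ 2 / (a / (2 * u)) ^ 2 * (a / (|σ| * u ^ 2)) := by
          gcongr
          exact exp_neg_le_inv_sq (by positivity)
        _ = _ := by field_simp; norm_num
  · have h1 : Real.exp (-(a * u / (u ^ 2 + σ ^ 2))) ≤ 1 := by
      rw [Real.exp_le_one_iff, neg_nonpos]; positivity
    calc _ ≤ 1 * (1 / ((u + |σ|) / 2) ^ 2) := by gcongr
      _ = _ := by field_simp; norm_num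

/-- The integral `∫₀^∞ e^{-lam u} e^{-a/(u+iτ)}/(u+iτ) du`, which is a radial function of `x`
for `a = |x|²/4`. -/
noncomputable def resolventProfile (lam τ a : ℝ) : ℂ :=
  ∫ u in Ioi (0 : ℝ), (Real.exp (-(lam * u)) : ℂ) * heatProfile a (complexTime τ u)

theorem integrableOn_heatProfile {lam τ a : ℝ} (hlam : 0 < lam) (hτ : τ ≠ 0) (ha : 0 ≤ a) :
    IntegrableOn (fun u => (Real.exp (-(lam * u)) : ℂ) * heatProfile a (complexTime τ u))
      (Ioi 0) := by
  refine Integrable.mono' ((integrableOn_exp_neg_mul hlam).1.mul_const (1 / |τ|)) ?_ ?_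
  · have := measurable_heatProfile a τ
    exact Measurable.aestronglyMeasurable (by fun_prop)
  · filter_upwards [ae_restrict_mem measurableSet_Ioi] with u hu
    rw [norm_mul, Complex.norm_real, Real.norm_of_nonneg (Real.exp_pos _).le]
    exact mul_le_mul_of_nonneg_left (norm_heatProfile_le_abs ha (le_of_lt hu) hτ)
      (Real.exp_pos _).le

theorem continuousOn_resolventProfile {lam τ : ℝ} (hlam : 0 < lam) (hτ : τ ≠ 0) :
    ContinuousOn (resolventProfile lam τ) (Ici 0) := by
  refine continuousOn_of_dominated (bound := fun u => Real.exp (-(lam * u)) * (1 / |τ|)) ?_ ?_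
    ((integrableOn_exp_neg_mul hlam).1.mul_const _) ?_
  · intro a _
    have := measurable_heatProfile a τ
    exact Measurable.aestronglyMeasurable (by fun_prop)
  · intro a ha
    filter_upwards [ae_restrict_mem measurableSet_Ioi] with u hu
    rw [norm_mul, Complex.norm_real, Real.norm_of_nonneg (Real.exp_pos _).le]
    exact mul_le_mul_of_nonneg_left (norm_heatProfile_le_abs ha (le_of_lt hu) hτ)
      (Real.exp_pos _).le
  · refine Eventually.of_forall fun u => Continuous.continuousOn ?_
    unfold heatProfile
    fun_prop

theorem hasDerivAt_resolventProfile {lam τ a : ℝ} (hlam : 0 < lam) (hτ : τ ≠ 0) (ha : 0 ≤ a) :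
    HasDerivAt (fun τ => resolventProfile lam τ a)
      (∫ u in Ioi (0 : ℝ), (Real.exp (-(lam * u)) : ℂ) *
        (heatProfileDeriv a (complexTime τ u) * Complex.I)) τ := by
  have hτ' := abs_pos.2 hτ
  have hball : ∀ x ∈ Metric.ball τ (|τ| / 2), |τ| / 2 ≤ |x| := by
    intro x hx
    rw [Metric.mem_ball, Real.dist_eq] at hx
    have := abs_sub_abs_le_abs_sub τ x
    rw [abs_sub_comm] at this
    linarith
  refine (hasDerivAt_integral_of_dominated_loc_of_deriv_le
    (F := fun τ u => (Real.exp (-(lam * u)) : ℂ) * heatProfile a (complexTime τ u))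
    (F' := fun τ u => (Real.exp (-(lam * u)) : ℂ) *
      (heatProfileDeriv a (complexTime τ u) * Complex.I))
    (bound := fun u => Real.exp (-(lam * u)) * (a / (|τ| / 2) ^ 3 + 1 / (|τ| / 2) ^ 2))
    (Metric.ball_mem_nhds τ (half_pos hτ')) ?_ (integrableOn_heatProfile hlam hτ ha) ?_ ?_
    ((integrableOn_exp_neg_mul hlam).1.mul_const _) ?_).2
  · refine Eventually.of_forall fun x => ?_
    have := measurable_heatProfile a x
    exact Measurable.aestronglyMeasurable (by fun_prop)
  · have := measurable_heatProfileDeriv a τ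
    exact Measurable.aestronglyMeasurable (by fun_prop)
  · filter_upwards [ae_restrict_mem measurableSet_Ioi] with u hu x hx
    rw [norm_mul, Complex.norm_real, Real.norm_of_nonneg (Real.exp_pos _).le, norm_mul,
      Complex.norm_I, mul_one]
    refine mul_le_mul_of_nonneg_left ((norm_heatProfileDeriv_le ha).trans ?_) (Real.exp_pos _).le
    have h1 : Real.exp (-(a * u / (u ^ 2 + x ^ 2))) ≤ 1 := by
      have : 0 < u := hu
      rw [Real.exp_le_one_iff, neg_nonpos]; positivity
    have h2 := (hball x hx).trans (abs_le_norm_complexTime x u)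
    calc _ ≤ 1 * (a / (|τ| / 2) ^ 3 + 1 / (|τ| / 2) ^ 2) := by gcongr
      _ = _ := one_mul _
  · filter_upwards [ae_restrict_mem measurableSet_Ioi] with u hu x hx
    exact ((hasDerivAt_heatProfile a (complexTime_ne_zero_of_pos x hu)).comp x
      (hasDerivAt_complexTime x u)).const_mul _

theorem norm_deriv_resolventProfile_le {lam τ a : ℝ} (hlam : 0 < lam) (hτ : τ ≠ 0) (ha : 0 ≤ a) :
    ‖∫ u in Ioi (0 : ℝ), (Real.exp (-(lam * u)) : ℂ) *
        (heatProfileDeriv a (complexTime τ u) * Complex.I)‖ ≤ (6 + 8 / (a * lam)) / |τ| := by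
  have hτ' := abs_pos.2 hτ
  have h1 : IntegrableOn (fun u => a / |τ| ^ 3 * Real.exp (-(a / (2 * τ ^ 2) * u))) (Ioi 0) ∧
      ∫ u in Ioi 0, a / |τ| ^ 3 * Real.exp (-(a / (2 * τ ^ 2) * u)) ≤ 2 / |τ| := by
    rcases ha.eq_or_lt with rfl | ha'
    · simp; positivity
    · have h := integrableOn_exp_neg_mul (show 0 < a / (2 * τ ^ 2) by positivity)
      refine ⟨h.1.const_mul _, ?_⟩
      rw [integral_const_mul, h.2, ← sq_abs τ]
      refine le_of_eq ?_
      field_simp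
  have h2 := integrableOn_exp_neg_mul hlam
  have h3 := integrableOn_inv_add_sq hτ'
  have hb : ∀ᵐ u ∂(volume.restrict (Ioi (0 : ℝ))), ‖(Real.exp (-(lam * u)) : ℂ) *
        (heatProfileDeriv a (complexTime τ u) * Complex.I)‖
      ≤ a / |τ| ^ 3 * Real.exp (-(a / (2 * τ ^ 2) * u)) + (8 / (a * |τ|) * Real.exp (-(lam * u))
        + 4 * ((u + |τ|) ^ 2)⁻¹) := by
    filter_upwards [ae_restrict_mem measurableSet_Ioi] with u hu
    have hu : 0 < u := hu
    rw [norm_mul, Complex.norm_real, Real.norm_of_nonneg (Real.exp_pos _).le, norm_mul,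
      Complex.norm_I, mul_one]
    have he : Real.exp (-(lam * u)) ≤ 1 := by
      rw [Real.exp_le_one_iff, neg_nonpos]; positivity
    have he0 := Real.exp_pos (-(lam * u))
    refine (mul_le_mul_of_nonneg_left (norm_heatProfileDeriv_le' ha hu hτ) he0.le).trans ?_
    have h4 : 0 ≤ a / |τ| ^ 3 * Real.exp (-(a / (2 * τ ^ 2) * u)) := by positivity
    have h5 : 0 ≤ 4 * ((u + |τ|) ^ 2)⁻¹ := by positivity
    nlinarith
  refine (norm_integral_le_of_norm_le (h1.1.add ((h2.1.const_mul _).add (h3.1.const_mul _)))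
    hb).trans ?_
  rw [integral_add' h1.1 ((h2.1.const_mul _).add (h3.1.const_mul _)),
    integral_add' (h2.1.const_mul _) (h3.1.const_mul _), integral_const_mul (8 / (a * |τ|)),
    integral_const_mul (4 : ℝ), h2.2,
    h3.2]
  have h4 : (6 + 8 / (a * lam)) / |τ| = 2 / |τ| + (8 / (a * |τ|) * lam⁻¹ + 4 * |τ|⁻¹) := by
    rw [add_div, div_div, div_mul_eq_mul_div, div_eq_mul_inv 6]
    have : 8 / (a * lam * |τ|) = 8 * lam⁻¹ / (a * |τ|) := by
      rw [div_eq_mul_inv, div_eq_mul_inv, mul_inv, mul_inv, mul_inv]; ring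
    rw [this]; ring
  rw [h4]
  linarith [h1.2]

theorem norm_resolventProfile_sub_le {ε lam a : ℝ} (hε : ε ^ 2 = 1) (hlam : 0 < lam) (ha : 0 ≤ a)
    {r r' : ℝ} (h0 : 0 < r) (h1 : r < r') :
    ‖resolventProfile lam (ε * r') a - resolventProfile lam (ε * r) a‖
      ≤ (6 + 8 / (a * lam)) * ((r' - r) / r) := by
  have hε1 : |ε| = 1 := abs_eq_one_of_sq_eq_one hε
  have hε0 : ε ≠ 0 := by rintro rfl; simp at hε
  have hC : 0 ≤ 6 + 8 / (a * lam) := by positivity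
  have h := Convex.norm_image_sub_le_of_norm_hasDerivWithin_le
    (f := fun r => resolventProfile lam (ε * r) a)
    (f' := fun r => ε • ∫ u in Ioi (0 : ℝ), (Real.exp (-(lam * u)) : ℂ) *
        (heatProfileDeriv a (complexTime (ε * r) u) * Complex.I))
    (s := Icc r r') (C := (6 + 8 / (a * lam)) / r) (fun x hx => ?_) (fun x hx => ?_)
    (convex_Icc _ _) (left_mem_Icc.2 h1.le) (right_mem_Icc.2 h1.le)
  · refine h.trans (le_of_eq ?_)
    rw [Real.norm_of_nonneg (sub_pos.2 h1).le]; ring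
  · have hx0 : x ≠ 0 := (h0.trans_le hx.1).ne'
    have hd := hasDerivAt_resolventProfile hlam (mul_ne_zero hε0 hx0) ha
    have hm : HasDerivAt (fun x => ε * x) ε x := by simpa using (hasDerivAt_id x).const_mul ε
    exact (hd.scomp x hm).hasDerivWithinAt
  · have hx0 : 0 < x := h0.trans_le hx.1
    rw [norm_smul, Real.norm_eq_abs, hε1, one_mul]
    refine (norm_deriv_resolventProfile_le hlam (mul_ne_zero hε0 hx0.ne') ha).trans ?_
    rw [abs_mul, hε1, one_mul, abs_of_pos hx0]
    exact div_le_div_of_nonneg_left hC h0 hx.1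

/-- The bound is uniform as `τ → 0`. For `u ≤ |τ|` one has `1/|τ| ≤ 4|τ|/(u + |τ|)²`, which
integrates to a constant; for `u > |τ|` the damping `e^{-a/(2u)} ≤ 2u/a` cancels the factor `1/u`.
This needs `a > 0`, that is, a point away from the centre. -/
theorem norm_resolventProfile_le {lam τ a : ℝ} (hlam : 0 < lam) (hτ : τ ≠ 0) (ha : 0 < a) :
    ‖resolventProfile lam τ a‖ ≤ 4 + 2 / a * lam⁻¹ := by
  have hτ' := abs_pos.2 hτ
  have h2 := integrableOn_exp_neg_mul hlam
  have h3 := integrableOn_inv_add_sq hτ'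
  have hb : ∀ᵐ u ∂(volume.restrict (Ioi (0 : ℝ))),
      ‖(Real.exp (-(lam * u)) : ℂ) * heatProfile a (complexTime τ u)‖
      ≤ 4 * |τ| * ((u + |τ|) ^ 2)⁻¹ + 2 / a * Real.exp (-(lam * u)) := by
    filter_upwards [ae_restrict_mem measurableSet_Ioi] with u hu
    have hu : 0 < u := hu
    rw [norm_mul, Complex.norm_real, Real.norm_of_nonneg (Real.exp_pos _).le]
    have he : Real.exp (-(lam * u)) ≤ 1 := by
      rw [Real.exp_le_one_iff, neg_nonpos]; positivity
    have he0 := Real.exp_pos (-(lam * u))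
    have hA : 0 ≤ 4 * |τ| * ((u + |τ|) ^ 2)⁻¹ := by positivity
    have hB : 0 ≤ 2 / a * Real.exp (-(lam * u)) := by positivity
    rcases le_or_gt u |τ| with h | h
    · refine le_trans ?_ (le_add_of_nonneg_right hB)
      have h4 := norm_heatProfile_le_abs ha.le hu.le hτ
      refine (mul_le_mul he h4 (norm_nonneg _) zero_le_one).trans ?_
      rw [one_mul, ← div_eq_mul_inv, div_le_div_iff₀ hτ' (by positivity)]
      nlinarith
    · refine le_trans ?_ (le_add_of_nonneg_left hA)
      rw [mul_comm]
      refine mul_le_mul_of_nonneg_right ?_ he0.le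
      rw [heatProfile, norm_div, norm_exp_neg_div_complexTime]
      have h5 := exp_ratio_le_of_ge ha.le hu h.le
      have h6 := le_norm_complexTime τ u
      calc _ ≤ (1 / (a / (2 * u))) / u := by
            gcongr
            exact h5.trans (exp_neg_le_inv (by positivity))
        _ = _ := by field_simp
  refine (norm_integral_le_of_norm_le ((h3.1.const_mul _).add (h2.1.const_mul _)) hb).trans ?_
  rw [integral_add' (h3.1.const_mul _) (h2.1.const_mul _), integral_const_mul, integral_const_mul,
    h2.2, h3.2]
  refine le_of_eq ?_
  field_simp

/-- At the centre the profile diverges like `-log r`. The logarithm is isolated by comparing `1/(u +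
iεr)` with `1/(u + r)` on `(0, 1]`, whose integral is `log(1 + r) - log r`. In the bound `lam` comes
from `|e^{-lam u} - 1| ≤ lam u`, `8` from the difference of the two fractions, `lam⁻¹` from `u > 1`
and `r` from `log(1 + r)`. -/
theorem norm_resolventProfile_zero_add_log_le {ε lam r : ℝ} (hε : ε ^ 2 = 1) (hlam : 0 < lam)
    (hr : 0 < r) :
    ‖resolventProfile lam (ε * r) 0 + Real.log r‖ ≤ lam + 8 + lam⁻¹ + r := by
  have hε1 : |ε| = 1 := abs_eq_one_of_sq_eq_one hε
  have hε0 : ε ≠ 0 := by rintro rfl; simp at hε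
  have hτ : ε * r ≠ 0 := mul_ne_zero hε0 hr.ne'
  have hτr : |ε * r| = r := by rw [abs_mul, hε1, one_mul, abs_of_pos hr]
  have h2 := integrableOn_exp_neg_mul hlam
  have h3 := integrableOn_inv_add_sq hr
  have h4 : IntegrableOn (fun u : ℝ => (u + r)⁻¹) (Ioc 0 1) := by
    refine (ContinuousOn.integrableOn_Icc ?_).mono_set Ioc_subset_Icc_self
    exact (continuousOn_id.add continuousOn_const).inv₀ fun u hu =>
      (add_pos_of_nonneg_of_pos hu.1 hr).ne'
  have h5 : IntegrableOn ((Ioc 0 1).indicator fun u : ℝ => ((u + r)⁻¹ : ℝ)) (Ioi 0) :=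
    ((integrable_indicator_iff measurableSet_Ioc).2 h4).integrableOn
  have h6 : ∫ u in Ioi (0 : ℝ), (Ioc 0 1).indicator (fun u : ℝ => ((u + r)⁻¹ : ℝ)) u
      = Real.log (1 + r) - Real.log r := by
    rw [setIntegral_indicator measurableSet_Ioc, inter_eq_right.2 Ioc_subset_Ioi_self,
      ← intervalIntegral.integral_of_le zero_le_one,
      intervalIntegral.integral_comp_add_right (fun u => u⁻¹), zero_add,
      integral_inv_of_pos hr (by linarith), Real.log_div (by linarith) hr.ne']
  have h7 : IntegrableOn ((Ioc 0 1).indicator fun _ : ℝ => lam) (Ioi 0) :=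
    ((integrable_indicator_iff measurableSet_Ioc).2 (by simp)).integrableOn
  have h8 : ∫ u in Ioi (0 : ℝ), (Ioc 0 1).indicator (fun _ : ℝ => lam) u = lam := by
    rw [setIntegral_indicator measurableSet_Ioc, inter_eq_right.2 Ioc_subset_Ioi_self]
    simp
  have hsplit : resolventProfile lam (ε * r) 0 + Real.log r
      = (∫ u in Ioi (0 : ℝ), ((Real.exp (-(lam * u)) : ℂ) * heatProfile 0 (complexTime (ε * r) u)
        - (((Ioc 0 1).indicator (fun u : ℝ => (u + r)⁻¹) u : ℝ) : ℂ))) + Real.log (1 + r) := by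
    have h5' : IntegrableOn (fun u => (((Ioc 0 1).indicator (fun u : ℝ => (u + r)⁻¹) u : ℝ) : ℂ))
      (Ioi 0) := h5.ofReal
    rw [integral_sub (integrableOn_heatProfile hlam hτ le_rfl) h5', integral_complex_ofReal, h6,
      resolventProfile]
    push_cast
    ring
  have hb : ∀ᵐ u ∂(volume.restrict (Ioi (0 : ℝ))),
      ‖(Real.exp (-(lam * u)) : ℂ) * heatProfile 0 (complexTime (ε * r) u)
        - (((Ioc 0 1).indicator (fun u : ℝ => (u + r)⁻¹) u : ℝ) : ℂ)‖
      ≤ (Ioc 0 1).indicator (fun _ : ℝ => lam) u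
        + (8 * r * ((u + r) ^ 2)⁻¹ + Real.exp (-(lam * u))) := by
    filter_upwards [ae_restrict_mem measurableSet_Ioi] with u hu
    have hu : 0 < u := hu
    have he0 := Real.exp_pos (-(lam * u))
    have he : Real.exp (-(lam * u)) ≤ 1 := by
      rw [Real.exp_le_one_iff, neg_nonpos]; positivity
    have he' : |Real.exp (-(lam * u)) - 1| ≤ lam * u := by
      rw [abs_sub_comm, abs_of_nonneg (by linarith)]
      linarith [Real.add_one_le_exp (-(lam * u))]
    have hp : heatProfile 0 (complexTime (ε * r) u) = 1 / complexTime (ε * r) u := by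
      simp [heatProfile]
    have hz1 := le_norm_complexTime (ε * r) u
    have hz2 := add_le_norm_complexTime (τ := ε * r) (u := u)
    rw [hτr] at hz2
    have hz0 := complexTime_ne_zero_of_pos (ε * r) hu
    rw [hp]
    by_cases h1 : u ≤ 1
    · rw [indicator_of_mem (show u ∈ Ioc (0 : ℝ) 1 from ⟨hu, h1⟩),
        indicator_of_mem (show u ∈ Ioc (0 : ℝ) 1 from ⟨hu, h1⟩)]
      have hur : ((u : ℂ) + r) ≠ 0 := by
        have : u + r ≠ 0 := by linarith
        exact_mod_cast this
      have heq : (Real.exp (-(lam * u)) : ℂ) * (1 / complexTime (ε * r) u) - ((u + r)⁻¹ : ℝ)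
          = ((Real.exp (-(lam * u)) - 1 : ℝ) : ℂ) / complexTime (ε * r) u
            + (r - (ε * r : ℝ) * Complex.I) / (complexTime (ε * r) u * (u + r)) := by
        have hct : complexTime (ε * r) u = u + (ε * r : ℝ) * Complex.I := rfl
        have : ((u : ℂ) + r) - complexTime (ε * r) u = r - (ε * r : ℝ) * Complex.I := by
          rw [hct]; ring
        rw [← this]
        push_cast
        field_simp
        ring
      rw [heq]
      refine (norm_add_le _ _).trans (add_le_add ?_ ?_)
      · rw [norm_div, Complex.norm_real, Real.norm_eq_abs]
        rw [div_le_iff₀ (norm_pos_iff.2 hz0)]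
        exact he'.trans (by gcongr)
      · refine le_trans ?_ (le_add_of_nonneg_right he0.le)
        have hn1 : ‖(r : ℂ) - (ε * r : ℝ) * Complex.I‖ ≤ 2 * r := by
          refine (norm_sub_le _ _).trans ?_
          rw [norm_mul, Complex.norm_I, Complex.norm_real, Complex.norm_real, Real.norm_eq_abs,
            Real.norm_eq_abs, hτr, abs_of_pos hr]
          linarith
        have hn2 : ‖(u : ℂ) + r‖ = u + r := by
          rw [← Complex.ofReal_add, Complex.norm_real, Real.norm_of_nonneg (by linarith)]
        rw [norm_div, norm_mul, hn2]
        calc _ ≤ 2 * r / ((u + r) / 2 * (u + r)) := by gcongr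
          _ ≤ _ := by
            rw [← div_eq_mul_inv]
            have : 2 * r / ((u + r) / 2 * (u + r)) = 4 * r / (u + r) ^ 2 := by field_simp; norm_num
            rw [this]
            gcongr
            norm_num
    · have h1' : u ∉ Ioc (0 : ℝ) 1 := fun h => h1 h.2
      rw [indicator_of_notMem h1', indicator_of_notMem h1', Complex.ofReal_zero, sub_zero, zero_add,
        norm_mul, Complex.norm_real, Real.norm_of_nonneg he0.le, norm_div, norm_one]
      refine le_trans ?_ (le_add_of_nonneg_left (by positivity))
      refine mul_le_of_le_one_right he0.le ?_
      rw [div_le_one (norm_pos_iff.2 hz0)]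
      linarith [not_le.1 h1]
  rw [hsplit]
  refine (norm_add_le _ _).trans ?_
  have h9 := norm_integral_le_of_norm_le (h7.add ((h3.1.const_mul _).add h2.1)) hb
  rw [integral_add' h7 ((h3.1.const_mul _).add h2.1), integral_add' (h3.1.const_mul _) h2.1, h8,
    integral_const_mul, h3.2, h2.2, mul_assoc, mul_inv_cancel₀ hr.ne'] at h9
  have h10 : ‖(Real.log (1 + r) : ℂ)‖ ≤ r := by
    rw [Complex.norm_real, Real.norm_of_nonneg (Real.log_nonneg (by linarith))]
    linarith [Real.log_le_sub_one_of_pos (show 0 < 1 + r by linarith)]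
  linarith

theorem isNice_resolventProfile {ε lam a : ℝ} (hε : ε ^ 2 = 1) (hlam : 0 < lam) (ha : 0 < a)
    (R : ℝ) : IsNice R fun r => resolventProfile lam (ε * r) a := by
  have hε0 : ε ≠ 0 := by rintro rfl; simp at hε
  refine IsNice.of_le (C := 6 + 8 / (a * lam))
    (fun r hr => norm_resolventProfile_le hlam (mul_ne_zero hε0 hr.1.ne') ha)
    fun r r' h0 h1 h2 => (norm_resolventProfile_sub_le hε hlam ha.le h0 h1).trans ?_
  have : 0 ≤ 6 + 8 / (a * lam) := by positivity
  refine mul_le_mul_of_nonneg_left ?_ this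
  linarith [Real.sqrt_nonneg (r' - r)]

theorem isNice_resolventProfile_zero_add_log {ε lam : ℝ} (hε : ε ^ 2 = 1) (hlam : 0 < lam) (R : ℝ) :
    IsNice R fun r => resolventProfile lam (ε * r) 0 + Real.log r := by
  -- The constant is `6 + 1`: at `a = 0` the bound `6 + 8/(a lam)` is read as `6` by the division
  -- convention, and the logarithm adds `1`.
  refine IsNice.of_le (M := lam + 8 + lam⁻¹ + R) (C := 7) (fun r hr =>
    (norm_resolventProfile_zero_add_log_le hε hlam hr.1).trans (by linarith [hr.2]))
    fun r r' h0 h1 h2 => ?_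
  have hr' := h0.trans h1
  have h3 := norm_resolventProfile_sub_le hε hlam (le_refl 0) h0 h1
  have h4 : ‖(Real.log r' : ℂ) - Real.log r‖ ≤ (r' - r) / r := by
    rw [← Complex.ofReal_sub, Complex.norm_real, ← Real.log_div hr'.ne' h0.ne',
      Real.norm_of_nonneg (Real.log_nonneg (by rw [le_div_iff₀ h0]; linarith))]
    refine (Real.log_le_sub_one_of_pos (div_pos hr' h0)).trans (le_of_eq ?_)
    field_simp
  have h5 : (6 + 8 / (0 * lam)) * ((r' - r) / r) = 6 * ((r' - r) / r) := by simp
  rw [h5] at h3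
  rw [add_sub_add_comm]
  refine (norm_add_le _ _).trans ?_
  linarith [Real.sqrt_nonneg (r' - r)]

end PointInteraction

/-! ### The free propagator -/

namespace PointInteraction

theorem freeProp_add (t : ℝ) (f g : L2Plane) : freeProp t (f + g) = freeProp t f + freeProp t g := by
  rw [freeProp, FourierAdd.fourier_add, Lp.add_smul, FourierInvAdd.fourierInv_add]
  rfl

theorem freeProp_smul (t : ℝ) (c : ℂ) (f : L2Plane) : freeProp t (c • f) = c • freeProp t f := by
  rw [freeProp, FourierSMul.fourier_smul, ← Lp.smul_comm, FourierInvSMul.fourierInv_smul]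
  rfl

theorem freeProp_zero (t : ℝ) : freeProp t 0 = 0 := by
  simpa using freeProp_smul t 0 0

theorem freeProp_sum (t : ℝ) {ι : Type*} (s : Finset ι) (f : ι → L2Plane) :
    freeProp t (∑ i ∈ s, f i) = ∑ i ∈ s, freeProp t (f i) := by
  classical
  induction s using Finset.induction_on with
  | empty => simpa using freeProp_zero t
  | insert a s ha ih => rw [Finset.sum_insert ha, Finset.sum_insert ha, freeProp_add, ih]

theorem fourier_freeProp (t : ℝ) (f : L2Plane) :
    ((𝓕 (freeProp t f) : L2Plane) : Plane → ℂ) =ᵐ[volume]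
      fun ξ => freeSymbol t ξ * (𝓕 f : L2Plane) ξ := by
  rw [freeProp, FourierInvPair.fourier_fourierInv_eq]
  filter_upwards [Lp.coeFn_lpSMul (r := 2) ((memLp_freeSymbol t).toLp (freeSymbol t)) (𝓕 f),
    (memLp_freeSymbol t).coeFn_toLp] with ξ h1 h2
  rw [h1, Pi.smul_apply', h2, smul_eq_mul]

theorem freeSymbol_eq (t : ℝ) (ξ : Plane) :
    freeSymbol t ξ = Complex.exp ((-(freq ξ * t) : ℝ) * Complex.I) := by
  rw [freeSymbol, freq]
  congr 1
  push_cast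
  ring

theorem norm_freeSymbol (t : ℝ) (ξ : Plane) : ‖freeSymbol t ξ‖ = 1 := by
  rw [freeSymbol_eq, Complex.norm_exp_ofReal_mul_I]

theorem continuous_freeSymbol (t : ℝ) : Continuous (freeSymbol t) := by
  unfold freeSymbol; fun_prop

/-- The tool for identifying an `L²` element known by its Fourier transform with an explicit kernel:
the kernel need only be locally integrable and pair correctly with Schwartz functions. -/
theorem eq_fourierInv_of_fourier_ae_eq {f : L2Plane} {w m : Plane → ℂ} (hf : (𝓕 f : L2Plane) =ᵐ[volume] m)
    (hw : LocallyIntegrable w)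
    (h : ∀ g : 𝓢(Plane, ℂ), ∫ x, (𝓕 g : 𝓢(Plane, ℂ)) x * w x = ∫ x, g x * m x) :
    (f : Plane → ℂ) =ᵐ[volume] w := by
  rw [← FourierPair.fourierInv_fourier_eq (F := L2Plane) f]
  refine fourierInv_ae_eq hw fun g => ?_
  rw [h g]
  refine integral_congr_ae ?_
  filter_upwards [hf] with x hx
  rw [hx]

/-! ### The resolvent kernel and its free evolution -/

/-- The Fourier transform `e^{-2πi⟨ξ, y⟩}/(|p|² + lam)` of the resolvent kernel. -/
noncomputable def resolventSymbol (lam : ℝ) (y ξ : Plane) : ℂ :=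
  planeWave y ξ / ((freq ξ + lam : ℝ) : ℂ)

theorem norm_resolventSymbol {lam : ℝ} (hlam : 0 < lam) (y ξ : Plane) :
    ‖resolventSymbol lam y ξ‖ = 1 / (freq ξ + lam) := by
  rw [resolventSymbol, norm_div, norm_planeWave, Complex.norm_real,
    Real.norm_of_nonneg (by linarith [freq_nonneg ξ])]

theorem continuous_resolventSymbol {lam : ℝ} (hlam : 0 < lam) (y : Plane) :
    Continuous (resolventSymbol lam y) := by
  unfold resolventSymbol
  refine (continuous_planeWave y).div ?_ fun ξ => ?_
  · exact Complex.continuous_ofReal.comp (continuous_freq.add continuous_const)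
  · have : freq ξ + lam ≠ 0 := by linarith [freq_nonneg ξ]
    exact_mod_cast this

theorem memLp_two_iff_lintegral {f : Plane → ℂ} (hf : AEStronglyMeasurable f volume) :
    MemLp f 2 volume ↔ ∫⁻ ξ, ‖f ξ‖ₑ ^ 2 < ∞ := by
  rw [MemLp, and_iff_right hf, eLpNorm_lt_top_iff_lintegral_rpow_enorm_lt_top (by norm_num)
    (by norm_num)]
  simp

theorem memLp_resolventSymbol {lam : ℝ} (hlam : 0 < lam) (y : Plane) :
    MemLp (resolventSymbol lam y) 2 volume := by
  rw [memLp_two_iff_lintegral (continuous_resolventSymbol hlam y).aestronglyMeasurable]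
  have h : ∀ ξ, ‖resolventSymbol lam y ξ‖ₑ ^ 2
      = (fun w : ℝ => ENNReal.ofReal (((w + lam) ^ 2)⁻¹)) (freq ξ) := by
    intro ξ
    rw [← ofReal_norm, norm_resolventSymbol hlam, ← ENNReal.ofReal_pow]
    · simp
    · have := freq_nonneg ξ
      positivity
  rw [lintegral_congr h, lintegral_freq
    (by fun_prop : Measurable fun w : ℝ => ENNReal.ofReal (((w + lam) ^ 2)⁻¹))]
  exact ENNReal.mul_lt_top ENNReal.ofReal_lt_top (integrableOn_inv_add_sq hlam).1.lintegral_lt_top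

/-- The resolvent kernel `(2π)⁻¹ K₀(√lam |x - y|)` as an element of `L²`. -/
noncomputable def resolventL2 {lam : ℝ} (hlam : 0 < lam) (y : Plane) : L2Plane :=
  𝓕⁻ ((memLp_resolventSymbol hlam y).toLp _ : L2Plane)

theorem fourier_resolventL2 {lam : ℝ} (hlam : 0 < lam) (y : Plane) :
    ((𝓕 (resolventL2 hlam y) : L2Plane) : Plane → ℂ) =ᵐ[volume] resolventSymbol lam y := by
  rw [resolventL2, FourierInvPair.fourier_fourierInv_eq]
  exact MemLp.coeFn_toLp _

/-- The kernel of `e^{iτΔ}(-Δ + lam)⁻¹`. -/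
noncomputable def resolventKernel (lam τ : ℝ) (x : Plane) : ℂ :=
  ∫ u in Ioi (0 : ℝ), (Real.exp (-(lam * u)) : ℂ) * heatKernel (complexTime τ u) x

theorem heatKernel_eq (z : ℂ) (x : Plane) :
    heatKernel z x = 1 / (4 * Real.pi) * heatProfile (‖x‖ ^ 2 / 4) z := by
  rw [heatKernel, heatProfile]
  push_cast
  have : -((‖x‖ : ℂ) ^ 2) / (4 * z) = -((‖x‖ : ℂ) ^ 2 / 4) / z := by
    rw [div_eq_mul_inv, mul_inv, div_eq_mul_inv _ z]; ring
  rw [this]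
  generalize Complex.exp _ = E
  rw [div_mul_div_comm, one_mul]

theorem resolventKernel_eq (lam τ : ℝ) (x : Plane) :
    resolventKernel lam τ x = 1 / (4 * Real.pi) * resolventProfile lam τ (‖x‖ ^ 2 / 4) := by
  rw [resolventKernel, resolventProfile, ← integral_const_mul]
  refine integral_congr_ae (Eventually.of_forall fun u => ?_)
  simp only [heatKernel_eq]
  ring

theorem continuous_resolventKernel {lam τ : ℝ} (hlam : 0 < lam) (hτ : τ ≠ 0) :
    Continuous (resolventKernel lam τ) := by
  have : resolventKernel lam τ
      = fun x => 1 / (4 * Real.pi) * resolventProfile lam τ (‖x‖ ^ 2 / 4) :=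
    funext (resolventKernel_eq lam τ)
  rw [this]
  refine continuous_const.mul ?_
  exact (continuousOn_resolventProfile hlam hτ).comp_continuous (by fun_prop) fun x => by
    simp only [mem_Ici]; positivity

theorem measurable_resolvent_integrand (lam τ : ℝ) (y : Plane) : Measurable fun p : Plane × ℝ =>
    (Real.exp (-(lam * p.2)) : ℂ) * heatKernel (complexTime τ p.2) (p.1 - y) := by
  unfold heatKernel complexTime
  fun_prop

/-- The Laplace transform of an exponential. It is the reason for writing the kernel as a
superposition of heat kernels along the line `u + iτ`. -/
theorem integral_exp_neg_freq_mul {lam : ℝ} (hlam : 0 < lam) (τ : ℝ) (ξ : Plane) :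
    ∫ u in Ioi (0 : ℝ), (Real.exp (-(lam * u)) : ℂ) * Complex.exp (-(freq ξ : ℂ) * complexTime τ u)
      = freeSymbol τ ξ / ((freq ξ + lam : ℝ) : ℂ) := by
  have hw := freq_nonneg ξ
  have h := integral_exp_mul_complex_Ioi (a := ((-(freq ξ + lam) : ℝ) : ℂ))
    (by rw [Complex.ofReal_re]; linarith) 0
  have h2 : ∀ u : ℝ, (Real.exp (-(lam * u)) : ℂ) * Complex.exp (-(freq ξ : ℂ) * complexTime τ u)
      = freeSymbol τ ξ * Complex.exp (((-(freq ξ + lam) : ℝ) : ℂ) * u) := by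
    intro u
    rw [freeSymbol_eq, Complex.ofReal_exp, ← Complex.exp_add, ← Complex.exp_add, complexTime]
    congr 1
    push_cast
    ring
  simp only [h2]
  rw [integral_const_mul, h]
  push_cast
  simp only [mul_zero, Complex.exp_zero]
  rw [neg_div_neg_eq, mul_one_div]

/-- Pairing of the resolvent kernel with a Fourier transform. -/
theorem integral_fourier_mul_resolventKernel {lam : ℝ} (hlam : 0 < lam) (τ : ℝ) (y : Plane)
    (g : 𝓢(Plane, ℂ)) (hint : Integrable (fun p : Plane × ℝ => (𝓕 g : 𝓢(Plane, ℂ)) p.1 *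
      ((Real.exp (-(lam * p.2)) : ℂ) * heatKernel (complexTime τ p.2) (p.1 - y)))
      (volume.prod (volume.restrict (Ioi 0)))) :
    ∫ x, (𝓕 g : 𝓢(Plane, ℂ)) x * resolventKernel lam τ (x - y)
      = ∫ ξ, g ξ * (freeSymbol τ ξ * resolventSymbol lam y ξ) := by
  have h1 : ∀ x, (𝓕 g : 𝓢(Plane, ℂ)) x * resolventKernel lam τ (x - y)
      = ∫ u in Ioi (0 : ℝ), (𝓕 g : 𝓢(Plane, ℂ)) x *
        ((Real.exp (-(lam * u)) : ℂ) * heatKernel (complexTime τ u) (x - y)) := by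
    intro x
    rw [resolventKernel, integral_const_mul]
  simp only [h1]
  rw [integral_integral_swap hint]
  have h2 : ∀ u ∈ Ioi (0 : ℝ), ∫ x, (𝓕 g : 𝓢(Plane, ℂ)) x *
        ((Real.exp (-(lam * u)) : ℂ) * heatKernel (complexTime τ u) (x - y))
      = ∫ ξ, g ξ * planeWave y ξ * ((Real.exp (-(lam * u)) : ℂ) *
        Complex.exp (-(freq ξ : ℂ) * complexTime τ u)) := by
    intro u hu
    have h3 := integral_fourier_mul_heatKernel (z := complexTime τ u)
      (by rw [complexTime_re]; exact le_of_lt hu) (complexTime_ne_zero_of_pos τ hu) y g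
    calc _ = ∫ x, (Real.exp (-(lam * u)) : ℂ) *
          ((𝓕 g : 𝓢(Plane, ℂ)) x * heatKernel (complexTime τ u) (x - y)) := by
            congr 1; ext x; ring
      _ = _ := by
        rw [integral_const_mul, h3, ← integral_const_mul]
        congr 1; ext x; ring
  rw [setIntegral_congr_fun measurableSet_Ioi h2, integral_integral_swap]
  · congr 1
    ext ξ
    rw [integral_const_mul, integral_exp_neg_freq_mul hlam, resolventSymbol]
    ring
  · have hi := ((integrableOn_exp_neg_mul hlam).1.ofReal (𝕜 := ℂ)).mul_prod
      (g.integrable (μ := volume))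
    refine Integrable.mono' hi.norm ?_ ?_
    · have hg := g.continuous.measurable
      have hp := (continuous_planeWave y).measurable
      have hf := continuous_freq.measurable
      refine Measurable.aestronglyMeasurable ?_
      unfold Function.uncurry complexTime
      fun_prop
    · have hpos : ∀ᵐ p : ℝ × Plane ∂((volume.restrict (Ioi 0)).prod volume), p.1 ∈ Ioi (0 : ℝ) :=
        Measure.quasiMeasurePreserving_fst.ae (ae_restrict_mem measurableSet_Ioi)
      filter_upwards [hpos] with p hp
      have hp : 0 < p.1 := hp
      have h4 := norm_exp_neg_freq_mul_le (z := complexTime τ p.1)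
        (by rw [complexTime_re]; exact hp.le) (freq_nonneg p.2)
      simp only [Function.uncurry]
      rw [norm_mul, norm_mul, norm_planeWave, mul_one, norm_mul, norm_mul, mul_comm]
      exact mul_le_mul_of_nonneg_right (mul_le_of_le_one_right (norm_nonneg _) h4) (norm_nonneg _)

/-- At real time the kernel is positive, so its `L¹` norm is the value of its Fourier transform at
zero. -/
theorem integral_norm_heatKernel {u : ℝ} (hu : 0 < u) (y : Plane) :
    Integrable (fun x => heatKernel (complexTime 0 u) (x - y)) ∧
      ∫ x, ‖heatKernel (complexTime 0 u) (x - y)‖ = 1 := by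
  have hre : 0 < (complexTime 0 u).re := by rwa [complexTime_re]
  refine ⟨(integrable_heatKernel hre).comp_sub_right y, ?_⟩
  have h := fourier_heatKernel hre y 0
  rw [Real.fourier_eq] at h
  simp only [inner_zero_right, neg_zero, AddChar.map_zero_eq_one, one_smul, mul_zero,
    Complex.ofReal_zero, zero_mul, Complex.exp_zero, freq, norm_zero] at h
  have h2 : ∀ x : Plane, heatKernel (complexTime 0 u) (x - y)
      = (‖heatKernel (complexTime 0 u) (x - y)‖ : ℂ) := by
    intro x
    have : heatKernel (complexTime 0 u) (x - y)
        = ((Real.exp (-‖x - y‖ ^ 2 / (4 * u)) / (4 * Real.pi * u) : ℝ) : ℂ) := by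
      rw [heatKernel, complexTime]
      push_cast
      simp
    rw [this, Complex.norm_real, Real.norm_of_nonneg (by positivity)]
  rw [← Complex.ofReal_inj, ← integral_complex_ofReal, ← integral_congr_ae (Eventually.of_forall h2),
    h]
  simp

/-- For `τ = 0` the heat kernels are not bounded uniformly in `u`; Fubini rests instead on their
unit mass. -/
theorem integrable_resolvent_integrand_zero {lam : ℝ} (hlam : 0 < lam) (y : Plane) :
    Integrable (fun p : Plane × ℝ =>
      (Real.exp (-(lam * p.2)) : ℂ) * heatKernel (complexTime 0 p.2) (p.1 - y))
      (volume.prod (volume.restrict (Ioi 0))) := by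
  rw [integrable_prod_iff' (measurable_resolvent_integrand lam 0 y).aestronglyMeasurable]
  constructor
  · filter_upwards [ae_restrict_mem measurableSet_Ioi] with u hu
    exact (integral_norm_heatKernel hu y).1.const_mul _
  · refine (integrableOn_exp_neg_mul hlam).1.congr ?_
    filter_upwards [ae_restrict_mem measurableSet_Ioi] with u hu
    simp only [norm_mul]
    rw [integral_const_mul, (integral_norm_heatKernel hu y).2, mul_one, Complex.norm_real,
      Real.norm_of_nonneg (Real.exp_pos _).le]

/-- For `τ ≠ 0` the heat kernels on the line are bounded by `1/(4π|τ|)`, so integrability in `x` is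
supplied by the Schwartz function alone. -/
theorem integrable_fourier_mul_resolvent_integrand {lam τ : ℝ} (hlam : 0 < lam) (hτ : τ ≠ 0)
    (y : Plane) (g : 𝓢(Plane, ℂ)) :
    Integrable (fun p : Plane × ℝ => (𝓕 g : 𝓢(Plane, ℂ)) p.1 *
      ((Real.exp (-(lam * p.2)) : ℂ) * heatKernel (complexTime τ p.2) (p.1 - y)))
      (volume.prod (volume.restrict (Ioi 0))) := by
  have hi := ((𝓕 g : 𝓢(Plane, ℂ)).integrable (μ := volume)).mul_prod
    ((integrableOn_exp_neg_mul hlam).1.ofReal (𝕜 := ℂ))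
  refine Integrable.mono' (hi.norm.mul_const (1 / (4 * Real.pi * |τ|))) ?_ ?_
  · exact (((𝓕 g : 𝓢(Plane, ℂ)).continuous.measurable.comp measurable_fst).mul
      (measurable_resolvent_integrand lam τ y)).aestronglyMeasurable
  · have hpos : ∀ᵐ p : Plane × ℝ ∂(volume.prod (volume.restrict (Ioi 0))), p.2 ∈ Ioi (0 : ℝ) :=
      Measure.quasiMeasurePreserving_snd.ae (ae_restrict_mem measurableSet_Ioi)
    filter_upwards [hpos] with p hp
    have hp : 0 < p.2 := hp
    have h := norm_heatKernel_le (z := complexTime τ p.2) (by rw [complexTime_re]; exact hp.le)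
      (p.1 - y)
    have h2 := abs_le_norm_complexTime τ p.2
    have h3 := abs_pos.2 hτ
    rw [norm_mul, norm_mul, norm_mul, ← mul_assoc]
    refine mul_le_mul_of_nonneg_left (h.trans ?_) (by positivity)
    gcongr

theorem resolventL2_ae_eq {lam : ℝ} (hlam : 0 < lam) (y : Plane) :
    (resolventL2 hlam y : Plane → ℂ) =ᵐ[volume] fun x => resolventKernel lam 0 (x - y) := by
  have hi := integrable_resolvent_integrand_zero hlam y
  refine eq_fourierInv_of_fourier_ae_eq (fourier_resolventL2 hlam y) ?_ fun g => ?_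
  · exact (hi.integral_prod_left).locallyIntegrable
  · rw [integral_fourier_mul_resolventKernel hlam 0 y g]
    · simp [freeSymbol]
    · have hm := (𝓕 g : 𝓢(Plane, ℂ)).continuous.measurable
      refine (hi.bdd_mul (c := (SchwartzMap.seminorm ℂ 0 0) (𝓕 g : 𝓢(Plane, ℂ)))
        (hm.comp measurable_fst).aestronglyMeasurable (Eventually.of_forall fun p => ?_))
      exact SchwartzMap.norm_le_seminorm ℂ _ _

theorem freeProp_resolventL2_ae_eq {lam τ : ℝ} (hlam : 0 < lam) (hτ : τ ≠ 0) (y : Plane) :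
    (freeProp τ (resolventL2 hlam y) : Plane → ℂ) =ᵐ[volume]
      fun x => resolventKernel lam τ (x - y) := by
  refine eq_fourierInv_of_fourier_ae_eq (m := fun ξ => freeSymbol τ ξ * resolventSymbol lam y ξ)
    ?_ ?_ fun g => ?_
  · filter_upwards [fourier_freeProp τ (resolventL2 hlam y), fourier_resolventL2 hlam y] with ξ h1 h2
    rw [h1, h2]
  · exact ((continuous_resolventKernel hlam hτ).comp (by fun_prop : Continuous fun x : Plane =>
      x - y)).locallyIntegrable
  · exact integral_fourier_mul_resolventKernel hlam τ y g
      (integrable_fourier_mul_resolvent_integrand hlam hτ y g)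

/-- The substitution `u ↦ lam u` in the integral for `K₀` moves the parameter `lam` into the
exponential weight. -/
theorem resolventKernel_zero_eq_besselK0 {lam : ℝ} (hlam : 0 < lam) (x : Plane) :
    resolventKernel lam 0 x
      = 1 / (2 * Real.pi) * (besselK0 (Real.sqrt lam * ‖x‖) : ℂ) := by
  have h1 : ∫ u in Ioi (0 : ℝ), Real.exp (-u - (Real.sqrt lam * ‖x‖) ^ 2 / (4 * u)) / u
      = ∫ u in Ioi (0 : ℝ), Real.exp (-(lam * u)) * (Real.exp (-(‖x‖ ^ 2 / (4 * u))) / u) := by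
    have h := integral_comp_mul_left_Ioi
      (fun u => Real.exp (-u - (Real.sqrt lam * ‖x‖) ^ 2 / (4 * u)) / u) 0 hlam
    rw [mul_zero, smul_eq_mul, eq_comm, inv_mul_eq_iff_eq_mul₀ hlam.ne', ← integral_const_mul] at h
    rw [h]
    refine setIntegral_congr_fun measurableSet_Ioi fun u hu => ?_
    have hu : 0 < u := hu
    rw [mul_pow, Real.sq_sqrt hlam.le, sub_eq_add_neg, Real.exp_add]
    have : lam * ‖x‖ ^ 2 / (4 * (lam * u)) = ‖x‖ ^ 2 / (4 * u) := by field_simp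
    rw [this]
    field_simp
  rw [besselK0, h1, resolventKernel]
  have h2 : ∀ u ∈ Ioi (0 : ℝ), (Real.exp (-(lam * u)) : ℂ) * heatKernel (complexTime 0 u) x
      = 1 / (4 * Real.pi) * ((Real.exp (-(lam * u)) * (Real.exp (-(‖x‖ ^ 2 / (4 * u))) / u) : ℝ) : ℂ) := by
    intro u hu
    rw [heatKernel, complexTime]
    push_cast
    simp only [zero_mul, add_zero, neg_div]
    generalize Complex.exp _ = E
    generalize Complex.exp _ = E'
    rw [mul_left_comm (1 / (4 * (Real.pi : ℂ))), div_mul_div_comm, one_mul]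
  rw [setIntegral_congr_fun measurableSet_Ioi h2, integral_const_mul, integral_complex_ofReal]
  push_cast
  ring

theorem singularPart_ae_eq {N : ℕ} (y : Fin N → Plane) {lam : ℝ} (hlam : 0 < lam) (c : Fin N → ℂ) :
    ((∑ j, c j • resolventL2 hlam (y j) : L2Plane) : Plane → ℂ) =ᵐ[volume]
      singularPart y lam c := by
  have h1 := Lp.coeFn_finsetSum Finset.univ (fun j => c j • resolventL2 hlam (y j))
  have h2 : ∀ᵐ x : Plane, ∀ j, (c j • resolventL2 hlam (y j) : L2Plane) x
      = c j * resolventKernel lam 0 (x - y j) := by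
    refine ae_all_iff.2 fun j => ?_
    filter_upwards [Lp.coeFn_smul (c j) (resolventL2 hlam (y j)), resolventL2_ae_eq hlam (y j)]
      with x h3 h4
    rw [h3, Pi.smul_apply, h4, smul_eq_mul]
  filter_upwards [h1, h2] with x h3 h4
  rw [h3, Finset.sum_apply, singularPart, Finset.mul_sum]
  refine Finset.sum_congr rfl fun j _ => ?_
  rw [h4, resolventKernel_zero_eq_besselK0 hlam]
  ring

/-- A null set cannot contain a neighbourhood. Hence limits modulo null sets are unique, and point
values of `L²` classes are meaningful. -/
instance neBot_ae_inf_nhds (x : Plane) : (ae (volume : Measure Plane) ⊓ 𝓝 x).NeBot := by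
  rw [inf_neBot_iff]
  intro s hs t ht
  by_contra h
  rw [not_nonempty_iff_eq_empty, ← disjoint_iff_inter_eq_empty] at h
  have h1 : volume t = 0 := measure_mono_null h.subset_compl_left (mem_ae_iff.1 hs)
  exact (Measure.measure_pos_of_mem_nhds volume ht).ne' h1

theorem pointValue_eq {f : L2Plane} {F : Plane → ℂ} (h : f =ᵐ[volume] F) {x : Plane}
    (hF : ContinuousAt F x) : pointValue f x = F x := by
  refine Tendsto.limUnder_eq ?_
  have h1 : Tendsto F (ae volume ⊓ 𝓝 x) (𝓝 (F x)) := hF.mono_left inf_le_right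
  refine h1.congr' ?_
  exact Filter.Eventually.filter_mono inf_le_left (h.mono fun x hx => hx.symm)

end PointInteraction

/-! ### Free evolution of `H²` functions and point values -/

namespace PointInteraction

theorem integrable_inv_freq_add_sq {σ : ℝ} (hσ : 0 < σ) :
    Integrable (fun ξ : Plane => ((freq ξ + σ) ^ 2)⁻¹) ∧
      ∫ ξ : Plane, ((freq ξ + σ) ^ 2)⁻¹ = 1 / (4 * Real.pi) * σ⁻¹ := by
  have h := integrableOn_inv_add_sq hσ
  have hm : AEMeasurable freq (volume : Measure Plane) := continuous_freq.measurable.aemeasurable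
  have hs : ∀ μ : Measure ℝ, AEStronglyMeasurable (fun w : ℝ => ((w + σ) ^ 2)⁻¹) μ :=
    fun μ => Measurable.aestronglyMeasurable (by fun_prop)
  constructor
  · have := (integrable_map_measure (f := freq) (hs _) hm).1 (by
      rw [map_freq_volume]
      exact h.1.smul_measure ENNReal.ofReal_ne_top)
    exact this
  · have := integral_map hm (hs (Measure.map freq volume))
    rw [← this, map_freq_volume, integral_smul_measure, h.2,
      ENNReal.toReal_ofReal (by positivity), smul_eq_mul]

/-- Both elementary bounds, `|x|` and `2`, are contained in one rational function; for `x` of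
modulus `δω` it becomes `4ω/(ω + δ⁻¹)`, whose relevant square integral is explicit. -/
theorem norm_exp_mul_I_sub_one_le (x : ℝ) :
    ‖Complex.exp ((x : ℝ) * Complex.I) - 1‖ ≤ 4 * |x| / (1 + |x|) := by
  have h1 : ‖Complex.exp ((x : ℝ) * Complex.I) - 1‖ ≤ |x| := by
    rw [mul_comm]
    exact Real.norm_exp_I_mul_ofReal_sub_one_le
  have h2 : ‖Complex.exp ((x : ℝ) * Complex.I) - 1‖ ≤ 2 := by
    refine (norm_sub_le _ _).trans ?_
    rw [Complex.norm_exp_ofReal_mul_I, norm_one]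
    norm_num
  have hx := abs_nonneg x
  rw [le_div_iff₀ (by positivity)]
  rcases le_total |x| 1 with h | h <;> nlinarith

theorem norm_freeSymbol_sub_le (τ : ℝ) {δ : ℝ} (hδ : 0 < δ) (τ' : ℝ) (h : |τ' - τ| = δ) (ξ : Plane) :
    ‖freeSymbol τ' ξ - freeSymbol τ ξ‖ ≤ 4 * freq ξ / (freq ξ + δ⁻¹) := by
  have hw := freq_nonneg ξ
  have h1 : freeSymbol τ' ξ - freeSymbol τ ξ
      = freeSymbol τ ξ * (Complex.exp ((-(freq ξ * (τ' - τ)) : ℝ) * Complex.I) - 1) := by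
    rw [freeSymbol_eq, freeSymbol_eq, mul_sub, ← Complex.exp_add, mul_one]
    congr 2
    push_cast
    ring
  rw [h1, norm_mul, norm_freeSymbol, one_mul]
  refine (norm_exp_mul_I_sub_one_le _).trans (le_of_eq ?_)
  rw [abs_neg, abs_mul, h, abs_of_nonneg hw]
  field_simp
  ring

/-- The Fourier transform of an element of `H²` is square integrable with the weight `1 + |ξ|²`. -/
theorem memLp_weight_of_memH_two {φ : L2Plane} (hφ : MemH 2 φ) :
    MemLp (fun ξ => ((1 + ‖ξ‖ ^ 2 : ℝ) : ℂ) * (𝓕 φ : L2Plane) ξ) 2 volume := by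
  have h := (memSobolev_iff_memLp_fourier 2 φ).1 hφ
  simpa using h

/-- Up to a factor this is the modulus of the resolvent symbol at `lam = (2π)²`, because `ω + (2π)²
= (2π)²(1 + ‖ξ‖²)`. -/
theorem memLp_inv_weight : MemLp (fun ξ : Plane => (((1 + ‖ξ‖ ^ 2)⁻¹ : ℝ) : ℂ)) 2 volume := by
  have hπ : 0 < (2 * Real.pi) ^ 2 := by positivity
  refine (memLp_resolventSymbol hπ 0).of_le_mul (c := (2 * Real.pi) ^ 2)
    (Continuous.aestronglyMeasurable ?_) (Eventually.of_forall fun ξ => ?_)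
  · refine Complex.continuous_ofReal.comp (Continuous.inv₀ (by fun_prop) fun ξ => ?_)
    positivity
  · rw [norm_resolventSymbol hπ, Complex.norm_real, Real.norm_of_nonneg (by positivity), freq]
    refine le_of_eq ?_
    field_simp
    ring

theorem integrable_fourier_of_memH_two {φ : L2Plane} (hφ : MemH 2 φ) :
    Integrable ((𝓕 φ : L2Plane) : Plane → ℂ) := by
  refine (MemLp.integrable_mul memLp_inv_weight (memLp_weight_of_memH_two hφ)).congr
    (Eventually.of_forall fun ξ => ?_)
  have : ((1 + ‖ξ‖ ^ 2 : ℝ) : ℂ) ≠ 0 := by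
    have : 1 + ‖ξ‖ ^ 2 ≠ 0 := by positivity
    exact_mod_cast this
  simp only [Pi.mul_apply]
  rw [Complex.ofReal_inv, inv_mul_cancel_left₀ this]

/-- The continuous representative of `e^{iτΔ}φ` for `φ ∈ H²`. -/
noncomputable def sobolevWave (φ : L2Plane) (τ : ℝ) (x : Plane) : ℂ :=
  𝓕⁻ (fun ξ => freeSymbol τ ξ * (𝓕 φ : L2Plane) ξ) x

theorem integrable_freeSymbol_mul {h : Plane → ℂ} (hh : Integrable h) (τ : ℝ) :
    Integrable fun ξ => freeSymbol τ ξ * h ξ :=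
  hh.bdd_mul (c := 1) (continuous_freeSymbol τ).aestronglyMeasurable
    (Eventually.of_forall fun ξ => (norm_freeSymbol τ ξ).le)

theorem continuous_sobolevWave {φ : L2Plane} (hφ : MemH 2 φ) (τ : ℝ) :
    Continuous (sobolevWave φ τ) := by
  have hi := integrable_freeSymbol_mul (integrable_fourier_of_memH_two hφ) τ
  have : sobolevWave φ τ = fun x => 𝓕 (fun ξ => freeSymbol τ ξ * (𝓕 φ : L2Plane) ξ) (-x) := by
    ext x
    rw [sobolevWave, Real.fourierInv_eq_fourier_neg]
  rw [this]
  exact (continuous_fourier_of_integrable hi).comp continuous_neg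

theorem freeProp_ae_eq_sobolevWave {φ : L2Plane} (hφ : MemH 2 φ) (τ : ℝ) :
    (freeProp τ φ : Plane → ℂ) =ᵐ[volume] sobolevWave φ τ := by
  have hi := integrable_freeSymbol_mul (integrable_fourier_of_memH_two hφ) τ
  have h2 : MemLp (fun ξ => freeSymbol τ ξ * (𝓕 φ : L2Plane) ξ) 2 volume :=
    (memLp_congr_ae (fourier_freeProp τ φ)).1 (Lp.memLp _)
  have h3 : freeProp τ φ = 𝓕⁻ (h2.toLp _ : L2Plane) := by
    rw [← FourierPair.fourierInv_fourier_eq (F := L2Plane) (freeProp τ φ)]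
    congr 1
    exact Lp.ext ((fourier_freeProp τ φ).trans h2.coeFn_toLp.symm)
  rw [h3]
  exact fourierInv_toLp_ae_eq h2 hi

theorem sobolevWave_eq (φ : L2Plane) (τ : ℝ) (x : Plane) :
    sobolevWave φ τ x = ∫ ξ, (Real.fourierChar (inner ℝ ξ x) : ℂ) *
      (freeSymbol τ ξ * (𝓕 φ : L2Plane) ξ) := by
  rw [sobolevWave, Real.fourierInv_eq]
  rfl

/-- This is the origin of the square root in `IsNice`. The factor `ω` in the increment of the symbol
is absorbed by the `H²` weight, which leaves `1/(ω + δ⁻¹)`; its `L²` norm over the plane is a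
constant times `√δ`, as the density of `ω` is constant. -/
theorem isNice_sobolevWave {ε : ℝ} (hε : ε ^ 2 = 1) {φ : L2Plane} (hφ : MemH 2 φ) (x : Plane) (R : ℝ) :
    IsNice R fun r => sobolevWave φ (ε * r) x := by
  have hε1 : |ε| = 1 := abs_eq_one_of_sq_eq_one hε
  have hi := integrable_fourier_of_memH_two hφ
  have hB := (memLp_weight_of_memH_two hφ).integrable_norm_pow two_ne_zero
  set h : Plane → ℂ := ((𝓕 φ : L2Plane) : Plane → ℂ) with hh
  set K := ∫ ξ, ‖((1 + ‖ξ‖ ^ 2 : ℝ) : ℂ) * h ξ‖ ^ 2 with hK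
  have hK0 : 0 ≤ K := integral_nonneg fun ξ => by positivity
  have hint : ∀ τ, Integrable fun ξ => (Real.fourierChar (inner ℝ ξ x) : ℂ) * (freeSymbol τ ξ * h ξ) := by
    intro τ
    refine (integrable_freeSymbol_mul hi τ).bdd_mul (c := 1) ?_
      (Eventually.of_forall fun ξ => (Circle.norm_coe _).le)
    refine Continuous.aestronglyMeasurable ?_
    exact continuous_subtype_val.comp (Real.continuous_fourierChar.comp (by fun_prop))
  set C := 1 / 2 * ((4 * (2 * Real.pi) ^ 2) ^ 2 * (1 / (4 * Real.pi)) + K) with hC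
  have hC0 : 0 ≤ C := by positivity
  refine IsNice.of_le (M := ∫ ξ, ‖h ξ‖) (C := C) (fun r hr => ?_) fun r r' h0 h1 h2 => ?_
  · rw [sobolevWave_eq]
    refine norm_integral_le_of_norm_le hi.norm (Eventually.of_forall fun ξ => le_of_eq ?_)
    rw [norm_mul, norm_mul, Circle.norm_coe, norm_freeSymbol, one_mul, one_mul]
  · set δ := r' - r with hδ
    have hδ0 : 0 < δ := sub_pos.2 h1
    have hsq := Real.sqrt_pos.2 hδ0
    have hss := Real.mul_self_sqrt hδ0.le
    have hf := integrable_inv_freq_add_sq (inv_pos.2 hδ0)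
    have hb : ∀ ξ, ‖(Real.fourierChar (inner ℝ ξ x) : ℂ) * (freeSymbol (ε * r') ξ * h ξ)
          - (Real.fourierChar (inner ℝ ξ x) : ℂ) * (freeSymbol (ε * r) ξ * h ξ)‖
        ≤ (4 * (2 * Real.pi) ^ 2) ^ 2 / (2 * √δ) * ((freq ξ + δ⁻¹) ^ 2)⁻¹
          + √δ / 2 * ‖((1 + ‖ξ‖ ^ 2 : ℝ) : ℂ) * h ξ‖ ^ 2 := by
      intro ξ
      have hw := freq_nonneg ξ
      have h3 := norm_freeSymbol_sub_le (ε * r) hδ0 (ε * r')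
        (by rw [← mul_sub, abs_mul, hε1, one_mul, abs_of_pos hδ0]) ξ
      rw [← mul_sub, norm_mul, Circle.norm_coe, one_mul, ← sub_mul, norm_mul, norm_mul,
        Complex.norm_real, Real.norm_of_nonneg (by positivity)]
      have h4 : freq ξ ≤ (2 * Real.pi) ^ 2 * (1 + ‖ξ‖ ^ 2) := by
        rw [freq, mul_pow]
        nlinarith [sq_nonneg (2 * Real.pi)]
      have h5 : ‖freeSymbol (ε * r') ξ - freeSymbol (ε * r) ξ‖ * ‖h ξ‖
          ≤ (4 * (2 * Real.pi) ^ 2 / (freq ξ + δ⁻¹)) * ((1 + ‖ξ‖ ^ 2) * ‖h ξ‖) := by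
        calc _ ≤ 4 * freq ξ / (freq ξ + δ⁻¹) * ‖h ξ‖ := by gcongr
          _ ≤ 4 * ((2 * Real.pi) ^ 2 * (1 + ‖ξ‖ ^ 2)) / (freq ξ + δ⁻¹) * ‖h ξ‖ := by gcongr
          _ = _ := by ring
      refine h5.trans ?_
      have h6 : (4 * (2 * Real.pi) ^ 2) ^ 2 / (2 * √δ) * ((freq ξ + δ⁻¹) ^ 2)⁻¹
          = (4 * (2 * Real.pi) ^ 2 / (freq ξ + δ⁻¹)) ^ 2 / (2 * √δ) := by
        rw [div_pow, div_mul_eq_mul_div, div_eq_mul_inv _ ((freq ξ + δ⁻¹) ^ 2)]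
      rw [h6]
      generalize 4 * (2 * Real.pi) ^ 2 / (freq ξ + δ⁻¹) = X
      generalize (1 + ‖ξ‖ ^ 2) * ‖h ξ‖ = Y
      -- The product is split by `XY ≤ X²/(2√δ) + √δ Y²/2`, which balances the two sides: `∫ X²` is
      -- of order `δ` and `∫ Y²` of order one.
      have h7 : X ^ 2 / (2 * √δ) + √δ / 2 * Y ^ 2 - X * Y = (X - √δ * Y) ^ 2 / (2 * √δ) := by
        field_simp
        ring
      have h8 : 0 ≤ (X - √δ * Y) ^ 2 / (2 * √δ) := by positivity
      linarith
    rw [sobolevWave_eq, sobolevWave_eq, ← integral_sub (hint _) (hint _)]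
    refine (norm_integral_le_of_norm_le ((hf.1.const_mul _).add (hB.const_mul _))
      (Eventually.of_forall hb)).trans ?_
    rw [integral_add' (hf.1.const_mul _) (hB.const_mul _), integral_const_mul, integral_const_mul,
      hf.2, inv_inv]
    have h9 : (4 * (2 * Real.pi) ^ 2) ^ 2 / (2 * √δ) * (1 / (4 * Real.pi) * δ) + √δ / 2 * K
        = C * √δ := by
      rw [hC]
      nth_rewrite 2 [← hss]
      field_simp
    rw [h9]
    have h10 : 0 ≤ δ / r := by positivity
    nlinarith

/-- The values of `e^{iτΔ}ψ` for `ψ` with regular part `φ` and charges `c`. -/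
theorem pointValue_freeProp {N : ℕ} {y : Fin N → Plane} {lam : ℝ} (hlam : 0 < lam) {φ ψ : L2Plane}
    {c : Fin N → ℂ} (hφ : MemH 2 φ) (hψ : ∀ᵐ x : Plane, ψ x = φ x + singularPart y lam c x) {τ : ℝ}
    (hτ : τ ≠ 0) (x : Plane) :
    pointValue (freeProp τ ψ) x
      = sobolevWave φ τ x + ∑ k, c k * resolventKernel lam τ (x - y k) := by
  have h1 : ψ = φ + ∑ j, c j • resolventL2 hlam (y j) := by
    refine Lp.ext ?_
    filter_upwards [hψ, singularPart_ae_eq y hlam c,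
      Lp.coeFn_add φ (∑ j, c j • resolventL2 hlam (y j))] with x h2 h3 h4
    rw [h4, Pi.add_apply, h2, h3]
  have h2 : (freeProp τ ψ : Plane → ℂ) =ᵐ[volume]
      fun x => sobolevWave φ τ x + ∑ k, c k * resolventKernel lam τ (x - y k) := by
    rw [h1, freeProp_add, freeProp_sum]
    simp only [freeProp_smul]
    have h3 : ∀ᵐ x : Plane, ∀ j, (c j • freeProp τ (resolventL2 hlam (y j)) : L2Plane) x
        = c j * resolventKernel lam τ (x - y j) := by
      refine ae_all_iff.2 fun j => ?_
      filter_upwards [Lp.coeFn_smul (c j) (freeProp τ (resolventL2 hlam (y j))),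
        freeProp_resolventL2_ae_eq hlam hτ (y j)] with x h3 h4
      rw [h3, Pi.smul_apply, h4, smul_eq_mul]
    filter_upwards [h3, freeProp_ae_eq_sobolevWave hφ τ,
      Lp.coeFn_add (freeProp τ φ) (∑ j, c j • freeProp τ (resolventL2 hlam (y j))),
      Lp.coeFn_finsetSum Finset.univ fun j => c j • freeProp τ (resolventL2 hlam (y j))]
      with x h4 h5 h6 h7
    rw [h6, Pi.add_apply, h5, h7, Finset.sum_apply]
    simp only [h4]
  have hc : Continuous fun x => sobolevWave φ τ x + ∑ k, c k * resolventKernel lam τ (x - y k) := by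
    refine (continuous_sobolevWave hφ τ).add (continuous_finsetSum _ fun k _ => ?_)
    exact continuous_const.mul ((continuous_resolventKernel hlam hτ).comp (by fun_prop))
  exact pointValue_eq h2 hc.continuousAt

end PointInteraction

/-! ### The charge equation without its logarithmic singularity -/

namespace PointInteraction

theorem IsNice.integrableOn_volterraI_mul {R r : ℝ} {f : ℝ → ℂ} (hf : IsNice R f) (hr : 0 < r)
    (hrR : r ≤ R) : IntegrableOn (fun ρ => (volterraI (r - ρ) : ℂ) * f ρ) (Ioo 0 r) := by
  obtain ⟨M, hM⟩ := hf.bounded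
  have hsub : Ioo 0 r ⊆ Ioc 0 R := fun ρ hρ => ⟨hρ.1, hρ.2.le.trans hrR⟩
  refine Integrable.mul_bdd (c := M) (integrableOn_volterraI_sub hr).ofReal ?_ ?_
  · exact (hf.continuousOn.mono hsub).aestronglyMeasurable measurableSet_Ioo
  · filter_upwards [ae_restrict_mem measurableSet_Ioo] with ρ hρ
    exact hM ρ (hsub hρ)

theorem integrableOn_volterraI_mul_gamma_add_log {r : ℝ} (hr : 0 < r) :
    IntegrableOn (fun ρ => volterraI (r - ρ) * (-Real.eulerMascheroniConstant - Real.log ρ))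
      (Ioo 0 r) := by
  have h1 := (integrableOn_volterraI_sub hr).mul_const (-Real.eulerMascheroniConstant)
  have h2 : IntegrableOn (fun ρ => volterraI (r - ρ) * Real.log ρ) (Ioo 0 r) := by
    refine (integrableOn_volterraI_mul_log hr).mono' ?_ ?_
    · refine ContinuousOn.aestronglyMeasurable (ContinuousOn.mul ?_ ?_) measurableSet_Ioo
      · exact continuousOn_volterraI.comp (by fun_prop) fun ρ hρ => sub_pos.2 hρ.2
      · exact Real.continuousOn_log.mono fun ρ hρ => hρ.1.ne'
    · filter_upwards [ae_restrict_mem measurableSet_Ioo] with ρ hρ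
      rw [norm_mul, Real.norm_of_nonneg (volterraI_nonneg (sub_pos.2 hρ.2)), Real.norm_eq_abs]
  refine (h1.sub h2).congr (Eventually.of_forall fun ρ => ?_)
  simp only [Pi.sub_apply]
  ring

theorem integral_eq_smul_integral_Ioo {ε r : ℝ} (hr : 0 < r) (s : ℝ) (F : ℝ → ℂ) :
    ∫ τ in s..(s + ε * r), F τ = ε * ∫ ρ in Ioo 0 r, F (s + ε * ρ) := by
  have h := intervalIntegral.smul_integral_comp_add_mul (a := 0) (b := r) F ε s
  rw [mul_zero, add_zero] at h
  rw [← h, intervalIntegral.integral_of_le hr.le, integral_Ioc_eq_integral_Ioo, Complex.real_smul]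

/-- The regular part of the source of the charge equation after elapsed time `r`. -/
noncomputable def regularSource {N : ℕ} (y : Fin N → Plane) (lam ε : ℝ) (φ : L2Plane) (c : Fin N → ℂ)
    (j : Fin N) (r : ℝ) : ℂ :=
  4 * Real.pi * sobolevWave φ (ε * r) (y j) +
    ∑ k, c k * if k = j then
        resolventProfile lam (ε * r) 0 + Real.log r + Real.eulerMascheroniConstant
      else resolventProfile lam (ε * r) (‖y j - y k‖ ^ 2 / 4)

/-- The coefficients of the charge equation after elapsed time `r`. -/
noncomputable def regularCoeff {N : ℕ} (α : Fin N → ℝ → ℝ) (y : Fin N → Plane) (s ε : ℝ)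
    (j l : Fin N) (r : ℝ) : ℂ :=
  if j = l then
    ((-(4 * Real.pi * (α j (s + ε * r) - 1 / (2 * Real.pi) * Real.log 2
      + Real.eulerMascheroniConstant / (2 * Real.pi))) : ℝ) : ℂ)
  else 2 * Complex.I * freeKernelIntegral s (s + ε * r) ‖y j - y l‖

theorem isNice_regularSource {N : ℕ} {y : Fin N → Plane} (hy : Function.Injective y) {lam ε : ℝ}
    (hε : ε ^ 2 = 1) (hlam : 0 < lam) {φ : L2Plane} (hφ : MemH 2 φ) (c : Fin N → ℂ) (j : Fin N)
    (R : ℝ) : IsNice R (regularSource y lam ε φ c j) := by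
  refine ((isNice_sobolevWave hε hφ (y j) R).const_mul (4 * Real.pi)).add
    (IsNice.sum _ fun k _ => IsNice.const_mul _ ?_)
  split_ifs with h
  · exact (isNice_resolventProfile_zero_add_log hε hlam R).add (IsNice.const _)
  · refine isNice_resolventProfile hε hlam ?_ R
    have : 0 < ‖y j - y k‖ := norm_pos_iff.2 (sub_ne_zero.2 fun h' => h (hy h'.symm))
    positivity

/-- On the diagonal a `C¹` function is Lipschitz on a compact interval; off the diagonal the centres
are at positive distance, so the oscillatory integral is controlled. -/
theorem isNice_regularCoeff {N : ℕ} {α : Fin N → ℝ → ℝ} (hα : ∀ j, ContDiff ℝ 1 (α j))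
    {y : Fin N → Plane} (hy : Function.Injective y) {ε : ℝ} (hε : ε ^ 2 = 1) (s : ℝ) (j l : Fin N)
    (R : ℝ) : IsNice R (regularCoeff α y s ε j l) := by
  unfold regularCoeff
  split_ifs with h
  · have hd : ContDiff ℝ 1 (fun r => -(4 * Real.pi * (α j (s + ε * r) - 1 / (2 * Real.pi) * Real.log 2
      + Real.eulerMascheroniConstant / (2 * Real.pi)))) := by
      have := hα j
      fun_prop
    obtain ⟨K, hK⟩ := hd.contDiffOn.exists_lipschitzOnWith one_ne_zero (convex_Icc (0 : ℝ) R)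
      isCompact_Icc
    refine IsNice.of_lipschitz (L := K) K.2 fun r hr r' hr' => ?_
    rw [← Complex.ofReal_sub, Complex.norm_real, ← Real.norm_eq_abs]
    exact hK.norm_sub_le hr' hr
  · refine (isNice_freeKernelIntegral hε s ?_ R).const_mul _
    exact norm_pos_iff.2 (sub_ne_zero.2 fun h' => h (hy h'))

/-- The charge equation in terms of the elapsed time, freed from its logarithmic singularity. -/
theorem charge_equation_of_isChargeSolution {N : ℕ} {y : Fin N → Plane} (hy : Function.Injective y)
    {α : Fin N → ℝ → ℝ} (hα : ∀ j, ContDiff ℝ 1 (α j)) {lam : ℝ} (hlam : 0 < lam) {s : ℝ}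
    {φ ψ : L2Plane} {c : Fin N → ℂ} (hφ : MemH 2 φ)
    (hψ : ∀ᵐ x : Plane, ψ x = φ x + singularPart y lam c x) {J : Set ℝ} {q : ℝ → Fin N → ℂ}
    (hq : IsChargeSolution α y s ψ c J q) {ε R : ℝ} (hε : ε ^ 2 = 1)
    (hJ : ∀ r ∈ Icc 0 R, s + ε * r ∈ J) (j : Fin N) {r : ℝ} (hr : r ∈ Ioc 0 R) :
    q (s + ε * r) j - c j = ∫ ρ in Ioo 0 r, (volterraI (r - ρ) : ℂ) *
      (regularSource y lam ε φ c j ρ + ∑ l, regularCoeff α y s ε j l ρ * q (s + ε * ρ) l) := by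
  have hε' : (ε : ℂ) * ε = 1 := by rw [← sq]; exact_mod_cast hε
  have hε0 : ε ≠ 0 := by rintro rfl; norm_num at hε
  have hr0 := hr.1
  have hts : s + ε * r ≠ s := by simp [hε0, hr0.ne']
  -- The odd extension of `𝓘` makes both directions of time look alike: reversal only produces the
  -- factor `ε`.
  have hI : ∀ ρ ∈ Ioo 0 r, volterraI (s + ε * r - (s + ε * ρ)) = ε * volterraI (r - ρ) := by
    intro ρ hρ
    have h1 : s + ε * r - (s + ε * ρ) = ε * (r - ρ) := by ring
    rw [h1]
    rcases mul_self_eq_one_iff.1 ((sq ε).symm.trans hε) with h | h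
    · rw [h, one_mul, one_mul]
    · rw [h, neg_one_mul, neg_one_mul, volterraI_neg]
  have heq := hq.equation _ (hJ r ⟨hr0.le, hr.2⟩) hts j
  have hG := isNice_regularSource hy hε hlam hφ c j R
  have hcont : ∀ l, ContinuousOn (fun ρ => q (s + ε * ρ) l) (Icc 0 R) := by
    intro l
    have : ContinuousOn (fun ρ => q (s + ε * ρ)) (Icc 0 R) :=
      hq.continuousOn.comp (by fun_prop) hJ
    exact (continuous_apply l).comp_continuousOn this
  have hkern : ∀ ρ ∈ Ioo 0 r, (chargeKernel α y s (s + ε * r) (s + ε * ρ)).mulVec (q (s + ε * ρ)) j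
      = -(ε * ((volterraI (r - ρ) : ℂ) * ∑ l, regularCoeff α y s ε j l ρ * q (s + ε * ρ) l)) := by
    intro ρ hρ
    rw [Matrix.mulVec, dotProduct, Finset.mul_sum, Finset.mul_sum, ← Finset.sum_neg_distrib]
    refine Finset.sum_congr rfl fun l _ => ?_
    rw [chargeKernel, regularCoeff, hI ρ hρ]
    split_ifs
    · push_cast; ring
    · push_cast; ring
  have hsrc : ∀ ρ ∈ Ioo 0 r, (volterraI (s + ε * r - (s + ε * ρ)) : ℂ) *
        pointValue (freeProp (s + ε * ρ - s) ψ) (y j)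
      = ε / (4 * Real.pi) * ((volterraI (r - ρ) : ℂ) * regularSource y lam ε φ c j ρ
        + c j * ((volterraI (r - ρ) * (-Real.eulerMascheroniConstant - Real.log ρ) : ℝ) : ℂ)) := by
    intro ρ hρ
    rw [hI ρ hρ, add_sub_cancel_left, pointValue_freeProp hlam hφ hψ (mul_ne_zero hε0 hρ.1.ne'),
      regularSource]
    -- Only the centre `k = j` is seen from distance zero and produces a logarithm. Adding and
    -- subtracting `-γ - log ρ` there leaves a bounded source.
    have h1 : ∑ k, c k * resolventKernel lam (ε * ρ) (y j - y k) = 1 / (4 * Real.pi) *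
        (∑ k, c k * (if k = j then
        resolventProfile lam (ε * ρ) 0 + Real.log ρ + Real.eulerMascheroniConstant
      else resolventProfile lam (ε * ρ) (‖y j - y k‖ ^ 2 / 4))
        + c j * (-Real.eulerMascheroniConstant - Real.log ρ)) := by
      have h2 : c j * (-(Real.eulerMascheroniConstant : ℂ) - Real.log ρ)
          = ∑ k, if k = j then c k * (-(Real.eulerMascheroniConstant : ℂ) - Real.log ρ) else 0 := by
        simp
      rw [h2, ← Finset.sum_add_distrib, Finset.mul_sum]
      refine Finset.sum_congr rfl fun k _ => ?_
      rw [resolventKernel_eq]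
      split_ifs with h
      · subst h
        simp only [sub_self, norm_zero]
        norm_num
        ring
      · ring
    rw [h1]
    have hπ : (Real.pi : ℂ) ≠ 0 := by exact_mod_cast Real.pi_ne_zero
    push_cast
    field_simp
    ring
  rw [chargeSource, integral_eq_smul_integral_Ioo hr0, integral_eq_smul_integral_Ioo hr0,
    setIntegral_congr_fun measurableSet_Ioo hkern, setIntegral_congr_fun measurableSet_Ioo hsrc] at heq
  have hGi := hG.integrableOn_volterraI_mul hr0 hr.2
  have hLi : IntegrableOn (fun ρ =>
      ((volterraI (r - ρ) * (-Real.eulerMascheroniConstant - Real.log ρ) : ℝ) : ℂ)) (Ioo 0 r) :=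
    (integrableOn_volterraI_mul_gamma_add_log hr0).ofReal
  have hSi : IntegrableOn (fun ρ => (volterraI (r - ρ) : ℂ) *
      ∑ l, regularCoeff α y s ε j l ρ * q (s + ε * ρ) l) (Ioo 0 r) := by
    simp only [Finset.mul_sum]
    refine integrable_finsetSum _ fun l _ => ?_
    obtain ⟨M, hM⟩ := (isCompact_Icc.image_of_continuousOn (hcont l).norm).bddAbove
    have h := ((isNice_regularCoeff hα hy hε s j l R).integrableOn_volterraI_mul hr0 hr.2)
    have hsub : Ioo 0 r ⊆ Icc 0 R := fun ρ hρ => ⟨hρ.1.le, hρ.2.le.trans hr.2⟩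
    refine (Integrable.mul_bdd (c := M) h
      (((hcont l).mono hsub).aestronglyMeasurable measurableSet_Ioo) ?_).congr
      (Eventually.of_forall fun ρ => mul_assoc _ _ _)
    filter_upwards [ae_restrict_mem measurableSet_Ioo] with ρ hρ
    exact hM ⟨ρ, hsub hρ, rfl⟩
  -- Volterra's identity evaluates the convolution of `𝓘` with `-γ - log ρ` to `1`, so the singular
  -- part of the source contributes exactly the initial charge.
  rw [integral_neg, integral_const_mul, integral_const_mul, integral_add hGi (hLi.const_mul _),
    integral_const_mul, integral_complex_ofReal, volterraI_conv_log hr0] at heq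
  simp only [mul_add]
  rw [integral_add hGi hSi]
  have hπ : (Real.pi : ℂ) ≠ 0 := by exact_mod_cast Real.pi_ne_zero
  -- One factor `ε` comes from the orientation of the time integral and one from the oddness of `𝓘`;
  -- they cancel.
  have h3 : 4 * (Real.pi : ℂ) * (ε * (ε / (4 * Real.pi) * ((∫ ρ in Ioo 0 r, (volterraI (r - ρ) : ℂ) * regularSource y lam ε φ c j ρ) + c j * (1 : ℝ))))
      = (ε * ε) * ((∫ ρ in Ioo 0 r, (volterraI (r - ρ) : ℂ) * regularSource y lam ε φ c j ρ) + c j) := by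
    push_cast
    field_simp
  rw [h3, hε'] at heq
  linear_combination heq + (∫ ρ in Ioo 0 r, (volterraI (r - ρ) : ℂ) *
      ∑ l, regularCoeff α y s ε j l ρ * q (s + ε * ρ) l) * hε'

end PointInteraction

/-! ### Waves emitted by the centres -/

namespace PointInteraction

/-- The contribution of the charge `p` in the time span `[a, b]` to the amplitude at energy `w` and
time `R`. -/
noncomputable def timeIntegral (ε R : ℝ) (p : ℝ → ℂ) (a b w : ℝ) : ℂ :=
  ∫ r in a..b, Complex.exp ((-(w * (ε * (R - r))) : ℝ) * Complex.I) * p r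

theorem timeIntegral_eq (ε R : ℝ) (p : ℝ → ℂ) {a b : ℝ} (hab : a ≤ b) (w : ℝ) :
    timeIntegral ε R p a b w = Complex.exp ((-(ε * w * R) : ℝ) * Complex.I) *
      𝓕 ((Ioc a b).indicator p) (-ε / (2 * Real.pi) * w) := by
  rw [timeIntegral, Real.fourier_real_eq_integral_exp_smul, intervalIntegral.integral_of_le hab,
    ← integral_indicator measurableSet_Ioc, ← integral_const_mul]
  refine integral_congr_ae (Eventually.of_forall fun r => ?_)
  by_cases hr : r ∈ Ioc a b
  · simp only [indicator_of_mem hr, smul_eq_mul]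
    rw [← mul_assoc (Complex.exp _) (Complex.exp _) (p r), ← Complex.exp_add]
    congr 2
    have := Real.pi_ne_zero
    push_cast
    field_simp
    ring
  · simp only [indicator_of_notMem hr, smul_zero, mul_zero]

theorem timeIntegral_zero_eq (ε R : ℝ) (p : ℝ → ℂ) (b w : ℝ) :
    timeIntegral ε R p 0 b w = Complex.exp ((-(ε * w * R) : ℝ) * Complex.I) *
      ∫ r in (0 : ℝ)..b, Complex.exp ((ε * w * r : ℝ) * Complex.I) * p r := by
  rw [timeIntegral, ← intervalIntegral.integral_const_mul]
  refine intervalIntegral.integral_congr fun r _ => ?_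
  rw [← mul_assoc (Complex.exp _) (Complex.exp _) (p r), ← Complex.exp_add]
  congr 2
  push_cast
  ring

theorem boundaryTerm_eq_timeIntegral (ε lam R : ℝ) (p : ℝ → ℂ) (w : ℝ) :
    boundaryTerm ε lam R p w = Complex.I * ε * timeIntegral ε R p 0 R w
      - p R / ((w + lam : ℝ) : ℂ)
      + Complex.exp ((-(ε * w * R) : ℝ) * Complex.I) * p 0 / ((w + lam : ℝ) : ℂ) := by
  rw [boundaryTerm, timeIntegral_zero_eq, mul_assoc (Complex.I * (ε : ℂ))]

variable {ε R : ℝ} {p : ℝ → ℂ}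

theorem intervalIntegrable_timeIntegrand (hp : ContinuousOn p (Icc 0 R)) {a b : ℝ} (ha : a ∈ Icc 0 R)
    (hb : b ∈ Icc 0 R) (w : ℝ) : IntervalIntegrable
      (fun r => Complex.exp ((-(w * (ε * (R - r))) : ℝ) * Complex.I) * p r) volume a b := by
  refine ContinuousOn.intervalIntegrable (ContinuousOn.mul (Continuous.continuousOn (by fun_prop))
    (hp.mono ?_))
  exact (convex_Icc (0 : ℝ) R).ordConnected.uIcc_subset ha hb

theorem timeIntegral_add (hp : ContinuousOn p (Icc 0 R)) {b : ℝ} (hb : b ∈ Icc 0 R) (w : ℝ) :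
    timeIntegral ε R p 0 b w + timeIntegral ε R p b R w = timeIntegral ε R p 0 R w := by
  have hR : 0 ≤ R := hb.1.trans hb.2
  exact intervalIntegral.integral_add_adjacent_intervals
    (intervalIntegrable_timeIntegrand hp ⟨le_rfl, hR⟩ hb w)
    (intervalIntegrable_timeIntegrand hp hb ⟨hR, le_rfl⟩ w)

theorem integrable_indicator_of_continuousOn (hp : ContinuousOn p (Icc 0 R)) {a b : ℝ} (ha : 0 ≤ a)
    (hb : b ≤ R) : Integrable ((Ioc a b).indicator p) :=
  (integrable_indicator_iff measurableSet_Ioc).2 (hp.integrableOn_Icc.mono_set fun _ hr =>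
    ⟨ha.trans hr.1.le, hr.2.trans hb⟩)

theorem memLp_indicator_of_continuousOn (hp : ContinuousOn p (Icc 0 R)) {a b : ℝ} (ha : 0 ≤ a)
    (hb : b ≤ R) : MemLp ((Ioc a b).indicator p) 2 := by
  obtain ⟨M, hM⟩ := (isCompact_Icc.image_of_continuousOn hp.norm).bddAbove
  have hsub : Ioc a b ⊆ Icc 0 R := fun r hr => ⟨ha.trans hr.1.le, hr.2.trans hb⟩
  refine (memLp_indicator_iff_restrict measurableSet_Ioc).2 (MemLp.of_bound (C := M) ?_ ?_)
  · exact (hp.mono hsub).aestronglyMeasurable measurableSet_Ioc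
  · filter_upwards [ae_restrict_mem measurableSet_Ioc] with r hr
    exact hM ⟨r, hsub hr, rfl⟩

theorem continuous_timeIntegral (hp : ContinuousOn p (Icc 0 R)) {a b : ℝ} (ha : 0 ≤ a) (hab : a ≤ b)
    (hb : b ≤ R) : Continuous (timeIntegral ε R p a b) := by
  have : timeIntegral ε R p a b = fun w => Complex.exp ((-(ε * w * R) : ℝ) * Complex.I) *
      𝓕 ((Ioc a b).indicator p) (-ε / (2 * Real.pi) * w) := funext (timeIntegral_eq ε R p hab)
  rw [this]
  have hF := continuous_fourier_of_integrable (integrable_indicator_of_continuousOn hp ha hb)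
  exact Continuous.mul (by fun_prop) (hF.comp (by fun_prop))

/-- Plancherel in the time variable; the factor `2π` is the ratio between energy and frequency. -/
theorem lintegral_timeIntegral_le (hε : ε ^ 2 = 1) (hp : ContinuousOn p (Icc 0 R)) {M : NNReal}
    (hM : ∀ r ∈ Icc 0 R, ‖p r‖ ≤ M) {a b : ℝ} (ha : 0 ≤ a) (hab : a ≤ b) (hb : b ≤ R) :
    ∫⁻ w, ‖timeIntegral ε R p a b w‖ₑ ^ 2
      ≤ ENNReal.ofReal (2 * Real.pi) * (M ^ 2 * ENNReal.ofReal (b - a)) := by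
  have hε1 : |ε| = 1 := abs_eq_one_of_sq_eq_one hε
  have hε0 : ε ≠ 0 := by rintro rfl; simp at hε
  have hi := integrable_indicator_of_continuousOn hp ha hb
  have h2 := memLp_indicator_of_continuousOn hp ha hb
  have hsub : Ioc a b ⊆ Icc 0 R := fun r hr => ⟨ha.trans hr.1.le, hr.2.trans hb⟩
  set P := (Ioc a b).indicator p with hP
  have hc : -ε / (2 * Real.pi) ≠ 0 := div_ne_zero (neg_ne_zero.2 hε0) (by positivity)
  have hF : Measurable fun ν => ‖𝓕 P ν‖ₑ ^ 2 :=
    ((continuous_fourier_of_integrable hi).measurable.enorm).pow_const 2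
  have h3 : ∀ w, ‖timeIntegral ε R p a b w‖ₑ ^ 2 = ‖𝓕 P (-ε / (2 * Real.pi) * w)‖ₑ ^ 2 := by
    intro w
    rw [timeIntegral_eq ε R p hab, enorm_mul, ← ofReal_norm (Complex.exp _),
      Complex.norm_exp_ofReal_mul_I, ENNReal.ofReal_one, one_mul]
  have hplanch : ∫⁻ ν, ‖𝓕 P ν‖ₑ ^ 2 = ∫⁻ r, ‖P r‖ₑ ^ 2 := by
    have h := eLpNorm_fourier_eq h2 hi
    rw [eLpNorm_eq_lintegral_rpow_enorm_toReal (by norm_num) (by norm_num),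
      eLpNorm_eq_lintegral_rpow_enorm_toReal (by norm_num) (by norm_num)] at h
    have h' := ENNReal.rpow_left_injective (by norm_num) h
    simpa only [ENNReal.toReal_ofNat, ENNReal.rpow_two] using h'
  rw [lintegral_congr h3, lintegral_comp_mul_le hc hF, hplanch]
  refine mul_le_mul' (ENNReal.ofReal_le_ofReal (le_of_eq ?_)) ?_
  · rw [abs_inv, abs_div, abs_neg, hε1, abs_of_pos (by positivity), one_div, inv_inv]
  · calc ∫⁻ r, ‖P r‖ₑ ^ 2 ≤ ∫⁻ r, (Ioc a b).indicator (fun _ => (M : ℝ≥0∞) ^ 2) r := by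
          refine lintegral_mono fun r => ?_
          by_cases hr : r ∈ Ioc a b
          · rw [hP, indicator_of_mem hr, indicator_of_mem hr]
            exact pow_le_pow_left' (enorm_le_coe (hM r (hsub hr))) 2
          · rw [hP, indicator_of_notMem hr, indicator_of_notMem hr]; simp
      _ = _ := by
        rw [lintegral_indicator measurableSet_Ioc, setLIntegral_const, Real.volume_Ioc]

/-- The Fourier transform of the wave emitted by the centre `y` in the time span `[a, b]`. -/
noncomputable def waveSymbol (ε R : ℝ) (p : ℝ → ℂ) (a b : ℝ) (y ξ : Plane) : ℂ :=
  planeWave y ξ * timeIntegral ε R p a b (freq ξ)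

theorem continuous_waveSymbol (hp : ContinuousOn p (Icc 0 R)) {a b : ℝ} (ha : 0 ≤ a) (hab : a ≤ b)
    (hb : b ≤ R) (y : Plane) : Continuous (waveSymbol ε R p a b y) :=
  (continuous_planeWave y).mul ((continuous_timeIntegral hp ha hab hb).comp continuous_freq)

/-- Passing from the plane to the energy line costs `1/(4π)`, which together with the `2π` from
Plancherel in time is less than `1`. The bound is linear in `b - a`, so waves emitted during a short
span are small even next to the singular time. -/
theorem lintegral_waveSymbol_le (hε : ε ^ 2 = 1) (hp : ContinuousOn p (Icc 0 R)) {M : NNReal}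
    (hM : ∀ r ∈ Icc 0 R, ‖p r‖ ≤ M) {a b : ℝ} (ha : 0 ≤ a) (hab : a ≤ b) (hb : b ≤ R) (y : Plane) :
    ∫⁻ ξ, ‖waveSymbol ε R p a b y ξ‖ₑ ^ 2 ≤ M ^ 2 * ENNReal.ofReal (b - a) := by
  have h1 : ∀ ξ, ‖waveSymbol ε R p a b y ξ‖ₑ ^ 2 = ‖timeIntegral ε R p a b (freq ξ)‖ₑ ^ 2 := by
    intro ξ
    rw [waveSymbol, enorm_mul, ← ofReal_norm (planeWave y ξ), norm_planeWave, ENNReal.ofReal_one,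
      one_mul]
  have hm : Measurable fun w => ‖timeIntegral ε R p a b w‖ₑ ^ 2 :=
    ((continuous_timeIntegral hp ha hab hb).measurable.enorm).pow_const 2
  rw [lintegral_congr h1, lintegral_freq hm]
  calc _ ≤ ENNReal.ofReal (1 / (4 * Real.pi)) *
        (ENNReal.ofReal (2 * Real.pi) * (M ^ 2 * ENNReal.ofReal (b - a))) :=
        mul_le_mul_right ((setLIntegral_le_lintegral _ _).trans
          (lintegral_timeIntegral_le hε hp hM ha hab hb)) _
    _ ≤ 1 * (M ^ 2 * ENNReal.ofReal (b - a)) := by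
      rw [← mul_assoc, ← ENNReal.ofReal_mul (by positivity)]
      refine mul_le_mul_left ?_ _
      rw [← ENNReal.ofReal_one]
      refine ENNReal.ofReal_le_ofReal ?_
      have := Real.pi_pos
      field_simp
      norm_num
    _ = _ := one_mul _

theorem memLp_waveSymbol (hε : ε ^ 2 = 1) (hp : ContinuousOn p (Icc 0 R)) {a b : ℝ} (ha : 0 ≤ a)
    (hab : a ≤ b) (hb : b ≤ R) (y : Plane) : MemLp (waveSymbol ε R p a b y) 2 volume := by
  obtain ⟨M, hM⟩ := (isCompact_Icc.image_of_continuousOn hp.norm).bddAbove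
  rw [memLp_two_iff_lintegral (continuous_waveSymbol hp ha hab hb y).aestronglyMeasurable]
  refine (lintegral_waveSymbol_le hε hp (M := M.toNNReal) (fun r hr => ?_) ha hab hb y).trans_lt
    (by finiteness)
  exact (hM ⟨r, hr, rfl⟩).trans (Real.le_coe_toNNReal M)

/-- Because `b < R`, the time between emission and observation is at least `R - b`, so the kernels
are uniformly bounded and both exchanges of integrals are legitimate. -/
theorem waveSymbol_pairing (hε : ε ^ 2 = 1) (hp : ContinuousOn p (Icc 0 R)) {b : ℝ} (hb0 : 0 ≤ b)
    (hb : b < R) (y : Plane) (g : 𝓢(Plane, ℂ)) :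
    ∫ x, (𝓕 g : 𝓢(Plane, ℂ)) x *
        (∫ r in (0 : ℝ)..b, heatKernel (complexTime (ε * (R - r)) 0) (x - y) * p r)
      = ∫ ξ, g ξ * waveSymbol ε R p 0 b y ξ := by
  have hε1 : |ε| = 1 := abs_eq_one_of_sq_eq_one hε
  have hε0 : ε ≠ 0 := by rintro rfl; simp at hε
  have hsub : Ioc 0 b ⊆ Icc 0 R := fun r hr => ⟨hr.1.le, hr.2.trans hb.le⟩
  have hpi : IntegrableOn p (Ioc 0 b) := hp.integrableOn_Icc.mono_set hsub
  have hτ : ∀ r ∈ Ioc 0 b, ε * (R - r) ≠ 0 := fun r hr =>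
    mul_ne_zero hε0 (by linarith [hr.2])
  have hpm : AEStronglyMeasurable p (volume.restrict (Ioc 0 b)) := hpi.aestronglyMeasurable
  have h1 : ∀ x, (𝓕 g : 𝓢(Plane, ℂ)) x *
        (∫ r in (0 : ℝ)..b, heatKernel (complexTime (ε * (R - r)) 0) (x - y) * p r)
      = ∫ r in Ioc 0 b, (𝓕 g : 𝓢(Plane, ℂ)) x *
        (heatKernel (complexTime (ε * (R - r)) 0) (x - y) * p r) := by
    intro x
    rw [intervalIntegral.integral_of_le hb0, integral_const_mul]
  have h2 : ∀ r ∈ Ioc 0 b, ∫ x, (𝓕 g : 𝓢(Plane, ℂ)) x *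
        (heatKernel (complexTime (ε * (R - r)) 0) (x - y) * p r)
      = ∫ ξ, g ξ * (planeWave y ξ *
        (Complex.exp ((-(freq ξ * (ε * (R - r))) : ℝ) * Complex.I) * p r)) := by
    intro r hr
    have h3 := integral_fourier_mul_heatKernel (z := complexTime (ε * (R - r)) 0)
      (by rw [complexTime_re]) (complexTime_ne_zero_of_ne (hτ r hr) 0) y g
    calc _ = ∫ x, p r * ((𝓕 g : 𝓢(Plane, ℂ)) x *
          heatKernel (complexTime (ε * (R - r)) 0) (x - y)) := by
            congr 1; ext x; ring
      _ = _ := by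
        rw [integral_const_mul, h3, ← integral_const_mul]
        congr 1
        ext ξ
        have h4 : -(freq ξ : ℂ) * complexTime (ε * (R - r)) 0
            = ((-(freq ξ * (ε * (R - r))) : ℝ) : ℂ) * Complex.I := by
          rw [complexTime]; push_cast; ring
        rw [h4]
        ring
  simp only [h1]
  rw [integral_integral_swap, setIntegral_congr_fun measurableSet_Ioc h2, integral_integral_swap]
  · congr 1
    ext ξ
    rw [integral_const_mul, integral_const_mul, waveSymbol, timeIntegral,
      intervalIntegral.integral_of_le hb0]
  · refine (hpi.mul_prod (g.integrable (μ := volume))).norm.mono' ?_ (Eventually.of_forall fun z => ?_)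
    · have hg := g.continuous.measurable
      have hw := (continuous_planeWave y).measurable
      have hf := continuous_freq.measurable
      have hm : Measurable fun z : ℝ × Plane => g z.2 * (planeWave y z.2 *
          Complex.exp ((-(freq z.2 * (ε * (R - z.1))) : ℝ) * Complex.I)) := by fun_prop
      refine (hm.aestronglyMeasurable.mul hpm.comp_fst).congr (Eventually.of_forall fun z => ?_)
      simp only [Function.uncurry, Pi.mul_apply]
      ring
    · simp only [Function.uncurry]
      rw [norm_mul, norm_mul, norm_mul, norm_planeWave, Complex.norm_exp_ofReal_mul_I, one_mul,
        one_mul, norm_mul, mul_comm]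
  · refine (((𝓕 g : 𝓢(Plane, ℂ)).integrable (μ := volume)).mul_prod hpi).norm.mul_const
      (1 / (4 * Real.pi * (R - b))) |>.mono' ?_ ?_
    · have hg := (𝓕 g : 𝓢(Plane, ℂ)).continuous.measurable
      have hm : Measurable fun z : Plane × ℝ =>
          heatKernel (complexTime (ε * (R - z.2)) 0) (z.1 - y) := by
        unfold heatKernel complexTime
        fun_prop
      refine (((hg.comp measurable_fst).mul hm).aestronglyMeasurable.mul hpm.comp_snd).congr
        (Eventually.of_forall fun z => ?_)
      simp only [Function.uncurry, Pi.mul_apply, Function.comp_apply]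
      ring
    · have hpos : ∀ᵐ z : Plane × ℝ ∂(volume.prod (volume.restrict (Ioc 0 b))), z.2 ∈ Ioc 0 b :=
        Measure.quasiMeasurePreserving_snd.ae (ae_restrict_mem measurableSet_Ioc)
      filter_upwards [hpos] with z hz
      have h4 := norm_heatKernel_le (z := complexTime (ε * (R - z.2)) 0)
        (by rw [complexTime_re]) (z.1 - y)
      have h5 : R - b ≤ ‖complexTime (ε * (R - z.2)) 0‖ := by
        refine le_trans ?_ (abs_le_norm_complexTime _ _)
        rw [abs_mul, hε1, one_mul]
        exact le_trans (by linarith [hz.2]) (le_abs_self _)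
      have h6 : 0 < R - b := sub_pos.2 hb
      simp only [Function.uncurry]
      rw [norm_mul, norm_mul, norm_mul, mul_comm ‖heatKernel _ _‖, ← mul_assoc]
      refine mul_le_mul_of_nonneg_left (h4.trans ?_) (by positivity)
      gcongr

theorem locallyIntegrable_wave (hε : ε ^ 2 = 1) (hp : ContinuousOn p (Icc 0 R)) {b : ℝ} (hb0 : 0 ≤ b)
    (hb : b < R) (y : Plane) : LocallyIntegrable fun x =>
      ∫ r in (0 : ℝ)..b, heatKernel (complexTime (ε * (R - r)) 0) (x - y) * p r := by
  refine Continuous.locallyIntegrable ?_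
  have hε1 : |ε| = 1 := abs_eq_one_of_sq_eq_one hε
  have hsub : Ioc 0 b ⊆ Icc 0 R := fun r hr => ⟨hr.1.le, hr.2.trans hb.le⟩
  have hpi : IntegrableOn p (Ioc 0 b) := hp.integrableOn_Icc.mono_set hsub
  have h6 : 0 < R - b := sub_pos.2 hb
  simp only [intervalIntegral.integral_of_le hb0]
  refine continuous_of_dominated (bound := fun r => 1 / (4 * Real.pi * (R - b)) * ‖p r‖) ?_ ?_
    (hpi.norm.const_mul _) ?_
  · intro x
    refine AEStronglyMeasurable.mul (Measurable.aestronglyMeasurable ?_) hpi.aestronglyMeasurable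
    unfold heatKernel complexTime
    fun_prop
  · intro x
    filter_upwards [ae_restrict_mem measurableSet_Ioc] with r hr
    have h4 := norm_heatKernel_le (z := complexTime (ε * (R - r)) 0)
      (by rw [complexTime_re]) (x - y)
    have h5 : R - b ≤ ‖complexTime (ε * (R - r)) 0‖ := by
      refine le_trans ?_ (abs_le_norm_complexTime _ _)
      rw [abs_mul, hε1, one_mul]
      exact le_trans (by linarith [hr.2]) (le_abs_self _)
    rw [norm_mul]
    refine mul_le_mul_of_nonneg_right (h4.trans ?_) (norm_nonneg _)
    gcongr
  · refine Eventually.of_forall fun r => ?_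
    exact ((continuous_heatKernel _).comp (by fun_prop)).mul continuous_const

/-- The wave emitted by the centre `y` in the time span `[a, b]`, at time `R`. -/
noncomputable def waveL2 (hε : ε ^ 2 = 1) (hp : ContinuousOn p (Icc 0 R)) {a b : ℝ} (ha : 0 ≤ a)
    (hab : a ≤ b) (hb : b ≤ R) (y : Plane) : L2Plane :=
  𝓕⁻ ((memLp_waveSymbol hε hp ha hab hb y).toLp _ : L2Plane)

theorem fourier_waveL2 (hε : ε ^ 2 = 1) (hp : ContinuousOn p (Icc 0 R)) {a b : ℝ} (ha : 0 ≤ a)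
    (hab : a ≤ b) (hb : b ≤ R) (y : Plane) :
    ((𝓕 (waveL2 hε hp ha hab hb y) : L2Plane) : Plane → ℂ) =ᵐ[volume] waveSymbol ε R p a b y := by
  rw [waveL2, FourierInvPair.fourier_fourierInv_eq]
  exact MemLp.coeFn_toLp _

theorem waveL2_ae_eq (hε : ε ^ 2 = 1) (hp : ContinuousOn p (Icc 0 R)) {b : ℝ} (hb0 : 0 ≤ b)
    (hb : b < R) (y : Plane) : (waveL2 hε hp le_rfl hb0 hb.le y : Plane → ℂ) =ᵐ[volume] fun x =>
      ∫ r in (0 : ℝ)..b, heatKernel (complexTime (ε * (R - r)) 0) (x - y) * p r :=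
  eq_fourierInv_of_fourier_ae_eq (fourier_waveL2 hε hp le_rfl hb0 hb.le y)
    (locallyIntegrable_wave hε hp hb0 hb y) (waveSymbol_pairing hε hp hb0 hb y)

theorem waveL2_add (hε : ε ^ 2 = 1) (hp : ContinuousOn p (Icc 0 R)) {b : ℝ} (hb0 : 0 ≤ b)
    (hb : b ≤ R) (y : Plane) : waveL2 hε hp le_rfl hb0 hb y + waveL2 hε hp hb0 hb le_rfl y
      = waveL2 hε hp le_rfl (hb0.trans hb) le_rfl y := by
  rw [waveL2, waveL2, waveL2, ← FourierInvAdd.fourierInv_add]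
  congr 1
  refine Lp.ext ?_
  filter_upwards [Lp.coeFn_add ((memLp_waveSymbol hε hp le_rfl hb0 hb y).toLp _)
    ((memLp_waveSymbol hε hp hb0 hb le_rfl y).toLp _),
    (memLp_waveSymbol hε hp le_rfl hb0 hb y).coeFn_toLp,
    (memLp_waveSymbol hε hp hb0 hb le_rfl y).coeFn_toLp,
    (memLp_waveSymbol hε hp le_rfl (hb0.trans hb) le_rfl y).coeFn_toLp] with ξ h1 h2 h3 h4
  rw [h1, Pi.add_apply, h2, h3, h4, waveSymbol, waveSymbol, waveSymbol, ← mul_add,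
    timeIntegral_add hp ⟨hb0, hb⟩]

theorem norm_waveL2_le (hε : ε ^ 2 = 1) (hp : ContinuousOn p (Icc 0 R)) {M : NNReal}
    (hM : ∀ r ∈ Icc 0 R, ‖p r‖ ≤ M) {a b : ℝ} (ha : 0 ≤ a) (hab : a ≤ b) (hb : b ≤ R) (y : Plane) :
    ‖waveL2 hε hp ha hab hb y‖ ≤ M * √(b - a) := by
  rw [waveL2, ← Lp.norm_fourier_eq, FourierInvPair.fourier_fourierInv_eq, Lp.norm_toLp]
  refine ENNReal.toReal_le_of_le_ofReal (by positivity) ?_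
  rw [eLpNorm_eq_lintegral_rpow_enorm_toReal (by norm_num) (by norm_num)]
  simp only [ENNReal.toReal_ofNat, ENNReal.rpow_two]
  rw [one_div, ENNReal.rpow_inv_le_iff (by norm_num), ENNReal.rpow_two,
    ← ENNReal.ofReal_pow (by positivity), mul_pow, Real.sq_sqrt (sub_nonneg.2 hab),
    ENNReal.ofReal_mul (by positivity), ENNReal.ofReal_pow M.coe_nonneg, ENNReal.ofReal_coe_nnreal]
  exact lintegral_waveSymbol_le hε hp hM ha hab hb y

end PointInteraction

/-! ### Evolution and regular part in Fourier space -/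

namespace PointInteraction

theorem mul_freeKernel_eq_heatKernel (τ : ℝ) (x : Plane) :
    Complex.I / (2 * Real.pi) * freeKernel τ ‖x‖ = Complex.I * heatKernel (complexTime τ 0) x := by
  have hπ : (Real.pi : ℂ) ≠ 0 := by exact_mod_cast Real.pi_ne_zero
  have h1 : -(‖x‖ : ℂ) ^ 2 / (4 * Complex.I * τ) = -(‖x‖ : ℂ) ^ 2 / (4 * (0 + τ * Complex.I)) := by
    congr 1; ring
  rw [freeKernel, heatKernel, complexTime, h1, Complex.ofReal_zero]
  generalize Complex.exp _ = E
  -- At `τ = 0` both kernels are `0` by the convention for division by zero.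
  rcases eq_or_ne τ 0 with rfl | hτ
  · simp
  · have hτ' : (τ : ℂ) ≠ 0 := by exact_mod_cast hτ
    rw [zero_add]
    field_simp
    ring

theorem chargeTerm_eq {N : ℕ} (y : Fin N → Plane) (s : ℝ) {ε R : ℝ} (q : ℝ → Fin N → ℂ) (θ : ℝ)
    (x : Plane) : chargeTerm y s (s + ε * R) q θ x = ∑ j, Complex.I * ε *
      ∫ r in (0 : ℝ)..(θ * R), heatKernel (complexTime (ε * (R - r)) 0) (x - y j)
        * q (s + ε * r) j := by
  rw [chargeTerm, Finset.mul_sum]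
  refine Finset.sum_congr rfl fun j _ => ?_
  have h := intervalIntegral.smul_integral_comp_add_mul (a := 0) (b := θ * R)
    (fun τ => freeKernel (s + ε * R - τ) ‖x - y j‖ * q τ j) ε s
  rw [mul_zero, add_zero] at h
  rw [show s + θ * (s + ε * R - s) = s + ε * (θ * R) by ring, ← h, Complex.real_smul, ← mul_assoc,
    mul_comm _ (ε : ℂ), mul_assoc, ← intervalIntegral.integral_const_mul,
    ← intervalIntegral.integral_const_mul, ← intervalIntegral.integral_const_mul]
  refine intervalIntegral.integral_congr fun r _ => ?_
  rw [← mul_assoc (Complex.I / (2 * (Real.pi : ℂ))), mul_freeKernel_eq_heatKernel,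
    show s + ε * R - (s + ε * r) = ε * (R - r) by ring]
  ring

theorem memH_one_iff (f : L2Plane) {m : Plane → ℂ} (hf : ((𝓕 f : L2Plane) : Plane → ℂ) =ᵐ[volume] m) :
    MemH 1 f ↔ MemLp (fun ξ => (((1 + ‖ξ‖ ^ 2) ^ ((1 : ℝ) / 2) : ℝ) : ℂ) * m ξ) 2 volume := by
  rw [MemH, memSobolev_iff_memLp_fourier]
  refine memLp_congr_ae ?_
  filter_upwards [hf] with ξ hξ
  rw [hξ]

theorem measurable_boundaryTerm {ε lam R : ℝ} {p : ℝ → ℂ} (hR : 0 ≤ R)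
    (hp : ContinuousOn p (Icc 0 R)) : Measurable (boundaryTerm ε lam R p) := by
  have : boundaryTerm ε lam R p = fun w => Complex.I * ε * timeIntegral ε R p 0 R w
      - p R / ((w + lam : ℝ) : ℂ)
      + Complex.exp ((-(ε * w * R) : ℝ) * Complex.I) * p 0 / ((w + lam : ℝ) : ℂ) :=
    funext (boundaryTerm_eq_timeIntegral ε lam R p)
  rw [this]
  have h := (continuous_timeIntegral (ε := ε) hp le_rfl hR le_rfl).measurable
  fun_prop

/-- Plane waves have modulus one and `1 + ‖ξ‖² ≤ 1 + ω`, so everything depends on the energy alone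
and reduces to an integral over the half line. -/
theorem memLp_weight_mul_boundaryTerm {ε lam R : ℝ} {p : ℝ → ℂ} (hR : 0 ≤ R)
    (hp : ContinuousOn p (Icc 0 R))
    (hB : ∫⁻ w in Ioi 0, ENNReal.ofReal (1 + w) * ‖boundaryTerm ε lam R p w‖ₑ ^ 2 < ∞) (y : Plane) :
    MemLp (fun ξ => (((1 + ‖ξ‖ ^ 2) ^ ((1 : ℝ) / 2) : ℝ) : ℂ) *
      (planeWave y ξ * boundaryTerm ε lam R p (freq ξ))) 2 volume := by
  have hm := measurable_boundaryTerm (ε := ε) (lam := lam) hR hp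
  have hf := continuous_freq.measurable
  have hw := (continuous_planeWave y).measurable
  rw [memLp_two_iff_lintegral (Measurable.aestronglyMeasurable (by fun_prop))]
  have h1 : ∀ ξ : Plane, ‖(((1 + ‖ξ‖ ^ 2) ^ ((1 : ℝ) / 2) : ℝ) : ℂ) *
      (planeWave y ξ * boundaryTerm ε lam R p (freq ξ))‖ₑ ^ 2
      ≤ ENNReal.ofReal (1 + freq ξ) * ‖boundaryTerm ε lam R p (freq ξ)‖ₑ ^ 2 := by
    intro ξ
    rw [enorm_mul, enorm_mul, ← ofReal_norm (planeWave y ξ), norm_planeWave, ENNReal.ofReal_one,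
      one_mul, mul_pow, ← ofReal_norm, Complex.norm_real, Real.norm_of_nonneg (by positivity),
      ← ENNReal.ofReal_pow (by positivity), ← Real.sqrt_eq_rpow, Real.sq_sqrt (by positivity)]
    refine mul_le_mul_left (ENNReal.ofReal_le_ofReal ?_) _
    rw [freq, mul_pow]
    have := Real.pi_gt_three
    nlinarith [sq_nonneg ‖ξ‖, mul_nonneg (sq_nonneg ‖ξ‖) (show 0 ≤ (2 * Real.pi) ^ 2 - 1 by nlinarith)]
  refine (lintegral_mono h1).trans_lt ?_
  have h2 : Measurable fun w => ENNReal.ofReal (1 + w) * ‖boundaryTerm ε lam R p w‖ₑ ^ 2 := by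
    fun_prop
  rw [lintegral_freq h2]
  exact ENNReal.mul_lt_top ENNReal.ofReal_lt_top hB

theorem memLp_weight_mul_freeSymbol {φ : L2Plane} (hφ : MemH 2 φ) (t : ℝ) :
    MemLp (fun ξ => (((1 + ‖ξ‖ ^ 2) ^ ((1 : ℝ) / 2) : ℝ) : ℂ) *
      (freeSymbol t ξ * (𝓕 φ : L2Plane) ξ)) 2 volume := by
  have h1 : MemH 1 φ := TemperedDistribution.MemSobolev.mono one_le_two hφ
  have h2 := (memH_one_iff φ EventuallyEq.rfl).1 h1
  refine h2.of_le ?_ (Eventually.of_forall fun ξ => le_of_eq ?_)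
  · refine AEStronglyMeasurable.mul (Measurable.aestronglyMeasurable (by fun_prop))
      ((continuous_freeSymbol t).aestronglyMeasurable.mul (Lp.aestronglyMeasurable _))
  · rw [norm_mul, norm_mul, norm_mul, norm_freeSymbol, one_mul]

/-- The cut-off wave is a function with a pointwise formula. What it lacks is the wave emitted
during `[θR, R]`, whose norm is at most `M √(R - θR)` and vanishes as `θ ↑ 1`. -/
theorem isEvolution_waveL2 {N : ℕ} (y : Fin N → Plane) (s : ℝ) (ψ : L2Plane) {q : ℝ → Fin N → ℂ}
    {ε R : ℝ} (hε : ε ^ 2 = 1) (hR : 0 < R)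
    (hp : ∀ j, ContinuousOn (fun r => q (s + ε * r) j) (Icc 0 R)) :
    IsEvolution y s (s + ε * R) q ψ (freeProp (s + ε * R - s) ψ +
      ∑ j, (Complex.I * ε) • waveL2 hε (hp j) le_rfl hR.le le_rfl (y j)) := by
  have hM : ∀ j, ∃ M : NNReal, ∀ r ∈ Icc 0 R, ‖q (s + ε * r) j‖ ≤ M := by
    intro j
    obtain ⟨M, hM⟩ := (isCompact_Icc.image_of_continuousOn (hp j).norm).bddAbove
    exact ⟨M.toNNReal, fun r hr => (hM ⟨r, hr, rfl⟩).trans (Real.le_coe_toNNReal M)⟩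
  choose M hM using hM
  have hε1 : ‖Complex.I * (ε : ℂ)‖ = 1 := by
    rw [norm_mul, Complex.norm_I, one_mul, Complex.norm_real, Real.norm_eq_abs]
    rw [← sq_abs] at hε
    exact (pow_eq_one_iff_of_nonneg (abs_nonneg ε) two_ne_zero).1 hε
  have hlim : Tendsto (fun θ : ℝ => ENNReal.ofReal (∑ j, M j * √(R - θ * R))) (𝓝[<] 1) (𝓝 0) := by
    have hc : Continuous fun θ : ℝ => ENNReal.ofReal (∑ j, M j * √(R - θ * R)) :=
      ENNReal.continuous_ofReal.comp (by fun_prop)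
    have := hc.tendsto 1
    simp only [one_mul, sub_self, Real.sqrt_zero, mul_zero, Finset.sum_const_zero,
      ENNReal.ofReal_zero] at this
    exact this.mono_left nhdsWithin_le_nhds
  refine tendsto_of_tendsto_of_tendsto_of_le_of_le' tendsto_const_nhds hlim
    (Eventually.of_forall fun _ => zero_le) ?_
  filter_upwards [self_mem_nhdsWithin, mem_nhdsWithin_of_mem_nhds (Ioi_mem_nhds zero_lt_one)]
    with θ hθ1 hθ0
  have hθ1 : θ < 1 := hθ1
  have hθ0 : 0 < θ := hθ0
  have hb0 : 0 ≤ θ * R := by positivity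
  have hb : θ * R < R := by nlinarith
  have hae : (fun x : Plane => (freeProp (s + ε * R - s) ψ +
      ∑ j, (Complex.I * ε) • waveL2 hε (hp j) le_rfl hR.le le_rfl (y j) : L2Plane) x
        - freeProp (s + ε * R - s) ψ x - chargeTerm y s (s + ε * R) q θ x) =ᵐ[volume]
      ((∑ j, (Complex.I * ε) • waveL2 hε (hp j) hb0 hb.le le_rfl (y j) : L2Plane) : Plane → ℂ) := by
    have h1 : ∑ j, (Complex.I * (ε : ℂ)) • waveL2 hε (hp j) le_rfl hR.le le_rfl (y j)
        = ∑ j, (Complex.I * (ε : ℂ)) • waveL2 hε (hp j) le_rfl hb0 hb.le (y j)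
          + ∑ j, (Complex.I * (ε : ℂ)) • waveL2 hε (hp j) hb0 hb.le le_rfl (y j) := by
      rw [← Finset.sum_add_distrib]
      refine Finset.sum_congr rfl fun j _ => ?_
      rw [← smul_add, waveL2_add]
    have h2 : ∀ᵐ x : Plane, ∀ j, ((Complex.I * (ε : ℂ)) • waveL2 hε (hp j) le_rfl hb0 hb.le (y j) :
        L2Plane) x = Complex.I * ε * ∫ r in (0 : ℝ)..(θ * R),
          heatKernel (complexTime (ε * (R - r)) 0) (x - y j) * q (s + ε * r) j := by
      refine ae_all_iff.2 fun j => ?_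
      filter_upwards [Lp.coeFn_smul (Complex.I * (ε : ℂ)) (waveL2 hε (hp j) le_rfl hb0 hb.le (y j)),
        waveL2_ae_eq hε (hp j) hb0 hb (y j)] with x h3 h4
      rw [h3, Pi.smul_apply, h4, smul_eq_mul]
    rw [h1]
    filter_upwards [h2, Lp.coeFn_add (freeProp (s + ε * R - s) ψ)
      (∑ j, (Complex.I * (ε : ℂ)) • waveL2 hε (hp j) le_rfl hb0 hb.le (y j)
          + ∑ j, (Complex.I * (ε : ℂ)) • waveL2 hε (hp j) hb0 hb.le le_rfl (y j)),
      Lp.coeFn_add (∑ j, (Complex.I * (ε : ℂ)) • waveL2 hε (hp j) le_rfl hb0 hb.le (y j))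
        (∑ j, (Complex.I * (ε : ℂ)) • waveL2 hε (hp j) hb0 hb.le le_rfl (y j)),
      Lp.coeFn_finsetSum Finset.univ fun j =>
        (Complex.I * (ε : ℂ)) • waveL2 hε (hp j) le_rfl hb0 hb.le (y j)] with x h3 h4 h5 h6
    rw [h4, Pi.add_apply, h5, Pi.add_apply, h6, Finset.sum_apply, chargeTerm_eq]
    simp only [h3]
    ring
  rw [eLpNorm_congr_ae hae, ← Lp.enorm_def, ← ofReal_norm]
  refine ENNReal.ofReal_le_ofReal ((norm_sum_le _ _).trans (Finset.sum_le_sum fun j _ => ?_))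
  rw [norm_smul, hε1, one_mul]
  exact norm_waveL2_le hε (hp j) (hM j) hb0 hb.le le_rfl (y j)

theorem fourier_sum_L2 {ι : Type*} (s : Finset ι) (f : ι → L2Plane) :
    (𝓕 (∑ i ∈ s, f i) : L2Plane) = ∑ i ∈ s, (𝓕 (f i) : L2Plane) := by
  classical
  induction s using Finset.induction_on with
  | empty => simp
  | insert a s ha ih =>
    rw [Finset.sum_insert ha, Finset.sum_insert ha, FourierAdd.fourier_add, ih]

/-- For each centre three pieces combine: the freely evolved initial singularity, the emitted wave
and the subtracted final singularity. In Fourier space each is the same plane wave times a function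
of the energy, and these functions add up to `boundaryTerm`. The remaining piece is the free
evolution of `φ`, which preserves Sobolev regularity. -/
theorem hasFormCharges_waveL2 {N : ℕ} (y : Fin N → Plane) {lam : ℝ} (hlam : 0 < lam) (s : ℝ)
    {φ ψ : L2Plane} (hφ : MemH 2 φ) {q : ℝ → Fin N → ℂ}
    (hψ : ∀ᵐ x : Plane, ψ x = φ x + singularPart y lam (q s) x)
    {ε R : ℝ} (hε : ε ^ 2 = 1) (hR : 0 < R)
    (hp : ∀ j, ContinuousOn (fun r => q (s + ε * r) j) (Icc 0 R))
    (hB : ∀ j, ∫⁻ w in Ioi 0, ENNReal.ofReal (1 + w) *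
      ‖boundaryTerm ε lam R (fun r => q (s + ε * r) j) w‖ₑ ^ 2 < ∞) :
    HasFormCharges y lam (freeProp (s + ε * R - s) ψ +
      ∑ j, (Complex.I * ε) • waveL2 hε (hp j) le_rfl hR.le le_rfl (y j)) (q (s + ε * R)) := by
  set Φ : L2Plane := freeProp (s + ε * R - s) φ + ∑ j, (q s j • freeProp (s + ε * R - s)
    (resolventL2 hlam (y j)) + (Complex.I * (ε : ℂ)) • waveL2 hε (hp j) le_rfl hR.le le_rfl (y j)
    + (-q (s + ε * R) j) • resolventL2 hlam (y j)) with hΦ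
  have h1 : ψ = φ + ∑ j, q s j • resolventL2 hlam (y j) := by
    refine Lp.ext ?_
    filter_upwards [hψ, singularPart_ae_eq y hlam (q s),
      Lp.coeFn_add φ (∑ j, q s j • resolventL2 hlam (y j))] with x h2 h3 h4
    rw [h4, Pi.add_apply, h2, h3]
  have h2 : freeProp (s + ε * R - s) ψ +
      ∑ j, (Complex.I * (ε : ℂ)) • waveL2 hε (hp j) le_rfl hR.le le_rfl (y j)
      = Φ + ∑ j, q (s + ε * R) j • resolventL2 hlam (y j) := by
    rw [h1, freeProp_add, freeProp_sum, hΦ, add_assoc, add_assoc, ← Finset.sum_add_distrib,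
      ← Finset.sum_add_distrib]
    congr 1
    refine Finset.sum_congr rfl fun j _ => ?_
    rw [freeProp_smul, neg_smul, neg_add_cancel_right]
  refine ⟨Φ, ?_, ?_⟩
  · have hF : ((𝓕 Φ : L2Plane) : Plane → ℂ) =ᵐ[volume] fun ξ =>
        freeSymbol (s + ε * R - s) ξ * (𝓕 φ : L2Plane) ξ + ∑ j, planeWave (y j) ξ *
          boundaryTerm ε lam R (fun r => q (s + ε * r) j) (freq ξ) := by
      obtain ⟨T, hT⟩ : ∃ T : Fin N → L2Plane, T = fun j => q s j •
          (𝓕 (freeProp (s + ε * R - s) (resolventL2 hlam (y j))) : L2Plane) +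
          (Complex.I * (ε : ℂ)) • (𝓕 (waveL2 hε (hp j) le_rfl hR.le le_rfl (y j)) : L2Plane)
          + (-q (s + ε * R) j) • (𝓕 (resolventL2 hlam (y j)) : L2Plane) := ⟨_, rfl⟩
      have hFΦ : (𝓕 Φ : L2Plane) = 𝓕 (freeProp (s + ε * R - s) φ) + ∑ j, T j := by
        rw [hT, hΦ, FourierAdd.fourier_add, fourier_sum_L2]
        simp only [FourierAdd.fourier_add, FourierSMul.fourier_smul]
      have hj : ∀ᵐ ξ : Plane, ∀ j, T j ξ
          = planeWave (y j) ξ * boundaryTerm ε lam R (fun r => q (s + ε * r) j) (freq ξ) := by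
        refine ae_all_iff.2 fun j => ?_
        simp only [hT]
        have e1 := fourier_freeProp (s + ε * R - s) (resolventL2 hlam (y j))
        have e2 := fourier_resolventL2 hlam (y j)
        have e3 := fourier_waveL2 hε (hp j) le_rfl hR.le le_rfl (y j)
        generalize (𝓕 (freeProp (s + ε * R - s) (resolventL2 hlam (y j))) : L2Plane) = f1 at e1
        generalize (𝓕 (resolventL2 hlam (y j)) : L2Plane) = f2 at e1 e2
        generalize (𝓕 (waveL2 hε (hp j) le_rfl hR.le le_rfl (y j)) : L2Plane) = f3 at e3
        filter_upwards [e1, e2, e3,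
          Lp.coeFn_add (q s j • f1 + (Complex.I * (ε : ℂ)) • f3) ((-q (s + ε * R) j) • f2),
          Lp.coeFn_add (q s j • f1) ((Complex.I * (ε : ℂ)) • f3),
          Lp.coeFn_smul (q s j) f1, Lp.coeFn_smul (Complex.I * (ε : ℂ)) f3,
          Lp.coeFn_smul (-q (s + ε * R) j) f2] with ξ a1 a2 a3 a4 a5 a6 a7 a8
        rw [a4, Pi.add_apply, a5, Pi.add_apply, a6, a7, a8, Pi.smul_apply, Pi.smul_apply,
          Pi.smul_apply, a1, a2, a3, boundaryTerm_eq_timeIntegral, waveSymbol, resolventSymbol,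
          freeSymbol_eq, smul_eq_mul, smul_eq_mul, smul_eq_mul]
        have e4 : -(freq ξ * (s + ε * R - s)) = -(ε * freq ξ * R) := by ring
        rw [e4, mul_zero, add_zero]
        ring
      rw [hFΦ]
      have e0 := fourier_freeProp (s + ε * R - s) φ
      generalize (𝓕 (freeProp (s + ε * R - s) φ) : L2Plane) = f0 at e0
      filter_upwards [e0, hj, Lp.coeFn_add f0 (∑ j, T j), Lp.coeFn_finsetSum Finset.univ T]
        with ξ a0 a1 a2 a3
      rw [a2, Pi.add_apply, a0, a3, Finset.sum_apply]
      simp only [a1]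
    rw [memH_one_iff Φ hF]
    have hsum := memLp_finsetSum (μ := (volume : Measure Plane)) (p := 2) Finset.univ fun j _ =>
      memLp_weight_mul_boundaryTerm hR.le (hp j) (hB j) (y j)
    refine (memLp_congr_ae (Eventually.of_forall fun ξ => ?_)).1
      ((memLp_weight_mul_freeSymbol hφ (s + ε * R - s)).add hsum)
    simp only [Pi.add_apply]
    rw [mul_add, Finset.mul_sum]
  · rw [h2]
    filter_upwards [singularPart_ae_eq y hlam (q (s + ε * R)),
      Lp.coeFn_add Φ (∑ j, q (s + ε * R) j • resolventL2 hlam (y j))] with x h3 h4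
    rw [h4, Pi.add_apply, h3]

end PointInteraction

/-! ### The initial time and conclusion -/

namespace PointInteraction

theorem freeProp_zero_time (f : L2Plane) : freeProp 0 f = f := by
  rw [← FourierPair.fourierInv_fourier_eq (F := L2Plane) (freeProp 0 f)]
  have : (𝓕 (freeProp 0 f) : L2Plane) = 𝓕 f := by
    refine Lp.ext ?_
    filter_upwards [fourier_freeProp 0 f] with ξ h
    rw [h]
    simp [freeSymbol]
  rw [this, FourierPair.fourierInv_fourier_eq]

theorem isEvolution_self {N : ℕ} (y : Fin N → Plane) (s : ℝ) (ψ : L2Plane) (q : ℝ → Fin N → ℂ) :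
    IsEvolution y s s q ψ ψ := by
  refine tendsto_const_nhds.congr fun θ => ?_
  simp [freeProp_zero_time, chargeTerm]

end PointInteraction

theorem mainTheorem3 {N : ℕ} (y : Fin N → PointInteraction.Plane) (hy : Function.Injective y)
    (α : Fin N → ℝ → ℝ) (hα : ∀ j, ContDiff ℝ 1 (α j)) (lam : ℝ) (hlam : 0 < lam)
    (s : ℝ) (ψ : PointInteraction.L2Plane) (c : Fin N → ℂ)
    (hψ : PointInteraction.HasOperatorCharges (fun j => α j s) y lam ψ c)
    (J : Set ℝ) (hJ : J.OrdConnected) (hs : s ∈ J) (q : ℝ → Fin N → ℂ)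
    (hq : PointInteraction.IsChargeSolution α y s ψ c J q) (t : ℝ) (ht : t ∈ J) :
    ∃ Ψ : PointInteraction.L2Plane,
      PointInteraction.IsEvolution y s t q ψ Ψ ∧
      Ψ ∈ PointInteraction.formDomain y lam ∧
      PointInteraction.HasFormCharges y lam Ψ (q t) := by
  suffices h : ∃ Ψ : PointInteraction.L2Plane, PointInteraction.IsEvolution y s t q ψ Ψ ∧
      PointInteraction.HasFormCharges y lam Ψ (q t) by
    obtain ⟨Ψ, h1, h2⟩ := h
    exact ⟨Ψ, h1, ⟨q t, h2⟩, h2⟩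
  obtain ⟨φ, hφ, hφψ, -⟩ := hψ
  rcases eq_or_ne t s with rfl | hts
  · rw [hq.initial]
    exact ⟨ψ, PointInteraction.isEvolution_self y t ψ q, φ,
      TemperedDistribution.MemSobolev.mono one_le_two hφ, hφψ⟩
  -- Here `ε` is the direction of time and `R` the elapsed time, so future and past are treated by
  -- one argument.
  · obtain ⟨ε, R, hε, hR, rfl⟩ : ∃ ε R : ℝ, ε ^ 2 = 1 ∧ 0 < R ∧ t = s + ε * R := by
      rcases lt_or_gt_of_ne hts with h | h
      · exact ⟨-1, s - t, by norm_num, by linarith, by ring⟩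
      · exact ⟨1, t - s, by norm_num, by linarith, by ring⟩
    -- Each intermediate time is a convex combination of `s` and `t`, with weight `r/R`; written so,
    -- the inclusion needs no distinction of the sign of `ε`.
    have hmem : ∀ r ∈ Icc 0 R, s + ε * r ∈ J := by
      intro r hr
      refine hJ.uIcc_subset hs ht ?_
      have h1 : s + ε * r = (1 - r / R) • s + (r / R) • (s + ε * R) := by
        simp only [smul_eq_mul]
        field_simp
        ring
      rw [h1, ← segment_eq_uIcc]
      exact ⟨1 - r / R, r / R, sub_nonneg.2 (div_le_one_of_le₀ hr.2 hR.le), div_nonneg hr.1 hR.le,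
        by ring, rfl⟩
    have hp : ∀ j, ContinuousOn (fun r => q (s + ε * r) j) (Icc 0 R) := by
      intro j
      have h1 : ContinuousOn (fun r => q (s + ε * r)) (Icc 0 R) :=
        hq.continuousOn.comp (by fun_prop) hmem
      exact (continuous_apply j).comp_continuousOn h1
    refine ⟨_, PointInteraction.isEvolution_waveL2 y s ψ hε hR hp,
      PointInteraction.hasFormCharges_waveL2 y hlam s hφ (by rwa [hq.initial]) hε hR hp fun j => ?_⟩
    refine PointInteraction.lintegral_boundaryTerm_lt_top_of_volterra hε hR hlam hp
      (fun j => PointInteraction.isNice_regularSource hy hε hlam hφ c j R)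
      (fun j l => PointInteraction.isNice_regularCoeff hα hy hε s j l R) (fun j r hr => ?_) j
    rw [← PointInteraction.charge_equation_of_isChargeSolution hy hα hlam hφ hφψ hq hε hmem j hr,
      mul_zero, add_zero, hq.initial]
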